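/- Let $m\ge 2$, $\mathcal A=\{1,\dots,m\}$, and let $\zeta:\mathcal A\to\mathcal A^+$ be a substitution (each letter is sent to a non-empty finite word), extended to words by concatenation, with substitution matrix $\mathsf S_\zeta(i,j)=$ number of symbols $i$ in $\zeta(j)$. Let $X_\zeta\subset\mathcal A^{\mathbb Z}$ be the set of two-sided sequences all of whose finite subwords are subwords of $\zeta^n(b)$ for some $b\in\mathcal A$, $n\ge1$, and let $T$ be the left shift. Assume that $\zeta$ is primitive (some power $\mathsf S_\zeta^k$, $k\ge 1$, has strictly positive entries) and aperiodic ($T$ has no periodic points in $X_\zeta$). Let $\theta_1$ be the Perron–Frobenius eigenvalue of $\mathsf S_\zeta$ and $\mu$ the unique $T$-invariant Borel probability measure on $X_\zeta$. For $\zeta(b)=u_1^b\dots u_{|\zeta(b)|}^b$ and $\xi\in\mathbb T^m=\mathbb R^m/\mathbb Z^m$ let $\mathscr M_\zeta(\xi)$ be the $m\times m$ matrix with entries $$\mathscr M_\zeta(\xi)_{b,c}=\sum_{j\le|\zeta(b)|,\ u_j^b=c}\exp\Bigl(-2\pi i\sum_{k=1}^{j-1}\xi_{u_k^b}\Bigr),\qquad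 b,c\in\mathcal A,$$ let $E_\zeta(\xi)=\mathsf S_\zeta^t\,\xi \pmod{\mathbb Z^m}$, and let $\mathscr M_\zeta(\xi,n)=\mathscr M_\zeta(E_\zeta^{n-1}\xi)\cdots\mathscr M_\zeta(E_\zeta\xi)\mathscr M_\zeta(\xi)$ be the spectral cocycle. For $\vec s\in\mathbb R^m_+$ (all $s_a>0$) let $(\mathfrak X_\zeta^{\vec s},\widetilde\mu,h_t)$ be the suspension flow over $(X_\zeta,\mu,T)$ with roof function $x\mapsto s_{x_0}$: it lives on $\mathfrak X_\zeta^{\vec s}=\{(x,t):x\in X_\zeta,\ 0\le t<s_{x_0}\}$ with $\widetilde\mu$ the restriction of $\mu\times$Lebesgue, and moves points at unit speed in the second coordinate, with $(x,s_{x_0})$ identified with $(Tx,0)$. For $f\in L^2(\widetilde\mu)$ the spectral measure $\sigma_f$ is the finite positive Borel measure on $\mathbb R$ with $\int e^{2\pi i\omega t}\,d\sigma_f(\omega)=\langle f\circ h_t,f\rangle$ for all $t\in\mathbb R$. A cylindrical function is a function $f(x,t)=\psi_{x_0}(t)$ with $\psi_a:[0,s_a]\to\mathbb C$ Lipschitz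 for each $a\in\mathcal A$. The flow has purely singular spectrum if $\sigma_f$ is singular with respect to Lebesgue measure for every $f\in L^2(\widetilde\mu)$. Suppose that $E_\zeta$ is ergodic with respect to the Haar measure of $\mathbb T^m$ (in particular it preserves it). Then there is a real number $\chi(\mathscr M_\zeta)$, the top Lyapunov exponent, such that $\lim_{n\to\infty}\frac1n\log\|\mathscr M_\zeta(\xi,n)\|=\chi(\mathscr M_\zeta)$ for a.e. $\xi\in\mathbb T^m$, and: (i) $\chi(\mathscr M_\zeta)\le\frac12\log\theta_1$; (ii) if $\chi(\mathscr M_\zeta)<\frac12\log\theta_1$, then for Lebesgue-a.e. $\vec s\in\mathbb R^m_+$, for every cylindrical function $f$ on $\mathfrak X_\zeta^{\vec s}$, the spectral measure $\sigma_f$ is singular with respect to Lebesgue measure; (iii) if $\chi(\mathscr M_\zeta)<\frac12\log\theta_1$ and $\det\mathscr M_\zeta(\xi)\not\equiv0$, then for Lebesgue-a.e. $\vec s\in\mathbb R^m_+$ the flow $(\mathfrak X_\zeta^{\vec s},\widetilde\mu,h_t)$ has purely singular spectrum. -/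

import Mathlib

open MeasureTheory Filter Topology

namespace SpectralCocycle

/-- A substitution on the alphabet `Fin m`: every letter is sent to a non-empty finite word. -/
structure Substitution (m : ℕ) where
  /-- The image word of a letter. -/
  word : Fin m → List (Fin m)
  word_ne_nil : ∀ a, word a ≠ []

namespace Substitution

variable {m : ℕ}

/-- The word `ζⁿ(b)`, where `ζ` acts on words by concatenation. -/
def iterWord (ζ : Substitution m) (n : ℕ) (b : Fin m) : List (Fin m) :=
  (fun w : List (Fin m) => w.flatMap ζ.word)^[n] [b]

/-- The substitution matrix: `S (i, j)` is the number of symbols `i` in the word `ζ(j)`. -/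
def matrix (ζ : Substitution m) : Matrix (Fin m) (Fin m) ℕ :=
  Matrix.of fun i j => (ζ.word j).count i

/-- `ζ` is primitive: some power `Sᵏ`, `k > 0`, of its substitution matrix has strictly positive
entries. -/
def IsPrimitive (ζ : Substitution m) : Prop :=
  (ζ.matrix.map (fun k : ℕ => (k : ℝ))).IsPrimitive

/-- The Perron-Frobenius eigenvalue `θ₁` of the (non-negative) substitution matrix, that is, its
spectral radius. -/
noncomputable def perronRoot (ζ : Substitution m) : ℝ :=
  (spectralRadius ℂ (ζ.matrix.map (fun k : ℕ => (k : ℂ)))).toReal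

/-- The substitution space `X_ζ`: all two-sided sequences each of whose finite subwords
`x_i … x_{i+n-1}` is a subword of `ζᵏ(b)` for some letter `b` and some `k ≥ 1`. -/
def space (ζ : Substitution m) : Set (ℤ → Fin m) :=
  {x | ∀ (i : ℤ) (n : ℕ), ∃ (b : Fin m) (k : ℕ), 1 ≤ k ∧
    (List.range n).map (fun j : ℕ => x (i + j)) <:+: ζ.iterWord k b}

end Substitution

/-- The left shift `T` on two-sided sequences. -/
def shift {m : ℕ} (x : ℤ → Fin m) : ℤ → Fin m := fun i => x (i + 1)

namespace Substitution

variable {m : ℕ}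

/-- `ζ` is aperiodic: the shift on `X_ζ` has no periodic points. -/
def IsAperiodic (ζ : Substitution m) : Prop :=
  ∀ x ∈ ζ.space, ∀ p : ℕ, 0 < p → shift^[p] x ≠ x

/-- `μ` is a shift-invariant Borel probability measure on `X_ζ`, regarded as a measure on the full
shift carried by `X_ζ`. (For primitive `ζ` there is exactly one.) -/
def IsInvariantProbability (ζ : Substitution m) (μ : Measure (ℤ → Fin m)) : Prop :=
  IsProbabilityMeasure μ ∧ (∀ᵐ x ∂μ, x ∈ ζ.space) ∧ MeasurePreserving shift μ μ

/-- The toral endomorphism `E_ζ : ξ ↦ Sᵗ ξ (mod ℤᵐ)` of `𝕋ᵐ = (ℝ/ℤ)ᵐ`. -/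
noncomputable def toralEndo (ζ : Substitution m) (ξ : Fin m → UnitAddCircle) :
    Fin m → UnitAddCircle :=
  fun b => ∑ a, ζ.matrix a b • ξ a

/-- The matrix-valued function `𝓜_ζ` on the torus: if `ζ(b) = u₁ … u_k`, its `(b, c)` entry is the
sum of `exp (-2πi (ξ_{u₁} + … + ξ_{u_{j-1}}))` over the positions `j` with `u_j = c`.
(Positions are numbered from `0` in the code, and `fourier (-1) x = exp (-2πi x)`.) -/
noncomputable def spectralMatrix (ζ : Substitution m) (ξ : Fin m → UnitAddCircle) :
    Matrix (Fin m) (Fin m) ℂ :=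
  Matrix.of fun b c =>
    ∑ j : Fin (ζ.word b).length,
      if (ζ.word b).get j = c then
        (fourier (-1) ((((ζ.word b).take j).map ξ).sum : UnitAddCircle) : ℂ)
      else 0

/-- The spectral cocycle
`𝓜_ζ(ξ, n) = 𝓜_ζ(E_ζ^{n-1} ξ) ⋯ 𝓜_ζ(E_ζ ξ) 𝓜_ζ(ξ)` over the toral endomorphism. -/
noncomputable def cocycle (ζ : Substitution m) (ξ : Fin m → UnitAddCircle) :
    ℕ → Matrix (Fin m) (Fin m) ℂ
  | 0 => 1
  | n + 1 => ζ.spectralMatrix (ζ.toralEndo^[n] ξ) * ζ.cocycle ξ n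

section

open scoped Matrix.Norms.Operator

/-- `(1/n) log ‖𝓜_ζ(ξ, n)‖`. The norm is the operator norm for the sup norm on `ℂᵐ` (maximal
absolute row sum); all matrix norms being equivalent, the limit does not depend on this choice. -/
noncomputable def logGrowth (ζ : Substitution m) (ξ : Fin m → UnitAddCircle) (n : ℕ) : ℝ :=
  (1 / (n : ℝ)) * Real.log ‖ζ.cocycle ξ n‖

end

/-- `χ` is the top Lyapunov exponent of the spectral cocycle:
`lim (1/n) log ‖𝓜_ζ(ξ, n)‖ = χ` for almost every `ξ ∈ 𝕋ᵐ`. -/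
def IsTopLyapunovExponent (ζ : Substitution m) (χ : ℝ) : Prop :=
  ∀ᵐ ξ ∂(volume : Measure (Fin m → UnitAddCircle)), Tendsto (ζ.logGrowth ξ) atTop (𝓝 χ)

end Substitution

/-! ### The suspension flow -/

section Suspension

variable {m : ℕ}

/-- The set of points `(x, u)` with `0 ≤ u < s_{x₀}`, on which the suspension over the shift with
the piecewise-constant roof function `x ↦ s_{x₀}` lives. -/
def underRoof (s : Fin m → ℝ) : Set ((ℤ → Fin m) × ℝ) :=
  {y | 0 ≤ y.2 ∧ y.2 < s (y.1 0)}

/-- The time at which the flow orbit of `(x, 0)` reaches `(Tⁿ x, 0)`: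
`s_{x₀} + … + s_{x_{n-1}}` for `n ≥ 0` and `-(s_{x_n} + … + s_{x_{-1}})` for `n < 0`. -/
noncomputable def hittingTime (s : Fin m → ℝ) (x : ℤ → Fin m) (n : ℤ) : ℝ :=
  ∑ k ∈ Finset.Ico 0 n, s (x k) - ∑ k ∈ Finset.Ico n 0, s (x k)

/-- The suspension flow `h_t`: `h_t (x, u) = (Tⁿ x, u + t - hittingTime s x n)` where `n` is the
integer with `hittingTime s x n ≤ u + t < hittingTime s x (n + 1)`, i.e. the largest one with
`hittingTime s x n ≤ u + t` (all `s_a` being positive). -/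
noncomputable def suspensionFlow (s : Fin m → ℝ) (t : ℝ) (y : (ℤ → Fin m) × ℝ) :
    (ℤ → Fin m) × ℝ :=
  let n : ℤ := sSup {n : ℤ | hittingTime s y.1 n ≤ y.2 + t}
  (fun i => y.1 (i + n), y.2 + t - hittingTime s y.1 n)

/-- The measure `μ̃` of the suspension: `μ × Lebesgue` on the region under the roof. When `μ` is
carried by `X_ζ`, it is carried by
`𝔛_ζ^s = {(x, u) : x ∈ X_ζ, 0 ≤ u < s_{x₀}}`. -/
noncomputable def suspensionMeasure (μ : Measure (ℤ → Fin m)) (s : Fin m → ℝ) :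
    Measure ((ℤ → Fin m) × ℝ) :=
  (μ.prod volume).restrict (underRoof s)

/-- `f` is the Lip-cylindrical function `f (x, t) = ∑ₐ 1_{[a]}(x) ψₐ(t)` for some Lipschitz
functions `ψₐ : [0, sₐ] → ℂ`. -/
def IsLipCylindrical (s : Fin m → ℝ) (f : (ℤ → Fin m) × ℝ → ℂ) : Prop :=
  ∃ ψ : Fin m → ℝ → ℂ, (∀ a, ∃ K, LipschitzOnWith K (ψ a) (Set.Icc 0 (s a))) ∧
    ∀ y ∈ underRoof s, f y = ψ (y.1 0) y.2

end Suspension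

/-- `σ` is the spectral measure `σ_f` of `f` for the flow `h` on `(Y, ν)`: the finite Borel measure
on `ℝ` with `∫ exp (2πiωt) dσ(ω) = ⟨f ∘ h_t, f⟩` for all `t ∈ ℝ`. -/
def IsSpectralMeasure {Y : Type*} [MeasurableSpace Y] (ν : Measure Y) (h : ℝ → Y → Y)
    (f : Y → ℂ) (σ : Measure ℝ) : Prop :=
  IsFiniteMeasure σ ∧
    ∀ t : ℝ, ∫ ω : ℝ, Complex.exp (2 * Real.pi * Complex.I * ω * t) ∂σ =
      ∫ y, f (h t y) * (starRingEnd ℂ) (f y) ∂ν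

/-- The flow `h` on `(Y, ν)` has purely singular spectrum: the spectral measure of every
`f ∈ L²(Y, ν)` is singular with respect to Lebesgue measure. -/
def HasPurelySingularSpectrum {Y : Type*} [MeasurableSpace Y] (ν : Measure Y)
    (h : ℝ → Y → Y) : Prop :=
  ∀ f : Y → ℂ, MemLp f 2 ν → ∀ σ : Measure ℝ, IsSpectralMeasure ν h f σ → σ ⟂ₘ volume

end SpectralCocycle

/-!
# Singular spectrum of substitution suspension flows via the spectral cocycle

**Lyapunov exponent.** The truncated logarithms `log (max ‖𝓜_ζ(ξ, n)‖ e⁻ⁿ)` form a bounded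
subadditive sequence over the ergodic map `E_ζ`, so the subadditive ergodic theorem applies
(`subadditive_ergodic`). The cocycle `𝓜_ζ(ξ, n)` is the spectral matrix of `ζⁿ` (`cocycle_apply`),
so along the circles `ξ + t (1, …, 1)` its entries are polynomials in `exp (-2πit)` with coefficients
of modulus `0` or `1`. Two consequences: by Jensen's formula the limit is non-negative, so that the
truncation is harmless (`exists_lyapunov`), and by Parseval's identity
`∫ ‖𝓜_ζ(ξ, n)‖² dξ` grows like `θ₁ⁿ`, which gives `χ ≤ (1/2) log θ₁` (`lyapunov_le`).

**Twisted integrals.** The ergodic theorem also gives, for every `β > χ` and almost every `ξ`, a bound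
`‖𝓜_ζ(E_ζʲ ξ, k)‖ ≤ B exp (β (j + k))` uniform over the orbit. Decomposing the words of `X_ζ` into
blocks `ζⁿ(a)`, one sees that twisted sums of functions depending on finitely many coordinates are
transported by the cocycle up to bounded errors at each level, and hence that twisted sums of length
comparable to `θ₁ⁿ` are `O(n² exp (β n))` (`exists_norm_sum_le`). Integration along the floors of the
suspension turns this into a bound for `∫₀ᴿ exp (-2πiωt) g (h_t y) dt` with `R = θ₁ⁿ`, which is
`o(√R)` when `β < (1/2) log θ₁`, provided that `ω s` modulo `1` is generic
(`tendsto_lintegral_twistedIntegral`). By Fubini's theorem this holds for almost every `s` and almost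
every `ω` (`ae_ae_smul_torus`).

**Singularity.** The mass of `σ_f` in the ball of radius `1 / (8R)` about `ω` is at most a constant
times `R⁻²` times the squared `L²` norm of the twisted integral of `f` (`spectralMeasure_closedBall_le`),
so the `o(√R)` bound makes the density of `σ_f` at `ω` vanish. A general `f ∈ L²` is the sum of a
function depending on finitely many coordinates and of a small one; by Bessel's inequality along the
orbits the contribution of the latter to the total mass of the absolutely continuous part is small
(`mutuallySingular_of_approx`). This treats all of `L²` at once, and
Lip-cylindrical functions are a special case.
-/

/-! ### The subadditive ergodic theorem -/

namespace SpectralCocycle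

section Ergodic

variable {X : Type*} {T : X → X} {g : ℕ → X → ℝ} {C : ℝ}

/-- Greedy covering of the orbit piece `x, …, T^(k-1) x`: outside `B` jump along a piece with
`g n ≤ n c`, inside `B` advance by one step at a cost of at most `C`; the last `N` points are
estimated trivially. -/
lemma subadditive_le_greedy (hsub : ∀ m n x, g (m + n) x ≤ g m x + g n (T^[m] x))
    (hC : 0 ≤ C) (hbdd : ∀ n x, |g n x| ≤ n * C) (c : ℝ) (N : ℕ) (B : Set X)
    (hB : ∀ x ∉ B, ∃ n, 1 ≤ n ∧ n ≤ N ∧ g n x ≤ n * c) (k : ℕ) :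
    ∀ x, g k x ≤ k * c + (C + |c|) * (birkhoffSum T (B.indicator 1) k x + N) := by
  induction k using Nat.strong_induction_on with
  | _ k ih =>
    intro x
    have hnn : ∀ j y, 0 ≤ birkhoffSum T (B.indicator (1 : X → ℝ)) j y := fun j y =>
      Finset.sum_nonneg fun i _ => Set.indicator_nonneg (fun _ _ => zero_le_one) _
    have hCc : 0 ≤ C + |c| := by positivity
    have hc1 := neg_abs_le c
    rcases le_or_gt k N with hk | hk
    · have h1 := (abs_le.1 (hbdd k x)).2
      have h2 : (k : ℝ) ≤ N := by exact_mod_cast hk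
      have h3 : (k : ℝ) * (C + |c|) ≤ (C + |c|) * (birkhoffSum T (B.indicator 1) k x + N) := by
        rw [mul_comm]
        exact mul_le_mul_of_nonneg_left (by linarith [hnn k x]) hCc
      have h4 : 0 ≤ (k : ℝ) * (c + |c|) := mul_nonneg (Nat.cast_nonneg _) (by linarith)
      linarith
    · by_cases hx : x ∈ B
      · obtain ⟨j, rfl⟩ : ∃ j, k = 1 + j := ⟨k - 1, by omega⟩
        have h1 := hsub 1 j x
        have h2 := ih j (by omega) (T^[1] x)
        have h3 := (abs_le.1 (hbdd 1 x)).2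
        rw [birkhoffSum_add]
        simp only [birkhoffSum_one, Set.indicator_of_mem hx, Pi.one_apply]
        push_cast at *
        nlinarith
      · obtain ⟨n, hn1, hnN, hn⟩ := hB x hx
        obtain ⟨j, rfl⟩ : ∃ j, k = n + j := ⟨k - n, by omega⟩
        have h1 := hsub n j x
        have h2 := ih j (by omega) (T^[n] x)
        rw [birkhoffSum_add]
        have h3 := mul_nonneg hCc (hnn n x)
        push_cast at *
        nlinarith

lemma subadditive_le_sum (hsub : ∀ m n x, g (m + n) x ≤ g m x + g n (T^[m] x)) (K r q : ℕ) (x : X) :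
    g (r + q * K) x ≤ g r x + ∑ i ∈ Finset.range q, g K (T^[r + i * K] x) := by
  induction q with
  | zero => simp
  | succ q ih =>
    have := hsub (r + q * K) K x
    rw [Finset.sum_range_succ, show r + (q + 1) * K = r + q * K + K by ring]
    linarith

/-- A subadditive sequence is dominated by the Birkhoff sums of any `g K / K`: average over the
`K` ways of cutting an orbit piece into blocks of length `K`. -/
lemma subadditive_le_birkhoffSum (hsub : ∀ m n x, g (m + n) x ≤ g m x + g n (T^[m] x))
    (hC : 0 ≤ C) (hbdd : ∀ n x, |g n x| ≤ n * C) {K : ℕ} (hK : 1 ≤ K) (k : ℕ) (x : X) :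
    g k x ≤ birkhoffSum T (fun y => g K y / K) k x + 5 * K * C := by
  have hK0 : (0 : ℝ) < K := by exact_mod_cast hK
  -- one block fewer than fits, so that the blocks starting at each `r < K` stay in `[0, k)`
  obtain ⟨q, hq⟩ : ∃ q, q = k / K - 1 := ⟨_, rfl⟩
  have hkq : q * K ≤ k := by
    rw [hq]
    have := Nat.div_mul_le_self k K
    exact (Nat.mul_le_mul_right _ (Nat.sub_le _ _)).trans this
  have hkq2 : k < q * K + 2 * K := by
    have := Nat.lt_div_mul_add (a := k) hK
    have h2 : k / K ≤ q + 1 := by rw [hq]; exact Nat.le_add_of_sub_le le_rfl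
    have := Nat.mul_le_mul_right K h2
    nlinarith
  have hr : ∀ r ∈ Finset.range K, g k x ≤
      (∑ i ∈ Finset.range q, g K (T^[r + i * K] x)) + 3 * K * C := by
    intro r hrK
    rw [Finset.mem_range] at hrK
    have h1 := (abs_le.1 (hbdd r x)).2
    have h1' : (r : ℝ) * C ≤ K * C := mul_le_mul_of_nonneg_right (by exact_mod_cast hrK.le) hC
    rcases le_or_gt (r + q * K) k with h | h
    · obtain ⟨s, rfl⟩ := Nat.exists_eq_add_of_le h
      have h2 := hsub (r + q * K) s x
      have h3 := subadditive_le_sum hsub K r q x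
      have h4 := (abs_le.1 (hbdd s (T^[r + q * K] x))).2
      have h5 : (s : ℝ) * C ≤ 2 * K * C :=
        mul_le_mul_of_nonneg_right (by exact_mod_cast (by omega : s ≤ 2 * K)) hC
      linarith
    · rcases Nat.eq_zero_or_pos q with h0 | h0
      · have h4 := (abs_le.1 (hbdd k x)).2
        have h5 : (k : ℝ) * C ≤ 2 * K * C := by
          refine mul_le_mul_of_nonneg_right ?_ hC
          exact_mod_cast (by rw [h0] at hkq2; omega : k ≤ 2 * K)
        rw [h0]; simp only [Finset.range_zero, Finset.sum_empty]
        nlinarith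
      · exfalso
        have h6 : (k / K) * K ≤ k := Nat.div_mul_le_self k K
        have h7 : k / K = q + 1 := by
          rw [hq]
          exact (Nat.sub_add_cancel (Nat.one_le_iff_ne_zero.2 fun h8 => by
          rw [hq, h8] at h0; exact absurd h0 (by simp))).symm
        rw [h7] at h6
        nlinarith
  have hsum : ∀ q, ∑ r ∈ Finset.range K, ∑ i ∈ Finset.range q, g K (T^[r + i * K] x)
      = ∑ j ∈ Finset.range (q * K), g K (T^[j] x) := by
    intro q
    induction q with
    | zero => simp
    | succ q ih =>
      simp only [Finset.sum_range_succ, Finset.sum_add_distrib, ih]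
      rw [add_mul, one_mul, Finset.sum_range_add]
      congr 1
      exact Finset.sum_congr rfl fun r _ => by rw [add_comm]
  have hS := Finset.sum_le_sum hr
  rw [Finset.sum_add_distrib, hsum] at hS
  simp only [Finset.sum_const, Finset.card_range, nsmul_eq_mul] at hS
  obtain ⟨s, hs⟩ := Nat.exists_eq_add_of_le hkq
  have hrest : - ((s : ℝ) * (K * C)) ≤ ∑ j ∈ Finset.range s, g K (T^[q * K + j] x) := by
    have : ∑ j ∈ Finset.range s, (-(K * C) : ℝ) ≤ ∑ j ∈ Finset.range s, g K (T^[q * K + j] x) :=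
      Finset.sum_le_sum fun j _ => (abs_le.1 (hbdd K _)).1
    simpa using this
  have hs2 : (s : ℝ) * (K * C) ≤ 2 * K * (K * C) :=
    mul_le_mul_of_nonneg_right (by exact_mod_cast (by omega : s ≤ 2 * K)) (by positivity)
  have hbs : birkhoffSum T (fun y => g K y / K) k x * K
      = ∑ j ∈ Finset.range (q * K), g K (T^[j] x) + ∑ j ∈ Finset.range s, g K (T^[q * K + j] x) := by
    rw [birkhoffSum, ← Finset.sum_div, div_mul_cancel₀ _ hK0.ne']
    conv_lhs => rw [hs]
    rw [Finset.sum_range_add]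
  refine le_of_mul_le_mul_left ?_ hK0
  nlinarith

variable [MeasurableSpace X] {μ : Measure X}

lemma subadditive_integrable [IsFiniteMeasure μ] (hm : ∀ n, Measurable (g n))
    (hbdd : ∀ n x, |g n x| ≤ n * C) (n : ℕ) : Integrable (g n) μ :=
  Integrable.of_bound (hm n).aestronglyMeasurable (n * C) (ae_of_all _ (hbdd n))

/-- The Katznelson–Weiss covering argument: if almost every point has some time `n ≥ 1` at which
`g n ≤ n c`, then orbits can be cut into such pieces up to a small proportion, so the average
growth of `g` is at most `c`. -/
lemma average_le_of_ae_exists [IsProbabilityMeasure μ] (hT : MeasurePreserving T μ μ)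
    (hm : ∀ n, Measurable (g n))
    (hsub : ∀ m n x, g (m + n) x ≤ g m x + g n (T^[m] x))
    (hC : 0 ≤ C) (hbdd : ∀ n x, |g n x| ≤ n * C) {Λ c : ℝ} (hΛ : ∀ n : ℕ, n * Λ ≤ ∫ x, g n x ∂μ)
    (h : ∀ᵐ x ∂μ, ∃ n : ℕ, 1 ≤ n ∧ g n x ≤ n * c) : Λ ≤ c := by
  -- `B N` is the set of points without a good time up to `N`; its measure tends to `0`
  let B : ℕ → Set X := fun N => {x | ∀ n, 1 ≤ n → n ≤ N → n * c < g n x}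
  have hBm : ∀ N, MeasurableSet (B N) := by
    intro N
    simp only [B, Set.ofPred_forall]
    refine MeasurableSet.iInter fun n => MeasurableSet.iInter fun _ => MeasurableSet.iInter fun _ =>
      measurableSet_lt measurable_const (hm n)
  have hBanti : Antitone B := fun N N' hN x hx n h1 h2 => hx n h1 (h2.trans hN)
  have hB0 : μ (⋂ N, B N) = 0 := by
    refine measure_mono_null ?_ h
    intro x hx
    simp only [Set.mem_iInter] at hx
    rintro ⟨n, hn, hn'⟩
    exact absurd (hx n n hn le_rfl) (not_lt.2 hn')
  have hlim : Tendsto (fun N => μ.real (B N)) atTop (𝓝 0) := by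
    have := tendsto_measure_iInter_atTop (μ := μ) (fun N => (hBm N).nullMeasurableSet) hBanti
      ⟨0, measure_ne_top _ _⟩
    rw [hB0] at this
    exact (ENNReal.tendsto_toReal ENNReal.zero_ne_top).comp this
  have hkey : ∀ N, Λ - c ≤ (C + |c|) * μ.real (B N) := by
    intro N
    have h1 : ∀ k : ℕ, k * Λ ≤ k * c + (C + |c|) * (k * μ.real (B N) + N) := by
      intro k
      have hind : Integrable ((B N).indicator (1 : X → ℝ)) μ :=
        (integrable_const (1 : ℝ)).indicator (hBm N)
      have hind' : ∀ i, Integrable (fun x => (B N).indicator (1 : X → ℝ) (T^[i] x)) μ := fun i =>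
        (hT.iterate i).integrable_comp_of_integrable hind
      have hbi : ∫ x, birkhoffSum T ((B N).indicator (1 : X → ℝ)) k x ∂μ = k * μ.real (B N) := by
        simp only [birkhoffSum]
        rw [integral_finsetSum _ fun i _ => hind' i]
        have : ∀ i, ∫ x, (B N).indicator (1 : X → ℝ) (T^[i] x) ∂μ = μ.real (B N) := by
          intro i
          have e : (fun x => (B N).indicator (1 : X → ℝ) (T^[i] x))
              = (T^[i] ⁻¹' (B N)).indicator 1 := by
            ext x; simp [Set.indicator]
          rw [e, integral_indicator_one (((hT.iterate i).measurable) (hBm N))]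
          simp [Measure.real, (hT.iterate i).measure_preimage (hBm N).nullMeasurableSet]
        simp [this]
      have hbint : Integrable (fun x => birkhoffSum T ((B N).indicator (1 : X → ℝ)) k x) μ :=
        integrable_finsetSum _ fun i _ => hind' i
      calc (k : ℝ) * Λ ≤ ∫ x, g k x ∂μ := hΛ k
        _ ≤ ∫ x, (k * c + (C + |c|) * (birkhoffSum T ((B N).indicator 1) k x + N)) ∂μ := by
          refine integral_mono (subadditive_integrable hm hbdd k) ?_
            (subadditive_le_greedy hsub hC hbdd c N (B N) ?_ k)
          · exact (integrable_const _).add ((hbint.add (integrable_const _)).const_mul _)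
          · intro x hx
            simp only [B, Set.mem_ofPred_eq, not_forall, not_lt] at hx
            obtain ⟨n, h1, h2, h3⟩ := hx
            exact ⟨n, h1, h2, h3⟩
        _ = _ := by
          have h2 : Integrable (fun x => birkhoffSum T ((B N).indicator (1 : X → ℝ)) k x + (N : ℝ)) μ :=
            hbint.add (integrable_const _)
          rw [integral_add (integrable_const _) (h2.const_mul _), integral_const,
            integral_const_mul, integral_add hbint (integrable_const _), hbi]
          simp
    by_contra hcon
    push Not at hcon
    obtain ⟨k, hk⟩ := exists_nat_gt (((C + |c|) * N) / (Λ - c - (C + |c|) * μ.real (B N)))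
    rw [div_lt_iff₀ (by linarith)] at hk
    nlinarith [h1 k]
  have := ge_of_tendsto' (hlim.const_mul (C + |c|)) hkey
  linarith

/-- Lower half of the subadditive ergodic theorem: the set on which `liminf g n / n ≤ c` is invariant,
and by the covering argument it cannot have full measure when `c < Λ`. -/
lemma ae_eventually_lt_subadditive [IsProbabilityMeasure μ] (hT : Ergodic T μ)
    (hm : ∀ n, Measurable (g n))
    (hsub : ∀ m n x, g (m + n) x ≤ g m x + g n (T^[m] x))
    (hC : 0 ≤ C) (hbdd : ∀ n x, |g n x| ≤ n * C) {Λ c : ℝ} (hΛ : ∀ n : ℕ, n * Λ ≤ ∫ x, g n x ∂μ)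
    (hc : c < Λ) : ∀ᵐ x ∂μ, ∀ᶠ n : ℕ in atTop, n * c < g n x := by
  -- `Z` is the set where the lower limit of `g n / n` is at most `c`.
  let Z : Set X := {x | ∀ i : ℕ, ∃ᶠ n : ℕ in atTop, g n x ≤ n * (c + 1 / (i + 1))}
  have hZm : MeasurableSet Z := by
    simp only [Z, Set.ofPred_forall, frequently_atTop, Set.ofPred_exists]
    refine MeasurableSet.iInter fun i => MeasurableSet.iInter fun a => MeasurableSet.iUnion fun b =>
      ?_
    have : {x | b ≥ a ∧ g b x ≤ b * (c + 1 / (i + 1))} =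
      {x | b ≥ a} ∩ {x | g b x ≤ b * (c + 1 / (i + 1))} := rfl
    rw [this]
    exact (MeasurableSet.const _).inter (measurableSet_le (hm b) measurable_const)
  -- invariance up to null sets: prepending one step changes `g n / n` by `O(1 / n)`
  have hZT : T ⁻¹' Z ⊆ Z := by
    intro x hx i
    have hpos : (0 : ℝ) < 1 / (i + 1) - 1 / (i + 2) := by
      rw [sub_pos]; exact one_div_lt_one_div_of_lt (by positivity) (by linarith)
    obtain ⟨N, hN⟩ := exists_nat_gt ((C + |c| + 1) / (1 / (i + 1) - 1 / (i + 2) : ℝ))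
    rw [div_lt_iff₀ hpos] at hN
    have h1 := (hx (i + 1)).and_eventually (eventually_ge_atTop N)
    refine (tendsto_add_atTop_nat 1).frequently (h1.mono ?_)
    rintro n ⟨hn, hnN⟩
    have h2 := hsub 1 n x
    have h3 := (abs_le.1 (hbdd 1 x)).2
    have h4 : (N : ℝ) ≤ n := by exact_mod_cast hnN
    have h5 : g n (T^[1] x) ≤ n * (c + 1 / (i + 2)) := by
      have : ((i + 1 : ℕ) : ℝ) + 1 = i + 2 := by push_cast; ring
      rw [← this]; exact hn
    rw [add_comm n 1]
    have h6 := neg_abs_le c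
    have h7 : (N : ℝ) * (1 / (i + 1) - 1 / (i + 2)) ≤ n * (1 / (i + 1) - 1 / (i + 2)) :=
      mul_le_mul_of_nonneg_right h4 hpos.le
    have h8 : (0 : ℝ) ≤ 1 / (i + 1) := by positivity
    push_cast at *
    nlinarith
  rcases hT.ae_empty_or_univ_of_preimage_ae_le hZm.nullMeasurableSet
    (LE.le.eventuallyLE hZT) with h | h
  · have h' : ∀ᵐ x ∂μ, x ∉ Z := by
      filter_upwards [h] with x hx hxZ
      have : Z x = (∅ : Set X) x := hx
      exact this.mp hxZ
    filter_upwards [h'] with x hx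
    simp only [Z, Set.mem_ofPred_eq, not_forall, not_frequently, not_le] at hx
    obtain ⟨i, hi⟩ := hx
    filter_upwards [hi] with n hn
    refine lt_of_le_of_lt (mul_le_mul_of_nonneg_left ?_ (Nat.cast_nonneg n)) hn
    have : (0 : ℝ) ≤ 1 / (i + 1) := by positivity
    linarith
  · exfalso
    have h' : ∀ᵐ x ∂μ, x ∈ Z := by
      filter_upwards [h] with x hx
      have : Z x = (Set.univ : Set X) x := hx
      exact this.mpr trivial
    obtain ⟨i, hi⟩ := exists_nat_one_div_lt (sub_pos.2 hc)
    have := average_le_of_ae_exists hT.toMeasurePreserving hm hsub hC hbdd hΛ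
      (c := c + 1 / (i + 1)) (by
        filter_upwards [h'] with x hx
        obtain ⟨n, hn, hn1⟩ := ((hx i).and_eventually (eventually_ge_atTop 1)).exists
        exact ⟨n, hn1, hn⟩)
    linarith

lemma exists_bound_of_eventually {a : ℕ → ℝ} (h : ∀ᶠ n in atTop, a n ≤ 0) : ∃ B, ∀ n, a n ≤ B := by
  obtain ⟨N, hN⟩ := eventually_atTop.1 h
  refine ⟨∑ i ∈ Finset.range N, |a i|, fun n => ?_⟩
  rcases lt_or_ge n N with hn | hn
  · exact (le_abs_self _).trans
      (Finset.single_le_sum (f := fun i => |a i|) (fun i _ => abs_nonneg _) (Finset.mem_range.2 hn))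
  · exact (hN n hn).trans (Finset.sum_nonneg fun i _ => abs_nonneg _)

/-- The pointwise ergodic theorem for a bounded function `φ`, obtained by applying the lower half of
the subadditive theorem to the Birkhoff sums of `φ` and of `-φ`. -/
lemma ae_exists_abs_birkhoffSum_sub_le [IsProbabilityMeasure μ] (hT : Ergodic T μ) {φ : X → ℝ}
    (hφ : Measurable φ) (hC : ∀ x, |φ x| ≤ C) {ε : ℝ} (hε : 0 < ε) :
    ∀ᵐ x ∂μ, ∃ B, ∀ n : ℕ, |birkhoffSum T φ n x - n * ∫ x, φ x ∂μ| ≤ n * ε + B := by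
  have hC0 : 0 ≤ C := by
    obtain ⟨x⟩ := nonempty_of_isProbabilityMeasure μ
    exact (abs_nonneg _).trans (hC x)
  have key : ∀ ψ : X → ℝ, Measurable ψ → (∀ x, |ψ x| ≤ C) →
      ∀ᵐ x ∂μ, ∀ᶠ n : ℕ in atTop, n * (∫ x, ψ x ∂μ - ε) < birkhoffSum T ψ n x := by
    intro ψ hψ hψC
    have hint : Integrable ψ μ := Integrable.of_bound hψ.aestronglyMeasurable C (ae_of_all _ hψC)
    refine ae_eventually_lt_subadditive (g := fun n x => birkhoffSum T ψ n x) hT ?_ ?_ hC0 ?_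
      (Λ := ∫ x, ψ x ∂μ) ?_ (by linarith)
    · intro n
      exact Finset.measurable_sum _ fun i _ => hψ.comp (hT.measurable.iterate i)
    · intro m n x
      rw [birkhoffSum_add]
    · intro n x
      refine (Finset.abs_sum_le_sum_abs _ _).trans ?_
      refine (Finset.sum_le_sum fun i _ => hψC _).trans ?_
      simp
    · intro n
      simp only [birkhoffSum]
      have hi : ∀ i, Integrable (fun x => ψ (T^[i] x)) μ := fun i =>
        (hT.toMeasurePreserving.iterate i).integrable_comp_of_integrable hint
      rw [integral_finsetSum _ fun i _ => hi i]
      have : ∀ i, ∫ x, ψ (T^[i] x) ∂μ = ∫ x, ψ x ∂μ := by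
        intro i
        have hmp := hT.toMeasurePreserving.iterate i
        conv_rhs => rw [← hmp.map_eq]
        rw [integral_map hmp.measurable.aemeasurable hψ.aestronglyMeasurable]
      simp [this]
  filter_upwards [key φ hφ hC, key (fun x => - φ x) hφ.neg (by simpa using hC)] with x h1 h2
  have hneg : ∀ n, birkhoffSum T (fun x => - φ x) n x = - birkhoffSum T φ n x := by
    intro n; simp [birkhoffSum]
  obtain ⟨B, hB⟩ := exists_bound_of_eventually
    (a := fun n : ℕ => |birkhoffSum T φ n x - n * ∫ x, φ x ∂μ| - n * ε) (by
      filter_upwards [h1, h2] with n h1 h2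
      rw [hneg, integral_neg] at h2
      rw [sub_nonpos, abs_le]
      constructor <;> nlinarith)
  exact ⟨B, fun n => by linarith [hB n]⟩

/-- The subadditive ergodic theorem for `|g n| ≤ n C`, together with an upper bound that is uniform
over all pieces of an orbit. -/
theorem subadditive_ergodic [IsProbabilityMeasure μ] (hT : Ergodic T μ)
    (hm : ∀ n, Measurable (g n))
    (hsub : ∀ m n x, g (m + n) x ≤ g m x + g n (T^[m] x))
    (hC : 0 ≤ C) (hbdd : ∀ n x, |g n x| ≤ n * C) :
    ∃ Λ : ℝ, (∀ a : ℝ, (∀ n : ℕ, n * a ≤ ∫ x, g n x ∂μ) → a ≤ Λ) ∧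
      (∀ᵐ x ∂μ, Tendsto (fun n : ℕ => g n x / n) atTop (𝓝 Λ)) ∧
      ∀ c, Λ < c → ∀ ε, 0 < ε → ∀ᵐ x ∂μ, ∃ B, ∀ j k : ℕ,
        g k (T^[j] x) ≤ k * c + (j + k) * ε + B := by
  let S : Set ℝ := (fun n : ℕ => (∫ x, g n x ∂μ) / n) '' Set.Ici 1
  have hSne : S.Nonempty := ⟨_, 1, Set.mem_Ici.2 le_rfl, rfl⟩
  have hint := subadditive_integrable (μ := μ) hm hbdd
  have hlow : ∀ n : ℕ, -(n * C) ≤ ∫ x, g n x ∂μ := by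
    intro n
    have := integral_mono (μ := μ) (integrable_const (-(n * C) : ℝ)) (hint n)
      (fun x => (abs_le.1 (hbdd n x)).1)
    simpa using this
  have hSb : BddBelow S := by
    refine ⟨-C, ?_⟩
    rintro _ ⟨n, hn, rfl⟩
    have : (0 : ℝ) < n := by exact_mod_cast (Set.mem_Ici.1 hn)
    rw [le_div_iff₀ this]; linarith [hlow n]
  have hg0 : ∀ x, g 0 x = 0 := fun x => by simpa using hbdd 0 x
  have hΛ : ∀ n : ℕ, n * sInf S ≤ ∫ x, g n x ∂μ := by
    intro n
    rcases Nat.eq_zero_or_pos n with rfl | hn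
    · simp [hg0]
    · have h := csInf_le hSb ⟨n, Set.mem_Ici.2 hn, rfl⟩
      have : (0 : ℝ) < n := by exact_mod_cast hn
      rw [le_div_iff₀ this] at h; linarith
  -- dominate `g` by the Birkhoff sums of `g K / K`, and write the sum over the piece of length `k`
  -- starting at time `j` as a difference of two sums starting at time `0`
  have hup : ∀ c, sInf S < c → ∀ ε, 0 < ε → ∀ᵐ x ∂μ, ∃ B, ∀ j k : ℕ,
      g k (T^[j] x) ≤ k * c + (j + k) * ε + B := by
    intro c hc ε hε
    obtain ⟨_, ⟨K, hK, rfl⟩, hKc⟩ := exists_lt_of_csInf_lt hSne hc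
    rw [Set.mem_Ici] at hK
    have hK0 : (0 : ℝ) < K := by exact_mod_cast hK
    have hφ : ∀ x, |g K x / K| ≤ C := by
      intro x
      rw [abs_div, Nat.abs_cast, div_le_iff₀ hK0]
      linarith [hbdd K x]
    filter_upwards [ae_exists_abs_birkhoffSum_sub_le hT (φ := fun x => g K x / K)
      ((hm K).div_const _) hφ (half_pos hε)] with x ⟨B, hB⟩
    refine ⟨2 * B + 5 * K * C, fun j k => ?_⟩
    have h1 := subadditive_le_birkhoffSum hsub hC hbdd hK k (T^[j] x)
    have h2 := (abs_le.1 (hB (j + k))).2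
    have h3 := (abs_le.1 (hB j)).1
    rw [birkhoffSum_add] at h2
    rw [integral_div] at h2 h3
    have h4 : (k : ℝ) * ((∫ x, g K x ∂μ) / K) ≤ k * c :=
      mul_le_mul_of_nonneg_left hKc.le (Nat.cast_nonneg k)
    have h5 : 0 ≤ (k : ℝ) * ε := by positivity
    push_cast at *
    nlinarith
  refine ⟨sInf S, ?_, ?_, hup⟩
  · intro a ha
    refine le_csInf hSne ?_
    rintro _ ⟨n, hn, rfl⟩
    have : (0 : ℝ) < n := by exact_mod_cast (Set.mem_Ici.1 hn)
    rw [le_div_iff₀ this]; linarith [ha n]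
  · have h1 : ∀ᵐ x ∂μ, ∀ i : ℕ, ∀ᶠ n : ℕ in atTop, n * (sInf S - 1 / (i + 1)) < g n x := by
      rw [ae_all_iff]
      intro i
      have : (0 : ℝ) < 1 / (i + 1) := by positivity
      exact ae_eventually_lt_subadditive hT hm hsub hC hbdd hΛ (by linarith)
    have h2 : ∀ᵐ x ∂μ, ∀ i : ℕ, ∃ B, ∀ j k : ℕ,
        g k (T^[j] x) ≤ k * (sInf S + 1 / (i + 1)) + (j + k) * (1 / (i + 1)) + B := by
      rw [ae_all_iff]
      intro i
      have : (0 : ℝ) < 1 / (i + 1) := by positivity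
      exact hup _ (by linarith) _ this
    filter_upwards [h1, h2] with x h1 h2
    rw [Metric.tendsto_atTop']
    intro ε hε
    obtain ⟨i, hi⟩ := exists_nat_one_div_lt (show 0 < ε / 3 by positivity)
    obtain ⟨B, hB⟩ := h2 i
    obtain ⟨N, hN⟩ := eventually_atTop.1 (h1 i)
    obtain ⟨N', hN'⟩ := exists_nat_gt (B / (ε / 3))
    rw [div_lt_iff₀ (by positivity)] at hN'
    refine ⟨max N N', fun n hn => ?_⟩
    have hnN := hN n (by omega)
    have hnN' : (N' : ℝ) ≤ n := by exact_mod_cast (by omega : N' ≤ n)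
    have hn0 : (0 : ℝ) < n := by exact_mod_cast (by omega : 0 < n)
    have hBn := hB 0 n
    simp only [Function.iterate_zero, id, Nat.cast_zero, zero_add] at hBn
    have h3 : (n : ℝ) * (1 / (i + 1)) < n * (ε / 3) := mul_lt_mul_of_pos_left hi hn0
    have h4 : (N' : ℝ) * (ε / 3) ≤ n * (ε / 3) := mul_le_mul_of_nonneg_right hnN' (by positivity)
    rw [Real.dist_eq, abs_lt]
    constructor
    · rw [lt_sub_iff_add_lt, lt_div_iff₀ hn0]; nlinarith
    · rw [sub_lt_iff_lt_add, div_lt_iff₀ hn0]; nlinarith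

end Ergodic

end SpectralCocycle

/-! ### Substitution words and the Perron root -/

namespace SpectralCocycle

namespace Substitution

variable {m : ℕ} (ζ : Substitution m)

/-- The action of `ζⁿ` on words. -/
def iter (n : ℕ) (w : List (Fin m)) : List (Fin m) :=
  (fun w : List (Fin m) => w.flatMap ζ.word)^[n] w

lemma iter_singleton (n : ℕ) (b : Fin m) : ζ.iter n [b] = ζ.iterWord n b := rfl

@[simp] lemma iter_nil (n : ℕ) : ζ.iter n [] = [] := by
  induction n with
  | zero => rfl
  | succ n ih => rw [iter, Function.iterate_succ_apply]; exact ih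

lemma iter_append (n : ℕ) (u v : List (Fin m)) : ζ.iter n (u ++ v) = ζ.iter n u ++ ζ.iter n v := by
  induction n generalizing u v with
  | zero => rfl
  | succ n ih => simp only [iter, Function.iterate_succ_apply, List.flatMap_append]; exact ih _ _

lemma iter_cons (n : ℕ) (a : Fin m) (v : List (Fin m)) :
    ζ.iter n (a :: v) = ζ.iterWord n a ++ ζ.iter n v := by
  rw [← List.singleton_append, iter_append, iter_singleton]

lemma iterWord_succ (n : ℕ) (b : Fin m) : ζ.iterWord (n + 1) b = ζ.iter n (ζ.word b) := by
  simp [iterWord, iter, Function.iterate_succ_apply]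

lemma iterWord_add (n k : ℕ) (b : Fin m) : ζ.iterWord (n + k) b = ζ.iter n (ζ.iterWord k b) := by
  simp only [iterWord, iter, Function.iterate_add_apply]

lemma iterWord_ne_nil (n : ℕ) (b : Fin m) : ζ.iterWord n b ≠ [] := by
  induction n generalizing b with
  | zero => simp [iterWord]
  | succ n ih =>
    rw [iterWord_succ]
    obtain ⟨a, v, h⟩ := List.exists_cons_of_ne_nil (ζ.word_ne_nil b)
    rw [h, iter_cons]
    simp [ih a]

lemma count_iter (n : ℕ) (i : Fin m) (v : List (Fin m)) :
    (ζ.iter n v).count i = ∑ a, v.count a * (ζ.iterWord n a).count i := by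
  induction v with
  | nil => simp
  | cons b v ih =>
    rw [iter_cons, List.count_append, ih]
    simp only [List.count_cons, add_mul, Finset.sum_add_distrib]
    rw [add_comm]
    congr 1
    simp

lemma matrix_pow_apply (n : ℕ) (i j : Fin m) : (ζ.matrix ^ n) i j = (ζ.iterWord n j).count i := by
  induction n generalizing i j with
  | zero =>
    simp [iterWord, Matrix.one_apply, List.count_cons, eq_comm (a := j)]
  | succ n ih =>
    rw [pow_succ, Matrix.mul_apply, iterWord_succ, count_iter]
    exact Finset.sum_congr rfl fun a _ => by rw [ih, mul_comm]; rfl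

lemma length_eq_sum_count (w : List (Fin m)) : w.length = ∑ a, w.count a := by
  induction w with
  | nil => simp
  | cons b v ih => simp [List.count_cons, Finset.sum_add_distrib, ih]

/-- By primitivity `ζᵏ(a)` contains every letter for some `k`, so `ζⁿ⁺ᵏ(a)` contains every `ζⁿ(b)`. -/
lemma exists_sum_length_le (hprim : ζ.IsPrimitive) : ∃ k, ∀ n a,
    ∑ b, (ζ.iterWord n b).length ≤ (ζ.iterWord (n + k) a).length := by
  obtain ⟨k, -, hk⟩ := hprim.exists_pos_pow
  refine ⟨k, fun n a => ?_⟩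
  have hpos : ∀ b, 1 ≤ (ζ.iterWord k a).count b := by
    intro b
    have h := hk b a
    have e : (ζ.matrix.map (fun k : ℕ => (k : ℝ))) = (Nat.castRingHom ℝ).mapMatrix ζ.matrix := rfl
    rw [e, ← map_pow] at h
    simp only [RingHom.mapMatrix_apply, Matrix.map_apply, matrix_pow_apply] at h
    have h' : (0 : ℝ) < ((ζ.iterWord k a).count b : ℝ) := h
    exact_mod_cast h'
  rw [iterWord_add, length_eq_sum_count]
  simp only [count_iter]
  rw [Finset.sum_comm]
  refine Finset.sum_le_sum fun b _ => ?_
  rw [← Finset.mul_sum, ← length_eq_sum_count]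
  exact Nat.le_mul_of_pos_left _ (hpos b)

section

open scoped Matrix.Norms.Operator

/-- The substitution matrix over `ℂ`. -/
noncomputable def complexMatrix : Matrix (Fin m) (Fin m) ℂ :=
  ζ.matrix.map (fun k : ℕ => (k : ℂ))

lemma complexMatrix_pow_apply (n : ℕ) (i j : Fin m) :
    (ζ.complexMatrix ^ n) i j = ((ζ.iterWord n j).count i : ℂ) := by
  have e : ζ.complexMatrix = (Nat.castRingHom ℂ).mapMatrix ζ.matrix := rfl
  rw [e, ← map_pow]
  simp [matrix_pow_apply]

lemma norm_le_sum_norm {m : ℕ} (A : Matrix (Fin m) (Fin m) ℂ) : ‖A‖ ≤ ∑ i, ∑ j, ‖A i j‖ := by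
  rw [Matrix.linfty_opNorm_def]
  have : (Finset.univ.sup fun i => ∑ j, ‖A i j‖₊) ≤ ∑ i, ∑ j, ‖A i j‖₊ :=
    Finset.sup_le fun i _ => Finset.single_le_sum (f := fun i => ∑ j, ‖A i j‖₊)
      (fun _ _ => zero_le) (Finset.mem_univ i)
  simpa using NNReal.coe_le_coe.2 this

lemma sum_norm_row_le {m : ℕ} (A : Matrix (Fin m) (Fin m) ℂ) (i : Fin m) : ∑ j, ‖A i j‖ ≤ ‖A‖ := by
  rw [Matrix.linfty_opNorm_def]
  have := Finset.le_sup (f := fun i => ∑ j, ‖A i j‖₊) (Finset.mem_univ i)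
  simpa using NNReal.coe_le_coe.2 this

lemma norm_entry_le {m : ℕ} (A : Matrix (Fin m) (Fin m) ℂ) (i j : Fin m) : ‖A i j‖ ≤ ‖A‖ :=
  (Finset.single_le_sum (f := fun j => ‖A i j‖) (fun _ _ => norm_nonneg _)
    (Finset.mem_univ j)).trans (sum_norm_row_le A i)

lemma norm_pow_le_sum_length (n : ℕ) :
    ‖ζ.complexMatrix ^ n‖ ≤ ∑ b, ((ζ.iterWord n b).length : ℝ) := by
  refine (norm_le_sum_norm _).trans ?_
  rw [Finset.sum_comm]
  refine Finset.sum_le_sum fun b _ => ?_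
  rw [length_eq_sum_count]
  simp [complexMatrix_pow_apply]

lemma sum_length_le_norm_pow (n : ℕ) :
    ∑ b, ((ζ.iterWord n b).length : ℝ) ≤ m * ‖ζ.complexMatrix ^ n‖ := by
  have h : ∀ i, ∑ b, ((ζ.iterWord n b).count i : ℝ) ≤ ‖ζ.complexMatrix ^ n‖ := by
    intro i
    have := sum_norm_row_le (ζ.complexMatrix ^ n) i
    simpa [complexMatrix_pow_apply] using this
  have h2 := Finset.sum_le_sum fun i (_ : i ∈ Finset.univ) => h i
  rw [Finset.sum_comm] at h2
  simp only [Finset.sum_const, Finset.card_univ, Fintype.card_fin, nsmul_eq_mul] at h2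
  refine le_trans (le_of_eq ?_) h2
  refine Finset.sum_congr rfl fun b _ => ?_
  rw [length_eq_sum_count]; push_cast; rfl

lemma spectralRadius_ne_top [NeZero m] : spectralRadius ℂ ζ.complexMatrix ≠ ⊤ :=
  ((spectrum.spectralRadius_le_nnnorm ζ.complexMatrix).trans_lt ENNReal.coe_lt_top).ne

/-- Gelfand's formula gives the spectral radius as an infimum of `‖Sⁿ‖^(1/n)`. -/
lemma perronRoot_pow_le [NeZero m] (n : ℕ) : ζ.perronRoot ^ n ≤ ‖ζ.complexMatrix ^ n‖ := by
  rcases n with _ | n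
  · simp
  · have h := spectrum.spectralRadius_le_pow_nnnorm_pow_one_div ℂ ζ.complexMatrix n
    simp only [nnnorm_one, ENNReal.coe_one, ENNReal.one_rpow, mul_one] at h
    have h2 := ENNReal.toReal_mono
      (ENNReal.rpow_ne_top_of_nonneg (by positivity) ENNReal.coe_ne_top) h
    rw [← ENNReal.toReal_rpow, ENNReal.coe_toReal, coe_nnnorm] at h2
    have h3 := pow_le_pow_left₀ ENNReal.toReal_nonneg h2 (n + 1)
    rw [← Real.rpow_natCast (_ ^ _) (n + 1), ← Real.rpow_mul (norm_nonneg _)] at h3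
    push_cast at h3
    rw [one_div_mul_cancel (by positivity), Real.rpow_one] at h3
    exact h3

lemma eventually_norm_pow_le [NeZero m] {r : ℝ} (hr : ζ.perronRoot < r) :
    ∀ᶠ n : ℕ in atTop, ‖ζ.complexMatrix ^ n‖ ≤ r ^ n := by
  have h := spectrum.pow_norm_pow_one_div_tendsto_nhds_spectralRadius ζ.complexMatrix
  have hr0 : 0 < r := lt_of_le_of_lt ENNReal.toReal_nonneg hr
  have hlt : spectralRadius ℂ ζ.complexMatrix < ENNReal.ofReal r := by
    rw [ENNReal.lt_ofReal_iff_toReal_lt ζ.spectralRadius_ne_top]; exact hr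
  filter_upwards [h.eventually (gt_mem_nhds hlt), eventually_ge_atTop 1] with n hn hn1
  have h1 := (ENNReal.ofReal_lt_ofReal_iff hr0).1 hn
  have h2 := pow_le_pow_left₀ (by positivity) h1.le n
  have : (n : ℝ) ≠ 0 := by positivity
  rwa [← Real.rpow_natCast, ← Real.rpow_mul (norm_nonneg _), one_div_mul_cancel this,
    Real.rpow_one] at h2

lemma one_le_perronRoot [NeZero m] : 1 ≤ ζ.perronRoot := by
  by_contra hcon
  push Not at hcon
  obtain ⟨r, hr, hr1⟩ := exists_between hcon
  have hr0 : 0 ≤ r := ENNReal.toReal_nonneg.trans hr.le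
  obtain ⟨N, hN⟩ := exists_pow_lt_of_lt_one (x := 1 / (m : ℝ)) (y := r)
    (by have := NeZero.pos m; positivity) hr1
  obtain ⟨n, hn, hnN⟩ := ((ζ.eventually_norm_pow_le hr).and (eventually_ge_atTop N)).exists
  have h1 : (1 : ℝ) ≤ ∑ b, ((ζ.iterWord n b).length : ℝ) := by
    have h2 := Finset.single_le_sum (f := fun b => ((ζ.iterWord n b).length : ℝ))
      (fun _ _ => Nat.cast_nonneg _) (Finset.mem_univ (0 : Fin m))
    refine le_trans ?_ h2
    exact_mod_cast List.length_pos_iff.2 (ζ.iterWord_ne_nil n 0)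
  have h3 := h1.trans (ζ.sum_length_le_norm_pow n)
  have hm : (0 : ℝ) < m := by exact_mod_cast NeZero.pos m
  have h4 : r ^ n ≤ r ^ N := pow_le_pow_of_le_one hr0 hr1.le hnN
  rw [lt_div_iff₀ hm] at hN
  nlinarith

/-- Primitivity makes all the words `ζⁿ(a)` grow at least like `θⁿ`. -/
lemma exists_perronRoot_pow_le_length [NeZero m] (hprim : ζ.IsPrimitive) :
    ∃ c : ℝ, 0 < c ∧ ∀ n a, ζ.perronRoot ^ n ≤ c * (ζ.iterWord n a).length := by
  obtain ⟨k, hk⟩ := ζ.exists_sum_length_le hprim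
  have hθ := ζ.one_le_perronRoot
  refine ⟨ζ.perronRoot ^ k, by positivity, fun n a => ?_⟩
  have hlen : ∀ n a, (1 : ℝ) ≤ (ζ.iterWord n a).length := fun n a => by
    exact_mod_cast List.length_pos_iff.2 (ζ.iterWord_ne_nil n a)
  rcases le_or_gt k n with h | h
  · obtain ⟨j, rfl⟩ := Nat.exists_eq_add_of_le' h
    rw [pow_add, mul_comm]
    refine mul_le_mul_of_nonneg_left ?_ (by positivity)
    refine (ζ.perronRoot_pow_le j).trans ((ζ.norm_pow_le_sum_length j).trans ?_)
    exact_mod_cast hk j a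
  · calc ζ.perronRoot ^ n ≤ ζ.perronRoot ^ k := pow_le_pow_right₀ hθ h.le
      _ ≤ _ := le_mul_of_one_le_right (by positivity) (hlen n a)

end

end Substitution

/-! ### Phases of words and the spectral cocycle -/

section Words

variable {m : ℕ}

/-- `exp (-2πi (ξ_{w₁} + … + ξ_{w_k}))` for a word `w = w₁ … w_k`. -/
noncomputable def phase (ξ : Fin m → UnitAddCircle) (w : List (Fin m)) : ℂ :=
  fourier (-1) ((w.map ξ).sum : UnitAddCircle)

@[simp] lemma phase_nil (ξ : Fin m → UnitAddCircle) : phase ξ [] = 1 := by simp [phase]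

lemma phase_append (ξ : Fin m → UnitAddCircle) (u v : List (Fin m)) :
    phase ξ (u ++ v) = phase ξ u * phase ξ v := by
  simp [phase, AddCircle.toCircle_add]

@[simp] lemma norm_phase (ξ : Fin m → UnitAddCircle) (w : List (Fin m)) : ‖phase ξ w‖ = 1 :=
  Circle.norm_coe _

/-- The row vector with entries `∑_{j : w_j = c} exp (-2πi (ξ_{w₁} + … + ξ_{w_{j-1}}))`. -/
noncomputable def row (ξ : Fin m → UnitAddCircle) (w : List (Fin m)) (c : Fin m) : ℂ :=
  ∑ j : Fin w.length, if w.get j = c then phase ξ (w.take j) else 0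

@[simp] lemma row_nil (ξ : Fin m → UnitAddCircle) (c : Fin m) : row ξ [] c = 0 := by simp [row]

lemma row_cons (ξ : Fin m → UnitAddCircle) (a : Fin m) (w : List (Fin m)) (c : Fin m) :
    row ξ (a :: w) c = (if a = c then 1 else 0) + phase ξ [a] * row ξ w c := by
  simp only [row, List.length_cons, Fin.sum_univ_succ, Finset.mul_sum]
  congr 1
  · simp
  · refine Finset.sum_congr rfl fun j _ => ?_
    simp only [Fin.val_succ, List.take_succ_cons, mul_ite, mul_zero]
    rw [← phase_append, List.singleton_append]
    rfl

lemma row_append (ξ : Fin m → UnitAddCircle) (u v : List (Fin m)) (c : Fin m) :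
    row ξ (u ++ v) c = row ξ u c + phase ξ u * row ξ v c := by
  induction u with
  | nil => simp
  | cons a u ih =>
    have h : phase ξ (a :: u) = phase ξ [a] * phase ξ u := by
      rw [← phase_append, List.singleton_append]
    rw [List.cons_append, row_cons, ih, row_cons, h]
    ring

lemma continuous_phase (w : List (Fin m)) : Continuous fun ξ => phase ξ w := by
  induction w with
  | nil => simp only [phase_nil]; exact continuous_const
  | cons a w ih =>
    have : (fun ξ : Fin m → UnitAddCircle => phase ξ (a :: w))
        = fun ξ => (fourier (-1) (ξ a) : ℂ) * phase ξ w := by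
      ext ξ
      rw [← List.singleton_append, phase_append]
      simp [phase]
    rw [this]
    exact ((fourier (-1)).continuous.comp (continuous_apply a)).mul ih

lemma continuous_row (w : List (Fin m)) (c : Fin m) : Continuous fun ξ => row ξ w c := by
  refine continuous_finsetSum _ fun j _ => ?_
  split_ifs
  · exact continuous_phase _
  · exact continuous_const

lemma toralEndo_apply (ζ : Substitution m) (ξ : Fin m → UnitAddCircle) (b : Fin m) :
    ζ.toralEndo ξ b = ((ζ.word b).map ξ).sum := by
  rw [Finset.sum_list_map_count]
  simp only [Substitution.toralEndo, Substitution.matrix, Matrix.of_apply]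
  symm
  refine Finset.sum_subset (Finset.subset_univ _) fun a _ ha => ?_
  rw [List.mem_toFinset] at ha
  simp [List.count_eq_zero_of_not_mem ha]

lemma sum_map_toralEndo_iterate (ζ : Substitution m) (n : ℕ) (ξ : Fin m → UnitAddCircle)
    (v : List (Fin m)) : (v.map (ζ.toralEndo^[n] ξ)).sum = ((ζ.iter n v).map ξ).sum := by
  induction n generalizing ξ v with
  | zero => rfl
  | succ n ih =>
    rw [Function.iterate_succ_apply, ih]
    have : ∀ w : List (Fin m), (w.map (ζ.toralEndo ξ)).sum
        = ((w.flatMap ζ.word).map ξ).sum := by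
      intro w
      induction w with
      | nil => rfl
      | cons a w ih => simp [ih, toralEndo_apply]
    rw [this, Substitution.iter, Substitution.iter, Function.iterate_succ_apply']

lemma phase_toralEndo_iterate (ζ : Substitution m) (n : ℕ) (ξ : Fin m → UnitAddCircle)
    (v : List (Fin m)) : phase (ζ.toralEndo^[n] ξ) v = phase ξ (ζ.iter n v) := by
  rw [phase, phase, sum_map_toralEndo_iterate]

/-- A function on words that is additive up to the phase of the first word and a bounded error is
transported by the substitution through the rows of the spectral matrix. -/
lemma norm_sub_sum_row_le (ζ : Substitution m) (ξ : Fin m → UnitAddCircle)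
    {V : List (Fin m) → ℂ} {C : ℝ} (hnil : V [] = 0)
    (hV : ∀ u v, ‖V (u ++ v) - V u - phase ξ u * V v‖ ≤ C) (n : ℕ) (v : List (Fin m)) :
    ‖V (ζ.iter n v) - ∑ a, row (ζ.toralEndo^[n] ξ) v a * V (ζ.iterWord n a)‖ ≤ C * v.length := by
  induction v with
  | nil => simp [hnil]
  | cons b v ih =>
    have h1 := hV (ζ.iterWord n b) (ζ.iter n v)
    have e : ∑ a, row (ζ.toralEndo^[n] ξ) (b :: v) a * V (ζ.iterWord n a) =
        V (ζ.iterWord n b) + phase ξ (ζ.iterWord n b) *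
          ∑ a, row (ζ.toralEndo^[n] ξ) v a * V (ζ.iterWord n a) := by
      simp only [row_cons, add_mul, Finset.sum_add_distrib, Finset.mul_sum,
        phase_toralEndo_iterate, Substitution.iter_singleton, mul_assoc]
      simp
    rw [e, ζ.iter_cons]
    have h2 : ‖phase ξ (ζ.iterWord n b) * (V (ζ.iter n v) -
        ∑ a, row (ζ.toralEndo^[n] ξ) v a * V (ζ.iterWord n a))‖ ≤ C * v.length := by
      rw [norm_mul, norm_phase, one_mul]; exact ih
    have h3 := norm_add_le_of_le h1 h2
    rw [List.length_cons]; push_cast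
    refine le_trans (le_of_eq ?_) (h3.trans (le_of_eq (by ring)))
    congr 1; ring

/-- The cocycle over `n` steps is the spectral matrix of `ζⁿ`. -/
lemma cocycle_apply (ζ : Substitution m) (ξ : Fin m → UnitAddCircle) (n : ℕ) (b c : Fin m) :
    ζ.cocycle ξ n b c = row ξ (ζ.iterWord n b) c := by
  induction n generalizing b with
  | zero =>
    simp [Substitution.cocycle, Substitution.iterWord, row_cons, Matrix.one_apply]
  | succ n ih =>
    have h := norm_sub_sum_row_le ζ ξ (V := fun w => row ξ w c) (C := 0) (row_nil _ _)
      (fun u v => by rw [row_append]; simp) n (ζ.word b)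
    rw [zero_mul, norm_le_zero_iff, sub_eq_zero] at h
    rw [ζ.iterWord_succ, h]
    simp only [Substitution.cocycle, Matrix.mul_apply, ih]
    rfl

lemma cocycle_add (ζ : Substitution m) (ξ : Fin m → UnitAddCircle) (k n : ℕ) :
    ζ.cocycle ξ (k + n) = ζ.cocycle (ζ.toralEndo^[k] ξ) n * ζ.cocycle ξ k := by
  induction n with
  | zero => simp [Substitution.cocycle]
  | succ n ih =>
    rw [← add_assoc, Substitution.cocycle, ih, Substitution.cocycle, Matrix.mul_assoc,
      ← Function.iterate_add_apply, add_comm n k]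

end Words

end SpectralCocycle

namespace SpectralCocycle

variable {m : ℕ}

/-! ### Moments of the cocycle over the torus -/

section Diagonal

instance isProbabilityMeasure_unitAddCircle : IsProbabilityMeasure (volume : Measure UnitAddCircle) :=
  ⟨UnitAddCircle.measure_univ⟩

/-- Averaging over the torus may be done along the circles `ξ + t (1, …, 1)`. -/
lemma integral_eq_integral_diagonal {φ : (Fin m → UnitAddCircle) → ℝ} (hφ : Continuous φ) :
    ∫ ξ, φ ξ = ∫ ξ : Fin m → UnitAddCircle, ∫ t : UnitAddCircle, φ (ξ + fun _ => t) := by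
  have hc : Continuous fun p : (Fin m → UnitAddCircle) × UnitAddCircle =>
      φ (p.1 + fun _ => p.2) := by fun_prop
  have hint : Integrable (Function.uncurry fun (ξ : Fin m → UnitAddCircle) (t : UnitAddCircle) =>
      φ (ξ + fun _ => t)) (volume.prod volume) :=
    hc.integrable_of_hasCompactSupport (HasCompactSupport.of_compactSpace _)
  rw [integral_integral_swap hint]
  simp only [integral_add_right_eq_self (μ := (volume : Measure (Fin m → UnitAddCircle))) φ]
  simp

lemma integral_fourier_neg_one (F : ℂ → ℝ) :
    ∫ t : UnitAddCircle, F (fourier (-1) t) = Real.circleAverage F 0 1 := by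
  have h1 : ∫ t : UnitAddCircle, F (fourier (-1) t) = ∫ t : UnitAddCircle, F (fourier 1 t) := by
    rw [← integral_neg_eq_self]
    congr 1; ext t; simp
  rw [h1, ← UnitAddCircle.intervalIntegral_preimage 0, Real.circleAverage_def]
  have h2 := intervalIntegral.mul_integral_comp_mul_left (a := 0) (b := 1)
    (f := fun θ => F (circleMap 0 1 θ)) (2 * Real.pi)
  rw [mul_zero, mul_one] at h2
  rw [← h2, smul_eq_mul, ← mul_assoc, inv_mul_cancel₀ (by positivity), one_mul, zero_add]
  congr 1; ext t
  rw [fourier_coe_apply, circleMap]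
  congr 1
  push_cast
  simp only [zero_add, one_mul, div_one, mul_one]
  congr 1; ring

lemma phase_add_diagonal (ξ : Fin m → UnitAddCircle) (t : UnitAddCircle) (w : List (Fin m)) :
    phase (ξ + fun _ => t) w = phase ξ w * (fourier (-1) t : ℂ) ^ w.length := by
  induction w with
  | nil => simp
  | cons a w ih =>
    have h : ∀ η : Fin m → UnitAddCircle, phase η (a :: w) = (fourier (-1) (η a) : ℂ) * phase η w := by
      intro η
      rw [← List.singleton_append, phase_append]
      simp [phase]
    rw [h, h, ih, Pi.add_apply, List.length_cons, pow_succ]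
    have : (fourier (-1) (ξ a + t) : ℂ) = fourier (-1) (ξ a) * fourier (-1) t := by
      simp [fourier_apply, AddCircle.toCircle_add, mul_comm]
    rw [this]; ring

open Polynomial in
/-- Along the circle `ξ + t (1, …, 1)` an entry of `row` is a polynomial in `exp (-2πit)`: the
prefixes of a word have pairwise different lengths. -/
noncomputable def rowPoly (ξ : Fin m → UnitAddCircle) (w : List (Fin m)) (c : Fin m) : ℂ[X] :=
  ∑ j : Fin w.length, monomial (j : ℕ) (if w.get j = c then phase ξ (w.take j) else 0)

lemma row_add_diagonal (ξ : Fin m → UnitAddCircle) (t : UnitAddCircle) (w : List (Fin m))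
    (c : Fin m) : row (ξ + fun _ => t) w c = (rowPoly ξ w c).eval (fourier (-1) t : ℂ) := by
  rw [row, rowPoly, Polynomial.eval_finsetSum]
  refine Finset.sum_congr rfl fun j _ => ?_
  rw [Polynomial.eval_monomial]
  split_ifs
  · rw [phase_add_diagonal, List.length_take, min_eq_left j.2.le]
  · simp

lemma coeff_rowPoly (ξ : Fin m → UnitAddCircle) (w : List (Fin m)) (c : Fin m) (j : Fin w.length) :
    (rowPoly ξ w c).coeff j = if w.get j = c then phase ξ (w.take j) else 0 := by
  rw [rowPoly, Polynomial.finsetSum_coeff, Finset.sum_eq_single j]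
  · simp
  · intro i _ hij
    rw [Polynomial.coeff_monomial, if_neg]
    exact fun h => hij (Fin.ext h)
  · simp

lemma coeff_rowPoly_of_le (ξ : Fin m → UnitAddCircle) (w : List (Fin m)) (c : Fin m) {j : ℕ}
    (hj : w.length ≤ j) : (rowPoly ξ w c).coeff j = 0 := by
  rw [rowPoly, Polynomial.finsetSum_coeff]
  refine Finset.sum_eq_zero fun i _ => ?_
  rw [Polynomial.coeff_monomial, if_neg]
  have := i.2
  omega

/-- Parseval's identity on the circles `ξ + t (1, …, 1)`: all coefficients of the polynomial have
modulus `0` or `1`. -/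
lemma integral_norm_row_sq (w : List (Fin m)) (c : Fin m) :
    ∫ ξ, ‖row ξ w c‖ ^ 2 = (w.count c : ℝ) := by
  rw [integral_eq_integral_diagonal (φ := fun ξ => ‖row ξ w c‖ ^ 2)
    ((continuous_row w c).norm.pow 2)]
  have key : ∀ ξ : Fin m → UnitAddCircle,
      ∫ t : UnitAddCircle, ‖row (ξ + fun _ => t) w c‖ ^ 2 = (w.count c : ℝ) := by
    intro ξ
    simp only [row_add_diagonal]
    rw [integral_fourier_neg_one fun z => ‖(rowPoly ξ w c).eval z‖ ^ 2,
      ← Polynomial.sum_sq_norm_coeff_eq_circleAverage]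
    have h1 : ∑ i ∈ (rowPoly ξ w c).support, ‖(rowPoly ξ w c).coeff i‖ ^ 2
        = ∑ i ∈ Finset.range w.length, ‖(rowPoly ξ w c).coeff i‖ ^ 2 := by
      refine Finset.sum_subset (fun i hi => ?_) fun i _ hi => ?_
      · by_contra h
        rw [Finset.mem_range, not_lt] at h
        exact Polynomial.mem_support_iff.1 hi (coeff_rowPoly_of_le ξ w c h)
      · rw [Polynomial.notMem_support_iff.1 hi]; simp
    rw [h1, Finset.sum_range]
    have h2 : ∀ j : Fin w.length, ‖(rowPoly ξ w c).coeff j‖ ^ 2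
        = if w.get j = c then (1 : ℝ) else 0 := by
      intro j
      rw [coeff_rowPoly]; split_ifs <;> simp
    simp only [h2]
    have h3 : ∀ w : List (Fin m), ∑ j : Fin w.length, (if w.get j = c then (1 : ℝ) else 0)
        = w.count c := by
      intro w
      induction w with
      | nil => simp
      | cons a w ih =>
        simp only [List.length_cons, Fin.sum_univ_succ, List.count_cons]
        push_cast
        rw [← ih, add_comm]
        by_cases h : a = c <;> simp [h]
    exact h3 w
  simp [key]

lemma log_max_continuous {X : Type*} [TopologicalSpace X] {f : X → ℝ} (hf : Continuous f) {δ : ℝ}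
    (hδ : 0 < δ) : Continuous fun x => Real.log (max (f x) δ) :=
  (hf.max continuous_const).log fun _ => (lt_max_of_lt_right hδ).ne'

/-- Jensen's inequality (through the Mahler measure) on the circles `ξ + t (1, …, 1)`: there the entry is a polynomial with
constant coefficient `1`, so its logarithm has non-negative mean. -/
lemma integral_log_row_nonneg (c : Fin m) (w : List (Fin m)) {δ : ℝ} (hδ : 0 < δ) :
    0 ≤ ∫ ξ, Real.log (max ‖row ξ (c :: w) c‖ δ) := by
  rw [integral_eq_integral_diagonal (log_max_continuous (continuous_row (c :: w) c).norm hδ)]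
  refine integral_nonneg fun ξ => ?_
  simp only [row_add_diagonal]
  rw [integral_fourier_neg_one fun z => Real.log (max ‖(rowPoly ξ (c :: w) c).eval z‖ δ)]
  set P := rowPoly ξ (c :: w) c with hP
  have h0 : P.coeff 0 = 1 := by
    have := coeff_rowPoly ξ (c :: w) c ⟨0, by simp⟩
    simpa using this
  have hP0 : P ≠ 0 := fun h => by simp [h] at h0
  have h1 : 0 ≤ P.logMahlerMeasure := by
    rw [Polynomial.logMahlerMeasure_eq_log_MahlerMeasure]
    refine Real.log_nonneg ?_
    have := P.norm_coeff_le_choose_mul_mahlerMeasure 0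
    simpa [h0] using this
  refine h1.trans ?_
  rw [Polynomial.logMahlerMeasure_def, Real.circleAverage_def, Real.circleAverage_def, smul_eq_mul,
    smul_eq_mul]
  refine mul_le_mul_of_nonneg_left ?_ (by positivity)
  refine intervalIntegral.integral_mono_ae (by positivity) P.intervalIntegrable_mahlerMeasure
    (Continuous.intervalIntegrable (log_max_continuous ?_ hδ) _ _) ?_
  · exact (P.continuous.comp (continuous_circleMap 0 1)).norm
  · have hroots : (circleMap 0 1 ⁻¹' {z | P.eval z = 0}).Countable := by
      refine Set.Countable.preimage_circleMap ?_ 0 one_ne_zero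
      exact ((Multiset.finite_toSet P.roots).subset fun z hz => by
        simpa [hP0] using hz).countable
    filter_upwards [hroots.ae_notMem volume] with θ hθ
    refine Real.log_le_log ?_ (le_max_left _ _)
    exact norm_pos_iff.2 hθ

end Diagonal

/-! ### The top Lyapunov exponent -/

section Lyapunov

open scoped Matrix.Norms.Operator

lemma continuous_cocycle (ζ : Substitution m) (n : ℕ) : Continuous fun ξ => ζ.cocycle ξ n := by
  refine continuous_matrix fun b c => ?_
  simp only [cocycle_apply]
  exact continuous_row _ _

lemma exists_norm_cocycle_le (ζ : Substitution m) :
    ∃ C : ℝ, 1 ≤ C ∧ ∀ n ξ, ‖ζ.cocycle ξ n‖ ≤ Real.exp (n * C) := by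
  have hbdd : ∃ D : ℝ, ∀ ξ, ‖ζ.spectralMatrix ξ‖ ≤ D := by
    have hc : Continuous fun ξ => ‖ζ.spectralMatrix ξ‖ := by
      have := (continuous_cocycle ζ 1).norm
      simpa [Substitution.cocycle] using this
    obtain ⟨D, hD⟩ := (isCompact_range hc).bddAbove
    exact ⟨D, fun ξ => hD ⟨ξ, rfl⟩⟩
  obtain ⟨D, hD⟩ := hbdd
  set C := max 1 (Real.log (max D 1)) with hC
  have hDC : D ≤ Real.exp C := by
    have h1 : (0 : ℝ) < max D 1 := by positivity
    calc D ≤ max D 1 := le_max_left _ _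
      _ = Real.exp (Real.log (max D 1)) := (Real.exp_log h1).symm
      _ ≤ _ := Real.exp_le_exp.2 (le_max_right _ _)
  refine ⟨C, le_max_left _ _, fun n ξ => ?_⟩
  induction n with
  | zero =>
    rw [Substitution.cocycle]
    refine (Matrix.linfty_opNorm_def (1 : Matrix (Fin m) (Fin m) ℂ)).le.trans ?_
    have : (Finset.univ.sup fun i => ∑ j, ‖(1 : Matrix (Fin m) (Fin m) ℂ) i j‖₊) ≤ 1 := by
      refine Finset.sup_le fun i _ => ?_
      rw [Finset.sum_eq_single i]
      · simp
      · intro j _ hj; simp [Matrix.one_apply_ne hj.symm]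
      · simp
    simpa using NNReal.coe_le_coe.2 this
  | succ n ih =>
    rw [Substitution.cocycle]
    refine (norm_mul_le _ _).trans ?_
    push_cast
    rw [add_mul, one_mul, add_comm, Real.exp_add]
    exact mul_le_mul ((hD _).trans hDC) ih (norm_nonneg _) (Real.exp_pos _).le

/-- The truncated logarithm `log (max ‖𝓜_ζ(ξ, n)‖ e⁻ⁿ)`. The truncation keeps the sequence
subadditive and bounded. -/
noncomputable def truncLog (ζ : Substitution m) (n : ℕ) (ξ : Fin m → UnitAddCircle) : ℝ :=
  Real.log (max ‖ζ.cocycle ξ n‖ (Real.exp (-n)))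

lemma norm_cocycle_le_exp (ζ : Substitution m) (n : ℕ) (ξ : Fin m → UnitAddCircle) :
    ‖ζ.cocycle ξ n‖ ≤ Real.exp (truncLog ζ n ξ) := by
  rw [truncLog, Real.exp_log (lt_max_of_lt_right (Real.exp_pos _))]
  exact le_max_left _ _

lemma truncLog_add_le (ζ : Substitution m) (k n : ℕ) (ξ : Fin m → UnitAddCircle) :
    truncLog ζ (k + n) ξ ≤ truncLog ζ k ξ + truncLog ζ n (ζ.toralEndo^[k] ξ) := by
  have h : ∀ (A : ℝ) (j : ℕ), 0 < max A (Real.exp (-j)) := fun A j =>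
    lt_max_of_lt_right (Real.exp_pos _)
  rw [truncLog, truncLog, truncLog, ← Real.log_mul (h _ _).ne' (h _ _).ne', cocycle_add]
  refine Real.log_le_log (h _ _) (max_le ?_ ?_)
  · refine (norm_mul_le _ _).trans ?_
    rw [mul_comm]
    exact mul_le_mul (le_max_left _ _) (le_max_left _ _) (norm_nonneg _) (h _ _).le
  · push_cast
    rw [neg_add, Real.exp_add]
    exact mul_le_mul (le_max_right _ _) (le_max_right _ _) (Real.exp_pos _).le (h _ _).le

/-- The cocycle dominates its entry at the first letter of `ζⁿ(0)`, whose logarithm has non-negative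
mean. -/
lemma integral_truncLog_nonneg [NeZero m] (ζ : Substitution m) (n : ℕ) :
    0 ≤ ∫ ξ, truncLog ζ n ξ := by
  obtain ⟨c, w, hw⟩ := List.exists_cons_of_ne_nil (ζ.iterWord_ne_nil n 0)
  refine (integral_log_row_nonneg c w (Real.exp_pos (-n))).trans ?_
  have hint : ∀ {φ : (Fin m → UnitAddCircle) → ℝ}, Continuous φ → Integrable φ := fun hφ =>
    hφ.integrable_of_hasCompactSupport (HasCompactSupport.of_compactSpace _)
  refine integral_mono
    (hint (log_max_continuous (continuous_row (c :: w) c).norm (Real.exp_pos _)))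
    (hint (log_max_continuous (continuous_cocycle ζ n).norm (Real.exp_pos _))) fun ξ => ?_
  refine Real.log_le_log (lt_max_of_lt_right (Real.exp_pos _)) (max_le_max_right _ ?_)
  rw [← hw, ← cocycle_apply]
  exact Substitution.norm_entry_le _ _ _

/-- Existence of the top Lyapunov exponent and its non-negativity, with a bound on the growth of the
cocycle that is uniform along the orbit. -/
theorem exists_lyapunov [NeZero m] (ζ : Substitution m)
    (herg : Ergodic ζ.toralEndo (volume : Measure (Fin m → UnitAddCircle))) :
    ∃ χ : ℝ, 0 ≤ χ ∧ ζ.IsTopLyapunovExponent χ ∧ ∀ β, χ < β →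
      ∀ᵐ ξ : Fin m → UnitAddCircle, ∃ B : ℝ, 0 ≤ B ∧
        ∀ j k : ℕ, ‖ζ.cocycle (ζ.toralEndo^[j] ξ) k‖ ≤ B * Real.exp (β * (j + k)) := by
  obtain ⟨C, hC1, hC⟩ := exists_norm_cocycle_le ζ
  have hbdd : ∀ n ξ, |truncLog ζ n ξ| ≤ n * C := by
    intro n ξ
    have h0 : (n : ℝ) ≤ n * C := le_mul_of_one_le_right (Nat.cast_nonneg _) hC1
    rw [abs_le, truncLog]
    constructor
    · rw [Real.le_log_iff_exp_le (lt_max_of_lt_right (Real.exp_pos _))]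
      exact (Real.exp_le_exp.2 (by linarith)).trans (le_max_right _ _)
    · rw [Real.log_le_iff_le_exp (lt_max_of_lt_right (Real.exp_pos _))]
      exact max_le (hC n ξ) (Real.exp_le_exp.2 (by linarith [Nat.cast_nonneg (α := ℝ) n]))
  obtain ⟨χ, h1, h2, h3⟩ := subadditive_ergodic herg (g := truncLog ζ) (C := C)
    (fun n => (log_max_continuous (continuous_cocycle ζ n).norm (Real.exp_pos _)).measurable)
    (truncLog_add_le ζ) (by linarith) hbdd
  have hχ : 0 ≤ χ := h1 0 fun n => by rw [mul_zero]; exact integral_truncLog_nonneg ζ n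
  refine ⟨χ, hχ, ?_, ?_⟩
  · filter_upwards [h2] with ξ hξ
    refine hξ.congr' ?_
    -- The limit is non-negative, so the truncation is eventually inactive.
    filter_upwards [hξ.eventually (lt_mem_nhds (show -1 < χ by linarith)),
      eventually_ge_atTop 1] with n hn hn1
    have hn0 : (0 : ℝ) < n := by exact_mod_cast hn1
    rw [lt_div_iff₀ hn0, truncLog,
      Real.lt_log_iff_exp_lt (lt_max_of_lt_right (Real.exp_pos _))] at hn
    rw [Substitution.logGrowth, truncLog, max_eq_left, one_div, div_eq_inv_mul]
    rcases lt_max_iff.1 hn with h | h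
    · exact le_of_lt (by simpa using h)
    · simp at h
  · intro β hβ
    filter_upwards [h3 ((χ + β) / 2) (by linarith) ((β - χ) / 2) (by linarith)] with ξ ⟨B, hB⟩
    refine ⟨Real.exp B, (Real.exp_pos _).le, fun j k => ?_⟩
    refine (norm_cocycle_le_exp ζ k _).trans ?_
    rw [← Real.exp_add]
    refine Real.exp_le_exp.2 ((hB j k).trans ?_)
    have h4 : 0 ≤ (j : ℝ) * ((χ + β) / 2) := mul_nonneg (Nat.cast_nonneg _) (by linarith)
    nlinarith

lemma norm_cocycle_sq_le (ζ : Substitution m) (ξ : Fin m → UnitAddCircle) (n : ℕ) :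
    ‖ζ.cocycle ξ n‖ ^ 2 ≤ (m * m : ℕ) * ∑ b, ∑ c, ‖row ξ (ζ.iterWord n b) c‖ ^ 2 := by
  have h1 := Substitution.norm_le_sum_norm (ζ.cocycle ξ n)
  have h2 := pow_le_pow_left₀ (norm_nonneg _) h1 2
  refine h2.trans ?_
  rw [← Finset.sum_product', ← Finset.sum_product']
  refine (sq_sum_le_card_mul_sum_sq).trans (le_of_eq ?_)
  simp [cocycle_apply]

lemma integral_norm_cocycle_sq_le (ζ : Substitution m) (n : ℕ) :
    ∫ ξ, ‖ζ.cocycle ξ n‖ ^ 2 ≤ (m * m : ℕ) * ∑ b, ((ζ.iterWord n b).length : ℝ) := by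
  have hint : ∀ {φ : (Fin m → UnitAddCircle) → ℝ}, Continuous φ → Integrable φ := fun hφ =>
    hφ.integrable_of_hasCompactSupport (HasCompactSupport.of_compactSpace _)
  have hr : ∀ b c, Continuous fun ξ => ‖row ξ (ζ.iterWord n b) c‖ ^ 2 := fun b c =>
    (continuous_row _ _).norm.pow 2
  refine (integral_mono (hint ((continuous_cocycle ζ n).norm.pow 2))
    (hint ?_) fun ξ => norm_cocycle_sq_le ζ ξ n).trans ?_
  · exact continuous_const.mul (continuous_finsetSum _ fun b _ => continuous_finsetSum _ fun c _ =>
      hr b c)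
  · rw [integral_const_mul, integral_finsetSum _ fun b _ => hint (continuous_finsetSum _ fun c _ =>
      hr b c)]
    refine mul_le_mul_of_nonneg_left (Finset.sum_le_sum fun b _ => ?_) (Nat.cast_nonneg _)
    rw [integral_finsetSum _ fun c _ => hint (hr b c)]
    simp only [integral_norm_row_sq]
    rw [Substitution.length_eq_sum_count]
    push_cast; rfl

/-- The second moment of the cocycle grows like `θ₁ⁿ`. By the Borel-Cantelli argument the cocycle
itself almost surely grows no faster than `θ₁^(n/2)`. -/
theorem lyapunov_le [NeZero m] (ζ : Substitution m) {χ : ℝ} (hχ : ζ.IsTopLyapunovExponent χ) :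
    χ ≤ (1 / 2) * Real.log ζ.perronRoot := by
  by_contra hcon
  push Not at hcon
  obtain ⟨η, hη, hηχ⟩ := exists_between hcon
  have hθ := ζ.one_le_perronRoot
  have hη0 : 0 < η := lt_of_le_of_lt (by have := Real.log_nonneg hθ; positivity) hη
  -- `r` lies strictly between `θ₁` and `exp (2η)`.
  have hr : ζ.perronRoot < Real.exp (2 * η) := by
    rw [← Real.log_lt_iff_lt_exp (by linarith)]; linarith
  obtain ⟨r, hr1, hr2⟩ := exists_between hr
  set q := r * Real.exp (-(2 * η)) with hq
  have hr0 : 0 < r := by linarith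
  have hq1 : q < 1 := by
    rw [hq, Real.exp_neg, ← div_eq_mul_inv, div_lt_one (Real.exp_pos _)]; exact hr2
  have hq0 : 0 ≤ q := by positivity
  let F : ℕ → (Fin m → UnitAddCircle) → ℝ := fun n ξ =>
    ‖ζ.cocycle ξ n‖ ^ 2 * Real.exp (-(2 * η)) ^ n
  have hFc : ∀ n, Continuous (F n) := fun n =>
    ((continuous_cocycle ζ n).norm.pow 2).mul continuous_const
  have hF0 : ∀ n ξ, 0 ≤ F n ξ := fun n ξ => by positivity
  have hFint : ∀ᶠ n in atTop, ∫ ξ, F n ξ ≤ ((m * m : ℕ) * m : ℝ) * q ^ n := by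
    filter_upwards [ζ.eventually_norm_pow_le hr1] with n hn
    rw [integral_mul_const, hq, mul_pow]
    rw [← mul_assoc]
    refine mul_le_mul_of_nonneg_right ((integral_norm_cocycle_sq_le ζ n).trans ?_) (by positivity)
    rw [mul_assoc]
    refine mul_le_mul_of_nonneg_left ((ζ.sum_length_le_norm_pow n).trans ?_) (Nat.cast_nonneg _)
    exact mul_le_mul_of_nonneg_left hn (Nat.cast_nonneg _)
  obtain ⟨N, hN⟩ := eventually_atTop.1 hFint
  -- the shift by `N` skips the times at which the growth bound is not yet available
  have hsum : ∑' n, ∫⁻ ξ, ENNReal.ofReal (F (n + N) ξ) ≠ ⊤ := by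
    have hle : ∀ n, ∫⁻ ξ, ENNReal.ofReal (F (n + N) ξ)
        ≤ ENNReal.ofReal (((m * m : ℕ) * m : ℝ) * q ^ (n + N)) := by
      intro n
      rw [← ofReal_integral_eq_lintegral_ofReal
        ((hFc _).integrable_of_hasCompactSupport (HasCompactSupport.of_compactSpace _))
        (ae_of_all _ (hF0 _))]
      exact ENNReal.ofReal_le_ofReal (hN _ (by omega))
    refine ((ENNReal.tsum_le_tsum hle).trans_lt ?_).ne
    have hs : Summable fun n => ((m * m : ℕ) * m : ℝ) * q ^ (n + N) :=
      ((summable_nat_add_iff N).2 (summable_geometric_of_lt_one hq0 hq1)).mul_left _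
    rw [← ENNReal.ofReal_tsum_of_nonneg (fun n => by positivity) hs]
    exact ENNReal.ofReal_lt_top
  have hmeas : ∀ n, Measurable fun ξ => ENNReal.ofReal (F (n + N) ξ) := fun n =>
    (hFc _).measurable.ennreal_ofReal
  rw [← lintegral_tsum fun n => (hmeas n).aemeasurable] at hsum
  have hae := ae_lt_top (Measurable.tsum hmeas) hsum
  obtain ⟨ξ, h1, h2⟩ := (hae.and hχ).exists
  have h3 := ENNReal.tendsto_atTop_zero_of_tsum_ne_top h1.ne
  have h4 := (h3.eventually (gt_mem_nhds (show (0 : ENNReal) < 1 by simp)))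
  have h5 := (tendsto_add_atTop_nat N).eventually (h2.eventually (lt_mem_nhds hηχ))
  obtain ⟨n, h6, h7, h8⟩ := (h4.and (h5.and (eventually_ge_atTop 1))).exists
  rw [ENNReal.ofReal_lt_one] at h6
  set k := n + N with hk
  have hk0 : (0 : ℝ) < k := by exact_mod_cast (by omega : 0 < k)
  rw [Substitution.logGrowth, one_div, ← div_eq_inv_mul, lt_div_iff₀ hk0] at h7
  have hpos : 0 < ‖ζ.cocycle ξ k‖ := by
    -- a vanishing norm has logarithm `0`, which the strict positivity of `η` excludes
    rcases (norm_nonneg (ζ.cocycle ξ k)).eq_or_lt with h | h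
    · rw [← h, Real.log_zero] at h7
      have := mul_pos hη0 hk0
      linarith
    · exact h
  rw [Real.lt_log_iff_exp_lt hpos] at h7
  have h9 := pow_le_pow_left₀ (Real.exp_pos _).le h7.le 2
  have h10 : Real.exp (η * k) ^ 2 * Real.exp (-(2 * η)) ^ k = 1 := by
    rw [← Real.exp_nat_mul, ← Real.exp_nat_mul, ← Real.exp_add, Real.exp_eq_one_iff]
    push_cast; ring
  have h11 : Real.exp (η * k) ^ 2 * Real.exp (-(2 * η)) ^ k ≤ F k ξ :=
    mul_le_mul_of_nonneg_right h9 (by positivity)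
  linarith

end Lyapunov

end SpectralCocycle

/-! ### Twisted sums over words -/

namespace SpectralCocycle

variable {m : ℕ}

section Growth

lemma norm_append_le {ξ : Fin m → UnitAddCircle} {V : List (Fin m) → ℂ} {C : ℝ}
    (hV : ∀ u v, ‖V (u ++ v) - V u - phase ξ u * V v‖ ≤ C) (u v : List (Fin m)) :
    ‖V (u ++ v)‖ ≤ ‖V u‖ + ‖V v‖ + C := by
  have e : V (u ++ v) = (V (u ++ v) - V u - phase ξ u * V v) + (V u + phase ξ u * V v) := by ring
  rw [e]
  refine (norm_add_le _ _).trans ?_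
  have h2 := norm_add_le (V u) (phase ξ u * V v)
  rw [norm_mul, norm_phase, one_mul] at h2
  linarith [hV u v]

lemma norm_right_le {ξ : Fin m → UnitAddCircle} {V : List (Fin m) → ℂ} {C : ℝ}
    (hV : ∀ u v, ‖V (u ++ v) - V u - phase ξ u * V v‖ ≤ C) (u v : List (Fin m)) :
    ‖V v‖ ≤ ‖V (u ++ v)‖ + ‖V u‖ + C := by
  have h : ‖V v‖ = ‖phase ξ u * V v‖ := by rw [norm_mul, norm_phase, one_mul]
  have e : phase ξ u * V v = V (u ++ v) - V u - (V (u ++ v) - V u - phase ξ u * V v) := by ring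
  rw [h, e]
  refine (norm_sub_le _ _).trans ?_
  have h2 := norm_sub_le (V (u ++ v)) (V u)
  linarith [hV u v]

/-- A prefix of `ζⁿ(v)` consists of `k` complete blocks `ζⁿ(a)` and a prefix of one more block. -/
lemma norm_prefix_le (ζ : Substitution m) {ξ : Fin m → UnitAddCircle} {V : List (Fin m) → ℂ}
    {C : ℝ} (hnil : V [] = 0) (hV : ∀ u v, ‖V (u ++ v) - V u - phase ξ u * V v‖ ≤ C)
    {n N : ℕ} (hN : ∀ a, N ≤ (ζ.iterWord n a).length) {A P : ℝ} (hP0 : 0 ≤ P)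
    (hA : ∀ a, ‖V (ζ.iterWord n a)‖ ≤ A) (hP : ∀ a W, W <+: ζ.iterWord n a → ‖V W‖ ≤ P)
    (v W : List (Fin m)) (hW : W <+: ζ.iter n v) :
    ∃ k : ℕ, k ≤ v.length ∧ k * N ≤ W.length ∧ ‖V W‖ ≤ k * (A + C) + P := by
  induction v generalizing W with
  | nil =>
    rw [ζ.iter_nil, List.prefix_nil] at hW
    subst hW
    exact ⟨0, by simp, by simp, by simpa [hnil] using hP0⟩
  | cons a v ih =>
    rw [ζ.iter_cons] at hW
    rcases List.prefix_or_prefix_of_prefix hW (List.prefix_append (ζ.iterWord n a) (ζ.iter n v))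
      with h | ⟨W', rfl⟩
    · exact ⟨0, by simp, by simp, by simpa using hP a W h⟩
    · rw [List.prefix_append_right_inj] at hW
      obtain ⟨k, h1, h2, h3⟩ := ih W' hW
      refine ⟨k + 1, by simpa using h1, ?_, ?_⟩
      · rw [List.length_append]; linarith [hN a]
      · have := norm_append_le hV (ζ.iterWord n a) W'
        push_cast
        linarith [hA a]

/-- A subword of `ζⁿ(v)` consists of `k` complete blocks `ζⁿ(a)` and of subwords of at most two
more blocks. -/
lemma norm_infix_le (ζ : Substitution m) {ξ : Fin m → UnitAddCircle} {V : List (Fin m) → ℂ}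
    {C : ℝ} (hC : 0 ≤ C) (hnil : V [] = 0)
    (hV : ∀ u v, ‖V (u ++ v) - V u - phase ξ u * V v‖ ≤ C)
    {n N : ℕ} (hN : ∀ a, N ≤ (ζ.iterWord n a).length) {A P : ℝ} (hP0 : 0 ≤ P)
    (hA : ∀ a, ‖V (ζ.iterWord n a)‖ ≤ A) (hP : ∀ a W, W <+: ζ.iterWord n a → ‖V W‖ ≤ P)
    (v W : List (Fin m)) (hW : W <:+: ζ.iter n v) :
    ∃ k : ℕ, k * N ≤ W.length ∧ ‖V W‖ ≤ k * (A + C) + 3 * P + 2 * C := by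
  induction v with
  | nil =>
    rw [ζ.iter_nil, List.infix_nil] at hW
    subst hW
    refine ⟨0, by simp, ?_⟩
    simp only [hnil, norm_zero, Nat.cast_zero, zero_mul, zero_add]
    positivity
  | cons a v ih =>
    obtain ⟨p, q, h⟩ := hW
    rw [ζ.iter_cons, List.append_assoc] at h
    rcases List.append_eq_append_iff.1 h with ⟨u, h1, h2⟩ | ⟨u, h1, h2⟩
    · have hp : ‖V p‖ ≤ P := hP a p ⟨u, h1.symm⟩
      have hright := fun x => norm_right_le hV p x
      rcases List.append_eq_append_iff.1 h2 with ⟨u', h3, h4⟩ | ⟨u', h3, h4⟩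
      · have := hP a (p ++ W) ⟨u', by rw [h1, h3, List.append_assoc]⟩
        refine ⟨0, by simp, ?_⟩
        simp only [Nat.cast_zero, zero_mul, zero_add]
        linarith [hright W]
      · obtain ⟨k, -, h5, h6⟩ := norm_prefix_le ζ hnil hV hN hP0 hA hP v u' ⟨q, h4.symm⟩
        have h7 := hP a (p ++ u) ⟨[], by rw [List.append_nil, h1]⟩
        refine ⟨k, ?_, ?_⟩
        · rw [h3, List.length_append]; omega
        · rw [h3]
          linarith [hright u, norm_append_le hV u u']
    · exact ih ⟨u, q, by rw [List.append_assoc]; exact h2.symm⟩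

open scoped Matrix.Norms.Operator in
/-- Iterating the almost-equivariance of `V`: the vector `V (ζⁿ(a))` is a sum of `n + 1` vectors of
bounded length transported by the cocycle. -/
lemma norm_iterWord_le (ζ : Substitution m) {ξ : Fin m → UnitAddCircle} {V : List (Fin m) → ℂ}
    {C D B β : ℝ} {L : ℕ} (hC : 0 ≤ C) (hD : 0 ≤ D) (hnil : V [] = 0)
    (hV : ∀ u v, ‖V (u ++ v) - V u - phase ξ u * V v‖ ≤ C) (hD1 : ∀ a, ‖V [a]‖ ≤ D)
    (hL : ∀ a, (ζ.word a).length ≤ L) (hB0 : 0 ≤ B)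
    (hB : ∀ j k : ℕ, ‖ζ.cocycle (ζ.toralEndo^[j] ξ) k‖ ≤ B * Real.exp (β * (j + k))) (n : ℕ)
    (a : Fin m) :
    ‖V (ζ.iterWord n a)‖ ≤ (n + 1) * (B * (D + C * L)) * Real.exp (β * n) := by
  set M := D + C * L with hM
  have hM0 : 0 ≤ M := by positivity
  -- `r j` is the error made at the `j`-th substitution step
  have key : ∀ n : ℕ, ∃ r : ℕ → Fin m → ℂ, (∀ j, ‖r j‖ ≤ M) ∧
      (fun a => V (ζ.iterWord n a)) =
        ∑ j ∈ Finset.range (n + 1), (ζ.cocycle (ζ.toralEndo^[j] ξ) (n - j)).mulVec (r j) := by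
    intro n
    induction n with
    | zero =>
      refine ⟨fun _ a => V [a], fun _ => ?_, ?_⟩
      · refine (pi_norm_le_iff_of_nonneg hM0).2 fun a => (hD1 a).trans ?_
        rw [hM]
        have : 0 ≤ C * L := by positivity
        linarith
      · simp [Substitution.cocycle, Substitution.iterWord]
    | succ n ih =>
      obtain ⟨r, hr, h⟩ := ih
      let e : Fin m → ℂ := fun a => V (ζ.iterWord (n + 1) a) -
        ((ζ.spectralMatrix (ζ.toralEndo^[n] ξ)).mulVec fun a => V (ζ.iterWord n a)) a
      have he : ‖e‖ ≤ M := by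
        refine (pi_norm_le_iff_of_nonneg hM0).2 fun a => ?_
        have h1 := norm_sub_sum_row_le ζ ξ hnil hV n (ζ.word a)
        rw [← ζ.iterWord_succ] at h1
        have h2 : C * (ζ.word a).length ≤ C * L :=
          mul_le_mul_of_nonneg_left (by exact_mod_cast hL a) hC
        refine h1.trans (h2.trans ?_)
        rw [hM]; linarith
      refine ⟨fun j => if j = n + 1 then e else r j, fun j => ?_, ?_⟩
      · dsimp only; split_ifs
        exacts [he, hr j]
      · rw [Finset.sum_range_succ]
        have h3 : ∀ j ∈ Finset.range (n + 1),
            (ζ.cocycle (ζ.toralEndo^[j] ξ) (n + 1 - j)).mulVec (if j = n + 1 then e else r j)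
            = (ζ.spectralMatrix (ζ.toralEndo^[n] ξ)).mulVec
              ((ζ.cocycle (ζ.toralEndo^[j] ξ) (n - j)).mulVec (r j)) := by
          intro j hj
          rw [Finset.mem_range] at hj
          rw [if_neg (by omega), Nat.sub_add_comm (by omega : j ≤ n), Substitution.cocycle,
            ← Function.iterate_add_apply, Nat.sub_add_cancel (by omega), Matrix.mulVec_mulVec]
        rw [Finset.sum_congr rfl h3, ← Matrix.mulVec_sum, ← h]
        ext a
        simp [e, Substitution.cocycle]
  obtain ⟨r, hr, h⟩ := key n
  have h1 : ‖V (ζ.iterWord n a)‖ ≤ ‖fun a => V (ζ.iterWord n a)‖ :=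
    norm_le_pi_norm (fun a => V (ζ.iterWord n a)) a
  refine h1.trans ?_
  rw [h]
  refine (norm_sum_le _ _).trans ?_
  have h2 : ∀ j ∈ Finset.range (n + 1),
      ‖(ζ.cocycle (ζ.toralEndo^[j] ξ) (n - j)).mulVec (r j)‖ ≤ B * M * Real.exp (β * n) := by
    intro j hj
    rw [Finset.mem_range] at hj
    refine (Matrix.linfty_opNorm_mulVec _ _).trans ?_
    have h3 := hB j (n - j)
    rw [← Nat.cast_add, Nat.add_sub_cancel' (by omega)] at h3
    refine (mul_le_mul h3 (hr j) (norm_nonneg _) (by positivity)).trans (le_of_eq (by ring))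
  refine (Finset.sum_le_sum h2).trans (le_of_eq ?_)
  simp; ring

/-- Growth of twisted sums over subwords of `ζⁿ(v)` along a point at which the spectral cocycle
grows at most like `exp (β n)`. -/
theorem exists_norm_infix_le (ζ : Substitution m) {ξ : Fin m → UnitAddCircle}
    {V : List (Fin m) → ℂ} {C D B β : ℝ} (hC : 0 ≤ C) (hD : 0 ≤ D) (hnil : V [] = 0)
    (hV : ∀ u v, ‖V (u ++ v) - V u - phase ξ u * V v‖ ≤ C) (hD1 : ∀ a, ‖V [a]‖ ≤ D)
    (hβ : 0 ≤ β) (hB0 : 0 ≤ B)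
    (hB : open scoped Matrix.Norms.Operator in
      ∀ j k : ℕ, ‖ζ.cocycle (ζ.toralEndo^[j] ξ) k‖ ≤ B * Real.exp (β * (j + k))) :
    ∃ K : ℝ, 0 ≤ K ∧ ∀ n N : ℕ, (∀ a, N ≤ (ζ.iterWord n a).length) →
      ∀ v W, W <:+: ζ.iter n v → ∃ k : ℕ, k * N ≤ W.length ∧
        ‖V W‖ ≤ K * (n + 1) ^ 2 * Real.exp (β * n) * (k + 1) := by
  obtain ⟨L, hL⟩ : ∃ L : ℕ, ∀ a, (ζ.word a).length ≤ L :=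
    ⟨∑ a, (ζ.word a).length, fun a => Finset.single_le_sum
      (f := fun a => (ζ.word a).length) (fun _ _ => Nat.zero_le _) (Finset.mem_univ a)⟩
  set Q := B * (D + C * L) + C + D with hQ
  have hQ0 : 0 ≤ Q := by positivity
  have hexp : ∀ n : ℕ, 1 ≤ Real.exp (β * n) := fun n => Real.one_le_exp (by positivity)
  have hA : ∀ n a, ‖V (ζ.iterWord n a)‖ ≤ (n + 1) * Q * Real.exp (β * n) := by
    intro n a
    refine (norm_iterWord_le ζ hC hD hnil hV hD1 hL hB0 hB n a).trans ?_
    gcongr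
    rw [hQ]; linarith
  have hCQ : ∀ n : ℕ, C ≤ (n + 1) * Q * Real.exp (β * n) := by
    intro n
    have h1 : C ≤ Q := by rw [hQ]; have : 0 ≤ B * (D + C * L) := by positivity
                          linarith
    have h2 : Q ≤ (n + 1) * Q := le_mul_of_one_le_left hQ0 (by linarith [Nat.cast_nonneg (α := ℝ) n])
    exact (h1.trans h2).trans (le_mul_of_one_le_right (by positivity) (hexp n))
  set R := 2 * L * Q + Q with hR
  have hR0 : 0 ≤ R := by positivity
  -- a prefix of `ζⁿ⁺¹(a)` is made of at most `L` blocks `ζⁿ(b)` and a prefix of one more block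
  have hP : ∀ n : ℕ, ∀ a W, W <+: ζ.iterWord n a →
      ‖V W‖ ≤ (n + 1) ^ 2 * R * Real.exp (β * n) := by
    intro n
    induction n with
    | zero =>
      intro a W hW
      have hDR : D ≤ R := by
        have : 0 ≤ B * (D + C * L) := by positivity
        have : 0 ≤ 2 * L * Q := by positivity
        rw [hR]; linarith
      have hW' : W = [] ∨ W = [a] := by
        have h : W <+: [a] := hW
        rcases W with _ | ⟨b, W⟩
        · exact Or.inl rfl
        · rw [List.cons_prefix_cons, List.prefix_nil] at h
          exact Or.inr (by rw [h.1, h.2])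
      rcases hW' with rfl | rfl
      · simp [hnil, hR0]
      · simpa using (hD1 a).trans hDR
    | succ n ih =>
      intro a W hW
      rw [ζ.iterWord_succ] at hW
      obtain ⟨k, hk, -, h⟩ := norm_prefix_le ζ hnil hV (N := 0) (fun _ => Nat.zero_le _)
        (by positivity) (hA n) ih (ζ.word a) W hW
      have hkL : (k : ℝ) ≤ L := by exact_mod_cast hk.trans (hL a)
      have h2 : (k : ℝ) * ((n + 1) * Q * Real.exp (β * n) + C)
          ≤ L * (2 * ((n + 1) * Q * Real.exp (β * n))) :=
        mul_le_mul hkL (by linarith [hCQ n]) (by positivity) (by positivity)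
      have h3 : Real.exp (β * n) ≤ Real.exp (β * (n + 1 : ℕ)) := by
        refine Real.exp_le_exp.2 (mul_le_mul_of_nonneg_left ?_ hβ)
        push_cast; linarith
      have h4 : (L : ℝ) * (2 * ((n + 1) * Q * Real.exp (β * n))) ≤
          (n + 1) * R * Real.exp (β * n) := by
        have : 0 ≤ (n + 1) * Q * Real.exp (β * n) := by positivity
        rw [hR]; nlinarith
      have h5 : ((n : ℝ) + 1) * R * Real.exp (β * n) + (n + 1) ^ 2 * R * Real.exp (β * n)
          ≤ ((n : ℝ) + 1 + 1) ^ 2 * R * Real.exp (β * n) := by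
        have : 0 ≤ R * Real.exp (β * n) := by positivity
        have hn : (0 : ℝ) ≤ n := Nat.cast_nonneg n
        nlinarith
      have h6 : ((n : ℝ) + 1 + 1) ^ 2 * R * Real.exp (β * n)
          ≤ ((n : ℝ) + 1 + 1) ^ 2 * R * Real.exp (β * (n + 1 : ℕ)) := by gcongr
      push_cast at *
      linarith
  refine ⟨2 * Q + 3 * R + 2 * Q, by positivity, fun n N hN v W hW => ?_⟩
  obtain ⟨k, hk, h⟩ := norm_infix_le ζ hC hnil hV hN (by positivity) (hA n) (hP n) v W hW
  refine ⟨k, hk, h.trans ?_⟩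
  set E := Real.exp (β * n) with hE
  have hE0 : 0 ≤ E := (Real.exp_pos _).le
  have h1 : ((n : ℝ) + 1) * Q * E ≤ (n + 1) ^ 2 * Q * E := by
    have : ((n : ℝ) + 1) ≤ (n + 1) ^ 2 := by nlinarith [Nat.cast_nonneg (α := ℝ) n]
    gcongr
  have h2 : (k : ℝ) * ((n + 1) * Q * E + C) ≤ k * (2 * ((n + 1) ^ 2 * Q * E)) :=
    mul_le_mul_of_nonneg_left (by linarith [hCQ n]) (Nat.cast_nonneg k)
  have h3 : 0 ≤ (k : ℝ) * (3 * ((n + 1) ^ 2 * R * E)) := by positivity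
  have h4 : 0 ≤ (k : ℝ) * (2 * ((n + 1) ^ 2 * Q * E)) := by positivity
  have h5 := hCQ n
  have h6 : 0 ≤ ((n : ℝ) + 1) ^ 2 * Q * E := by positivity
  linarith

end Growth

/-! ### Twisted sums along orbits of the shift -/

section WindowSums

/-- The two-sided sequence that continues the word `w` (placed at `0, …, |w| - 1`) by a fixed letter
on both sides. -/
def extendWord [NeZero m] (w : List (Fin m)) (i : ℤ) : Fin m :=
  if 0 ≤ i then w.getD i.toNat 0 else 0

lemma extendWord_append_left [NeZero m] (u v : List (Fin m)) {i : ℤ} (hi : i < u.length) :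
    extendWord (u ++ v) i = extendWord u i := by
  unfold extendWord
  split_ifs with h
  · rw [List.getD_append _ _ _ _ (by omega)]
  · rfl

lemma extendWord_append_right [NeZero m] (u v : List (Fin m)) {i : ℤ} (hi : 0 ≤ i) :
    extendWord (u ++ v) (u.length + i) = extendWord v i := by
  unfold extendWord
  rw [if_pos (by omega), if_pos hi, List.getD_append_right _ _ _ _ (by omega)]
  congr 1; omega

/-- `G` depends on the coordinates `x_{-K}, …, x_K` only. -/
def IsWindow (K : ℕ) (G : (ℤ → Fin m) → ℂ) : Prop :=
  ∀ x y, (∀ i : ℤ, |i| ≤ K → x i = y i) → G x = G y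

/-- The twisted sum of `G` along the word `w`; beyond the ends of `w` the letters are replaced by a
fixed one. -/
noncomputable def wordSum [NeZero m] (ξ : Fin m → UnitAddCircle) (G : (ℤ → Fin m) → ℂ)
    (w : List (Fin m)) : ℂ :=
  ∑ j ∈ Finset.range w.length, phase ξ (w.take j) * G fun i => extendWord w (i + j)

/-- Only the last `K` summands contribute. -/
lemma sum_ite_le (n K : ℕ) {D : ℝ} (hD : 0 ≤ D) :
    ∑ j ∈ Finset.range n, (if j + K < n then 0 else D) ≤ K * D := by
  induction n with
  | zero => simp; positivity
  | succ n ih =>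
    rcases Nat.lt_or_ge n K with h | h
    · refine (Finset.sum_le_sum (g := fun _ => D) fun j _ => ?_).trans ?_
      · split_ifs <;> simp [hD]
      · simp only [Finset.sum_const, Finset.card_range, nsmul_eq_mul]
        exact mul_le_mul_of_nonneg_right (by exact_mod_cast h) hD
    · obtain ⟨d, rfl⟩ := Nat.exists_eq_add_of_le h
      rw [show K + d + 1 = (d + 1) + K by ring, Finset.sum_range_add, Finset.sum_eq_zero, zero_add]
      · refine (Finset.sum_le_sum (g := fun _ => D) fun j _ => ?_).trans (by simp)
        split_ifs <;> simp [hD]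
      · intro j hj
        rw [Finset.mem_range] at hj
        rw [if_pos (by omega)]

/-- Only the first `K` summands contribute. -/
lemma sum_ite_le' (n K : ℕ) {D : ℝ} (hD : 0 ≤ D) :
    ∑ j ∈ Finset.range n, (if K ≤ j then 0 else D) ≤ K * D := by
  rw [← Finset.sum_range_reflect]
  refine (Finset.sum_le_sum fun j hj => ?_).trans (sum_ite_le n K hD)
  rw [Finset.mem_range] at hj
  split_ifs <;> first | omega | exact le_rfl

lemma norm_sub_le_of_bound {G : (ℤ → Fin m) → ℂ} {D : ℝ} (hD : ∀ x, ‖G x‖ ≤ D) (x y : ℤ → Fin m) :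
    ‖G x - G y‖ ≤ 2 * D := (norm_sub_le _ _).trans (by linarith [hD x, hD y])

/-- Window sums are additive up to phase: only the `2K` positions near the junction differ. -/
lemma wordSum_append [NeZero m] (ξ : Fin m → UnitAddCircle) {G : (ℤ → Fin m) → ℂ} {K : ℕ} {D : ℝ}
    (hG : IsWindow K G) (hD : ∀ x, ‖G x‖ ≤ D) (u v : List (Fin m)) :
    ‖wordSum ξ G (u ++ v) - wordSum ξ G u - phase ξ u * wordSum ξ G v‖ ≤ 4 * K * D := by
  have hD0 : 0 ≤ D := (norm_nonneg _).trans (hD fun _ => 0)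
  have e : wordSum ξ G (u ++ v) - wordSum ξ G u - phase ξ u * wordSum ξ G v =
      ∑ j ∈ Finset.range u.length, phase ξ (u.take j) *
        ((G fun i => extendWord (u ++ v) (i + j)) - G fun i => extendWord u (i + j)) +
      ∑ j ∈ Finset.range v.length, phase ξ u * phase ξ (v.take j) *
        ((G fun i => extendWord (u ++ v) (i + (u.length + j : ℕ))) -
          G fun i => extendWord v (i + j)) := by
    simp only [mul_sub, Finset.sum_sub_distrib]
    simp only [wordSum, List.length_append, Finset.sum_range_add, Finset.mul_sum]
    have h1 : ∀ j ∈ Finset.range u.length,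
        phase ξ ((u ++ v).take j) * (G fun i => extendWord (u ++ v) (i + j))
        = phase ξ (u.take j) * (G fun i => extendWord (u ++ v) (i + j)) := by
      intro j hj
      rw [List.take_append_of_le_length (Finset.mem_range.1 hj).le]
    have h2 : ∀ j ∈ Finset.range v.length,
        phase ξ ((u ++ v).take (u.length + j)) *
          (G fun i => extendWord (u ++ v) (i + (u.length + j : ℕ)))
        = phase ξ u * phase ξ (v.take j) *
          (G fun i => extendWord (u ++ v) (i + (u.length + j : ℕ))) := by
      intro j _
      rw [List.take_length_add_append, phase_append]
    rw [Finset.sum_congr rfl h1, Finset.sum_congr rfl h2]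
    simp only [mul_assoc]
    ring
  rw [e]
  have hA : ‖∑ j ∈ Finset.range u.length, phase ξ (u.take j) *
      ((G fun i => extendWord (u ++ v) (i + j)) - G fun i => extendWord u (i + j))‖
      ≤ K * (2 * D) := by
    refine (norm_sum_le _ _).trans ((Finset.sum_le_sum fun j hj => ?_).trans
      (sum_ite_le u.length K (D := 2 * D) (by positivity)))
    rw [norm_mul, norm_phase, one_mul]
    split_ifs with h
    · rw [hG _ (fun i => extendWord u (i + j)) fun i hi => ?_, sub_self, norm_zero]
      rw [abs_le] at hi
      exact extendWord_append_left u v (by omega)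
    · exact norm_sub_le_of_bound hD _ _
  have hB : ‖∑ j ∈ Finset.range v.length, phase ξ u * phase ξ (v.take j) *
        ((G fun i => extendWord (u ++ v) (i + (u.length + j : ℕ))) -
          G fun i => extendWord v (i + j))‖ ≤ K * (2 * D) := by
    refine (norm_sum_le _ _).trans ((Finset.sum_le_sum fun j hj => ?_).trans
      (sum_ite_le' v.length K (D := 2 * D) (by positivity)))
    rw [norm_mul, norm_mul, norm_phase, norm_phase, one_mul, one_mul]
    split_ifs with h
    · rw [hG _ (fun i => extendWord v (i + j)) fun i hi => ?_, sub_self, norm_zero]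
      rw [abs_le] at hi
      have := extendWord_append_right u v (i := i + j) (by omega)
      rw [← this]
      congr 1; push_cast; ring
    · exact norm_sub_le_of_bound hD _ _
  refine (norm_add_le _ _).trans ?_
  linarith

/-- The word `x₀ … x_{J-1}`. -/
def prefixWord (x : ℤ → Fin m) (J : ℕ) : List (Fin m) :=
  (List.range J).map fun j : ℕ => x j

@[simp] lemma length_prefixWord (x : ℤ → Fin m) (J : ℕ) : (prefixWord x J).length = J := by
  simp [prefixWord]

lemma take_prefixWord (x : ℤ → Fin m) {j J : ℕ} (h : j ≤ J) :
    (prefixWord x J).take j = prefixWord x j := by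
  rw [prefixWord, ← List.map_take, List.take_range, min_eq_left h, prefixWord]

lemma extendWord_prefixWord [NeZero m] (x : ℤ → Fin m) {J : ℕ} {i : ℤ} (h0 : 0 ≤ i) (h1 : i < J) :
    extendWord (prefixWord x J) i = x i := by
  rw [extendWord, if_pos h0, List.getD_eq_getElem _ _ (by simpa using by omega)]
  simp [prefixWord, h0]

/-- Twisted sums along an orbit of the shift agree with twisted sums along words up to a bounded
error. -/
lemma norm_sum_sub_wordSum_le [NeZero m] (ξ : Fin m → UnitAddCircle) {G : (ℤ → Fin m) → ℂ} {K : ℕ}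
    {D : ℝ} (hG : IsWindow K G) (hD : ∀ x, ‖G x‖ ≤ D) (x : ℤ → Fin m) (J : ℕ) :
    ‖∑ j ∈ Finset.range J, phase ξ (prefixWord x j) * (G fun i => x (i + j)) -
      wordSum ξ G (prefixWord x J)‖ ≤ 4 * K * D := by
  have hD0 : 0 ≤ D := (norm_nonneg _).trans (hD fun _ => 0)
  rw [wordSum, length_prefixWord, ← Finset.sum_sub_distrib]
  refine (norm_sum_le _ _).trans ?_
  have h : ∀ j ∈ Finset.range J, ‖phase ξ (prefixWord x j) * (G fun i => x (i + j)) -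
      phase ξ ((prefixWord x J).take j) * (G fun i => extendWord (prefixWord x J) (i + j))‖
      ≤ (if j + K < J then 0 else 2 * D) + (if K ≤ j then 0 else 2 * D) := by
    intro j hj
    rw [Finset.mem_range] at hj
    rw [take_prefixWord x hj.le, ← mul_sub, norm_mul, norm_phase, one_mul]
    by_cases h1 : j + K < J ∧ K ≤ j
    · rw [if_pos h1.1, if_pos h1.2, hG _ (fun i => extendWord (prefixWord x J) (i + j))]
      · simp
      · intro i hi
        rw [abs_le] at hi
        exact (extendWord_prefixWord x (by omega) (by omega)).symm
    · refine (norm_sub_le_of_bound hD _ _).trans ?_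
      split_ifs <;> first | (exfalso; omega) | linarith
  refine (Finset.sum_le_sum h).trans ?_
  rw [Finset.sum_add_distrib]
  have h1 := sum_ite_le J K (D := 2 * D) (by positivity)
  have h2 := sum_ite_le' J K (D := 2 * D) (by positivity)
  linarith

/-- Every word of a point of `X_ζ` lies in some `ζⁿ(v)`, for each prescribed level `n`. -/
lemma exists_prefixWord_infix (ζ : Substitution m) {x : ℤ → Fin m} (hx : x ∈ ζ.space) (J n : ℕ) :
    ∃ v, prefixWord x J <:+: ζ.iter n v := by
  -- a word longer than all `ζᵏ(b)`, `k < n`, can only occur in some `ζᵏ(b)` with `k ≥ n`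
  set S := ∑ k ∈ Finset.range n, ∑ b, (ζ.iterWord k b).length with hS
  obtain ⟨b, k, -, hk⟩ := hx 0 (J + S + 1)
  have e : ((List.range (J + S + 1)).map fun j : ℕ => x (0 + j)) = prefixWord x (J + S + 1) := by
    simp [prefixWord]
  rw [e] at hk
  have hkn : n ≤ k := by
    by_contra hlt
    push Not at hlt
    have h1 := hk.length_le
    rw [length_prefixWord] at h1
    have h2 : (ζ.iterWord k b).length ≤ S :=
      (Finset.single_le_sum (f := fun b => (ζ.iterWord k b).length) (fun _ _ => Nat.zero_le _)
        (Finset.mem_univ b)).trans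
      (Finset.single_le_sum (f := fun k => ∑ b, (ζ.iterWord k b).length) (fun _ _ => Nat.zero_le _)
        (Finset.mem_range.2 hlt))
    omega
  obtain ⟨d, rfl⟩ := Nat.exists_eq_add_of_le hkn
  refine ⟨ζ.iterWord d b, ?_⟩
  rw [← ζ.iterWord_add]
  have : prefixWord x J <+: prefixWord x (J + S + 1) := by
    rw [← take_prefixWord x (by omega : J ≤ J + S + 1)]
    exact List.take_prefix _ _
  exact this.isInfix.trans hk

/-- Twisted sums along orbits of the shift on `X_ζ`, at a point `ξ` where the spectral cocycle grows
at rate `β`: the sum of length `J` is bounded by `exp (β n)` times the number `k` of blocks of level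
`n`, up to a polynomial factor. -/
theorem exists_norm_sum_le [NeZero m] (ζ : Substitution m) {ξ : Fin m → UnitAddCircle}
    {G : (ℤ → Fin m) → ℂ} {K : ℕ} {D B β : ℝ} (hG : IsWindow K G) (hD : ∀ x, ‖G x‖ ≤ D)
    (hβ : 0 ≤ β) (hB0 : 0 ≤ B)
    (hB : open scoped Matrix.Norms.Operator in
      ∀ j k : ℕ, ‖ζ.cocycle (ζ.toralEndo^[j] ξ) k‖ ≤ B * Real.exp (β * (j + k))) :
    ∃ K' : ℝ, 0 ≤ K' ∧ ∀ n N : ℕ, (∀ a, N ≤ (ζ.iterWord n a).length) →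
      ∀ x ∈ ζ.space, ∀ J : ℕ, ∃ k : ℕ, k * N ≤ J ∧
        ‖∑ j ∈ Finset.range J, phase ξ (prefixWord x j) * (G fun i => x (i + j))‖
          ≤ K' * (n + 1) ^ 2 * Real.exp (β * n) * (k + 1) := by
  have hD0 : 0 ≤ D := (norm_nonneg _).trans (hD fun _ => 0)
  obtain ⟨K', hK', h⟩ := exists_norm_infix_le ζ (ξ := ξ) (V := wordSum ξ G) (C := 4 * K * D) (D := D)
    (by positivity) hD0 (by simp [wordSum]) (wordSum_append ξ hG hD)
    (fun a => by simpa [wordSum] using hD _) hβ hB0 hB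
  refine ⟨K' + 4 * K * D, by positivity, fun n N hN x hx J => ?_⟩
  obtain ⟨v, hv⟩ := exists_prefixWord_infix ζ hx J n
  obtain ⟨k, hk, h1⟩ := h n N hN v _ hv
  rw [length_prefixWord] at hk
  refine ⟨k, hk, ?_⟩
  have h2 := norm_sum_sub_wordSum_le ξ hG hD x J
  have h3 := norm_le_norm_add_norm_sub' (∑ j ∈ Finset.range J, phase ξ (prefixWord x j) *
    (G fun i => x (i + j))) (wordSum ξ G (prefixWord x J))
  have h4 : 4 * K * D ≤ 4 * K * D * ((n + 1) ^ 2 * Real.exp (β * n) * (k + 1)) := by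
    refine le_mul_of_one_le_right (by positivity) ?_
    have a1 : (1 : ℝ) ≤ (n + 1) ^ 2 := one_le_pow₀ (by linarith [Nat.cast_nonneg (α := ℝ) n])
    have a2 : (1 : ℝ) ≤ Real.exp (β * n) := Real.one_le_exp (by positivity)
    have a3 : (1 : ℝ) ≤ (k + 1) := by linarith [Nat.cast_nonneg (α := ℝ) k]
    exact one_le_mul_of_one_le_of_one_le (one_le_mul_of_one_le_of_one_le a1 a2) a3
  linarith

end WindowSums

end SpectralCocycle

/-! ### The suspension flow -/

namespace SpectralCocycle

variable {m : ℕ}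

section Flow

/-- The `n`-th power of the shift, for `n : ℤ`. -/
def shiftPow (n : ℤ) (x : ℤ → Fin m) : ℤ → Fin m := fun i => x (i + n)

@[simp] lemma shiftPow_zero (x : ℤ → Fin m) : shiftPow 0 x = x := by
  ext i; simp [shiftPow]

lemma shiftPow_shiftPow (n k : ℤ) (x : ℤ → Fin m) :
    shiftPow k (shiftPow n x) = shiftPow (n + k) x := by
  ext i; simp only [shiftPow]; congr 2; ring

lemma measurable_shiftPow (n : ℤ) : Measurable (shiftPow n : (ℤ → Fin m) → ℤ → Fin m) :=
  measurable_pi_lambda _ fun i => measurable_pi_apply (i + n)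

/-- The shift as a measurable equivalence. -/
def shiftEquiv (m : ℕ) : (ℤ → Fin m) ≃ᵐ (ℤ → Fin m) where
  toFun := shiftPow 1
  invFun := shiftPow (-1)
  left_inv x := by rw [shiftPow_shiftPow]; simp
  right_inv x := by rw [shiftPow_shiftPow]; simp
  measurable_toFun := measurable_shiftPow 1
  measurable_invFun := measurable_shiftPow (-1)

lemma measurePreserving_shiftPow {μ : Measure (ℤ → Fin m)} (h : MeasurePreserving shift μ μ)
    (n : ℤ) : MeasurePreserving (shiftPow n) μ μ := by
  have h1 : MeasurePreserving (shiftEquiv m) μ μ := h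
  have h2 : MeasurePreserving (shiftPow (-1)) μ μ := h1.symm
  induction n using Int.induction_on with
  | zero =>
    have : (shiftPow 0 : (ℤ → Fin m) → ℤ → Fin m) = id := by ext1 x; simp
    rw [this]; exact MeasurePreserving.id μ
  | succ n ih =>
    have : (shiftPow (n + 1) : (ℤ → Fin m) → ℤ → Fin m) = shift ∘ shiftPow n := by
      ext1 x; exact (shiftPow_shiftPow n 1 x).symm
    rw [this]; exact h.comp ih
  | pred n ih =>
    have : (shiftPow (-(n : ℤ) - 1) : (ℤ → Fin m) → ℤ → Fin m) = shiftPow (-1) ∘ shiftPow (-n) := by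
      ext1 x; exact (shiftPow_shiftPow (-n) (-1) x).symm
    rw [this]; exact h2.comp ih

variable (s : Fin m → ℝ)

@[simp] lemma hittingTime_zero (x : ℤ → Fin m) : hittingTime s x 0 = 0 := by simp [hittingTime]

lemma hittingTime_succ (x : ℤ → Fin m) (n : ℤ) :
    hittingTime s x (n + 1) = hittingTime s x n + s (x n) := by
  unfold hittingTime
  rcases le_or_gt 0 n with h | h
  · have e : Finset.Ico 0 (n + 1) = insert n (Finset.Ico 0 n) := by
      ext i; simp only [Finset.mem_Ico, Finset.mem_insert]; omega
    rw [e, Finset.sum_insert (by simp), Finset.Ico_eq_empty_of_le h,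
      Finset.Ico_eq_empty_of_le (by omega : (0 : ℤ) ≤ n + 1)]
    simp; ring
  · have e : Finset.Ico n 0 = insert n (Finset.Ico (n + 1) 0) := by
      ext i; simp only [Finset.mem_Ico, Finset.mem_insert]; omega
    rw [e, Finset.sum_insert (by simp), Finset.Ico_eq_empty_of_le h.le,
      Finset.Ico_eq_empty_of_le (by omega : n + 1 ≤ 0)]
    simp

lemma hittingTime_add (x : ℤ → Fin m) (n k : ℤ) :
    hittingTime s x (n + k) = hittingTime s x n + hittingTime s (shiftPow n x) k := by
  induction k using Int.induction_on with
  | zero => simp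
  | succ k ih =>
    rw [← add_assoc, hittingTime_succ, ih, hittingTime_succ, shiftPow, add_assoc, add_comm n]
  | pred k ih =>
    have h1 := hittingTime_succ s x (n + (-(k : ℤ) - 1))
    have h2 := hittingTime_succ s (shiftPow n x) (-(k : ℤ) - 1)
    rw [show n + (-(k : ℤ) - 1) + 1 = n + -k by ring, ih] at h1
    rw [sub_add_cancel] at h2
    have h3 : shiftPow n x (-(k : ℤ) - 1) = x (n + (-(k : ℤ) - 1)) := by
      rw [shiftPow, add_comm]
    rw [h3] at h2
    linarith

variable {s}

lemma strictMono_hittingTime (hs : ∀ a, 0 < s a) (x : ℤ → Fin m) :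
    StrictMono (hittingTime s x) :=
  strictMono_int_of_lt_succ fun n => by rw [hittingTime_succ]; linarith [hs (x n)]

lemma mul_le_hittingTime {c : ℝ} (hc : ∀ a, c ≤ s a) (x : ℤ → Fin m) (n : ℕ) :
    n * c ≤ hittingTime s x n := by
  induction n with
  | zero => simp
  | succ n ih => push_cast; rw [hittingTime_succ]; linarith [hc (x n)]

lemma hittingTime_neg_le {c : ℝ} (hc : ∀ a, c ≤ s a) (x : ℤ → Fin m) (n : ℕ) :
    hittingTime s x (-n) ≤ -(n * c) := by
  have h1 := mul_le_hittingTime hc (shiftPow (-n) x) n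
  have h2 := hittingTime_add s x (-n) n
  rw [neg_add_cancel, hittingTime_zero] at h2
  linarith

lemma exists_pos_le (hs : ∀ a, 0 < s a) : ∃ c, 0 < c ∧ ∀ a, c ≤ s a := by
  rcases isEmpty_or_nonempty (Fin m) with h | h
  · exact ⟨1, one_pos, fun a => h.elim a⟩
  · obtain ⟨a, ha⟩ := Finite.exists_min s
    exact ⟨s a, hs a, ha⟩

variable (s) in
/-- The index `n` with `hittingTime s x n ≤ u < hittingTime s x (n + 1)`. -/
noncomputable def hitIndex (z : (ℤ → Fin m) × ℝ) : ℤ := sSup {n : ℤ | hittingTime s z.1 n ≤ z.2}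

lemma hitIndex_eq_iff (hs : ∀ a, 0 < s a) (z : (ℤ → Fin m) × ℝ) (n : ℤ) :
    hitIndex s z = n ↔ hittingTime s z.1 n ≤ z.2 ∧ z.2 < hittingTime s z.1 (n + 1) := by
  have hmono := strictMono_hittingTime hs z.1
  obtain ⟨c, hc0, hc⟩ := exists_pos_le hs
  obtain ⟨N, hN⟩ := exists_nat_gt (|z.2| / c)
  rw [div_lt_iff₀ hc0] at hN
  have hN1 := mul_le_hittingTime hc z.1 N
  have hN2 := hittingTime_neg_le hc z.1 N
  have hne : {n : ℤ | hittingTime s z.1 n ≤ z.2}.Nonempty :=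
    ⟨-N, by rw [Set.mem_ofPred_eq]; linarith [neg_abs_le z.2]⟩
  have hb : BddAbove {n : ℤ | hittingTime s z.1 n ≤ z.2} := by
    refine ⟨N, fun k hk => ?_⟩
    rw [Set.mem_ofPred_eq] at hk
    refine hmono.le_iff_le.1 (hk.trans ?_)
    linarith [le_abs_self z.2]
  constructor
  · rintro rfl
    refine ⟨Int.csSup_mem hne hb, ?_⟩
    by_contra hcon
    push Not at hcon
    have : hitIndex s z + 1 ≤ hitIndex s z := le_csSup hb hcon
    omega
  · rintro ⟨h1, h2⟩
    refine le_antisymm (csSup_le hne fun k hk => ?_) (le_csSup hb h1)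
    rw [Set.mem_ofPred_eq] at hk
    have := hmono.lt_iff_lt.1 (hk.trans_lt h2)
    omega

variable (s) in
/-- The action of `n : ℤ` on `(ℤ → Fin m) × ℝ` for which `underRoof s` is a fundamental domain and
which commutes with the vertical translations. -/
noncomputable def deck (n : ℤ) (z : (ℤ → Fin m) × ℝ) : (ℤ → Fin m) × ℝ :=
  (shiftPow n z.1, z.2 - hittingTime s z.1 n)

/-- The vertical translation. -/
def lift (t : ℝ) (z : (ℤ → Fin m) × ℝ) : (ℤ → Fin m) × ℝ := (z.1, z.2 + t)

@[simp] lemma deck_zero (z : (ℤ → Fin m) × ℝ) : deck s 0 z = z := by simp [deck]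

lemma deck_deck (n k : ℤ) (z : (ℤ → Fin m) × ℝ) : deck s k (deck s n z) = deck s (n + k) z := by
  simp only [deck, shiftPow_shiftPow, hittingTime_add]
  congr 1; ring

lemma lift_deck (t : ℝ) (n : ℤ) (z : (ℤ → Fin m) × ℝ) :
    lift t (deck s n z) = deck s n (lift t z) := by
  simp only [deck, lift]; congr 1; ring

lemma lift_lift (t t' : ℝ) (z : (ℤ → Fin m) × ℝ) : lift t (lift t' z) = lift (t + t') z := by
  simp only [lift]; congr 1; ring

@[simp] lemma lift_zero (z : (ℤ → Fin m) × ℝ) : lift 0 z = z := by simp [lift]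

variable (s) in
/-- The representative in `underRoof s`. -/
noncomputable def toRoof (z : (ℤ → Fin m) × ℝ) : (ℤ → Fin m) × ℝ := deck s (hitIndex s z) z

lemma suspensionFlow_eq (t : ℝ) (y : (ℤ → Fin m) × ℝ) :
    suspensionFlow s t y = toRoof s (lift t y) := rfl

lemma deck_mem_underRoof_iff (hs : ∀ a, 0 < s a) (n : ℤ) (z : (ℤ → Fin m) × ℝ) :
    deck s n z ∈ underRoof s ↔ hitIndex s z = n := by
  rw [hitIndex_eq_iff hs]
  simp only [underRoof, deck, Set.mem_ofPred_eq, shiftPow, zero_add, hittingTime_succ]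
  constructor <;> rintro ⟨h1, h2⟩ <;> constructor <;> linarith

lemma toRoof_deck (hs : ∀ a, 0 < s a) (n : ℤ) (z : (ℤ → Fin m) × ℝ) :
    toRoof s (deck s n z) = toRoof s z := by
  have h : hitIndex s (deck s n z) = hitIndex s z - n := by
    rw [← deck_mem_underRoof_iff hs, deck_deck, add_sub_cancel, deck_mem_underRoof_iff hs]
  rw [toRoof, h, deck_deck, add_sub_cancel, toRoof]

lemma toRoof_of_mem (hs : ∀ a, 0 < s a) {z : (ℤ → Fin m) × ℝ} (hz : z ∈ underRoof s) :
    toRoof s z = z := by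
  have : hitIndex s z = 0 := by rw [← deck_mem_underRoof_iff hs, deck_zero]; exact hz
  rw [toRoof, this, deck_zero]

lemma suspensionFlow_suspensionFlow (hs : ∀ a, 0 < s a) (t t' : ℝ) (y : (ℤ → Fin m) × ℝ) :
    suspensionFlow s t (suspensionFlow s t' y) = suspensionFlow s (t + t') y := by
  have h : lift t (toRoof s (lift t' y)) = deck s (hitIndex s (lift t' y)) (lift (t + t') y) := by
    rw [toRoof, lift_deck, lift_lift]
  rw [suspensionFlow_eq, suspensionFlow_eq, suspensionFlow_eq, h, toRoof_deck hs]

lemma measurable_hittingTime (n : ℤ) : Measurable fun x : ℤ → Fin m => hittingTime s x n := by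
  have h : ∀ k : ℤ, Measurable fun x : ℤ → Fin m => s (x k) := fun k =>
    (measurable_of_finite s).comp (measurable_pi_apply k)
  exact (Finset.measurable_sum _ fun k _ => h k).sub (Finset.measurable_sum _ fun k _ => h k)

lemma measurable_deck (n : ℤ) : Measurable (deck s n) :=
  ((measurable_shiftPow n).comp measurable_fst).prodMk
    (measurable_snd.sub ((measurable_hittingTime n).comp measurable_fst))

lemma measurable_lift (t : ℝ) : Measurable (lift t : (ℤ → Fin m) × ℝ → (ℤ → Fin m) × ℝ) :=
  measurable_fst.prodMk (measurable_snd.add_const t)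

lemma measurableSet_underRoof : MeasurableSet (underRoof s) := by
  have h : Measurable fun z : (ℤ → Fin m) × ℝ => s (z.1 0) :=
    (measurable_of_finite s).comp ((measurable_pi_apply 0).comp measurable_fst)
  exact (measurableSet_le measurable_const measurable_snd).inter (measurableSet_lt measurable_snd h)

lemma measurable_toRoof (hs : ∀ a, 0 < s a) : Measurable (toRoof s) := by
  have hidx : Measurable (hitIndex s) := by
    refine measurable_to_countable' fun n => ?_
    have : hitIndex s ⁻¹' {n} = {z | hittingTime s z.1 n ≤ z.2} ∩
        {z | z.2 < hittingTime s z.1 (n + 1)} := by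
      ext z; exact hitIndex_eq_iff hs z n
    rw [this]
    exact (measurableSet_le ((measurable_hittingTime n).comp measurable_fst) measurable_snd).inter
      (measurableSet_lt measurable_snd ((measurable_hittingTime (n + 1)).comp measurable_fst))
  have h2 : Measurable fun p : ℤ × ((ℤ → Fin m) × ℝ) => deck s p.1 p.2 :=
    measurable_from_prod_countable_right fun n => measurable_deck n
  exact h2.comp (hidx.prodMk measurable_id)

lemma measurable_suspensionFlow (hs : ∀ a, 0 < s a) :
    Measurable fun p : ((ℤ → Fin m) × ℝ) × ℝ => suspensionFlow s p.2 p.1 := by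
  refine (measurable_toRoof hs).comp
    (g := toRoof s) (f := fun p : ((ℤ → Fin m) × ℝ) × ℝ => lift p.2 p.1) ?_
  exact (measurable_fst.comp measurable_fst).prodMk
    ((measurable_snd.comp measurable_fst).add measurable_snd)

lemma measurePreserving_deck {μ : Measure (ℤ → Fin m)} [IsProbabilityMeasure μ]
    (h : MeasurePreserving shift μ μ) (n : ℤ) :
    MeasurePreserving (deck s n) (μ.prod volume) (μ.prod volume) := by
  refine (measurePreserving_shiftPow h n).skew_product
    (g := fun x u => u - hittingTime s x n) ?_ (ae_of_all _ fun x => ?_)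
  · exact measurable_snd.sub ((measurable_hittingTime n).comp measurable_fst)
  · exact (measurePreserving_sub_right volume _).map_eq

lemma measurePreserving_lift {μ : Measure (ℤ → Fin m)} [IsProbabilityMeasure μ] (t : ℝ) :
    MeasurePreserving (lift t) (μ.prod volume) (μ.prod volume) :=
  (MeasurePreserving.id μ).prod (measurePreserving_add_right volume t)

/-- The suspension flow preserves `μ̃`: unfold the integral over the fundamental domain
`underRoof s` of the action `deck` and use that `deck` and `lift` preserve `μ × Lebesgue`. -/
theorem measurePreserving_suspensionFlow (hs : ∀ a, 0 < s a) {μ : Measure (ℤ → Fin m)}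
    [IsProbabilityMeasure μ] (h : MeasurePreserving shift μ μ) (t : ℝ) :
    MeasurePreserving (suspensionFlow s t) (suspensionMeasure μ s) (suspensionMeasure μ s) := by
  set lam := μ.prod (volume : Measure ℝ) with hlam
  have hmf : Measurable (suspensionFlow s t) :=
    (measurable_toRoof hs).comp (measurable_lift t)
  refine ⟨hmf, ?_⟩
  ext A hA
  rw [Measure.map_apply hmf hA, suspensionMeasure, Measure.restrict_apply (hmf hA),
    Measure.restrict_apply hA]
  -- `1_D` is the indicator function of the fundamental domain, and `F` that of `A ∩ D`.
  let D : (ℤ → Fin m) × ℝ → ENNReal := (underRoof s).indicator 1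
  let F : (ℤ → Fin m) × ℝ → ENNReal := (A ∩ underRoof s).indicator 1
  have hDm : Measurable D := measurable_one.indicator measurableSet_underRoof
  have hFm : Measurable F := measurable_one.indicator (hA.inter measurableSet_underRoof)
  have hsum : ∀ z, ∑' n : ℤ, D (deck s n z) = 1 := by
    intro z
    rw [tsum_eq_single (hitIndex s z)]
    · simp [D, deck_mem_underRoof_iff hs]
    · intro n hn
      simp [D, deck_mem_underRoof_iff hs, hn.symm]
  have h1 : ∀ z, (suspensionFlow s t ⁻¹' A ∩ underRoof s).indicator (1 : (ℤ → Fin m) × ℝ → ENNReal) z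
      = ∑' n : ℤ, D z * F (deck s n (lift t z)) := by
    intro z
    rw [tsum_eq_single (hitIndex s (lift t z))]
    · have h2 : deck s (hitIndex s (lift t z)) (lift t z) ∈ underRoof s :=
        (deck_mem_underRoof_iff hs _ _).2 rfl
      by_cases hz : z ∈ underRoof s
      · have h3 : z ∈ suspensionFlow s t ⁻¹' A ∩ underRoof s ↔
            deck s (hitIndex s (lift t z)) (lift t z) ∈ A ∩ underRoof s :=
          ⟨fun h4 => ⟨h4.1, h2⟩, fun h4 => ⟨h4.1, hz⟩⟩
        simp only [D, F]
        by_cases h4 : deck s (hitIndex s (lift t z)) (lift t z) ∈ A ∩ underRoof s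
        · rw [Set.indicator_of_mem (h3.2 h4), Set.indicator_of_mem hz, Set.indicator_of_mem h4]
          simp
        · rw [Set.indicator_of_notMem (mt h3.1 h4), Set.indicator_of_notMem h4, mul_zero]
      · simp [D, F, Set.indicator, hz]
    · intro n hn
      have : deck s n (lift t z) ∉ underRoof s := fun h3 =>
        hn ((deck_mem_underRoof_iff hs _ _).1 h3).symm
      simp [F, this]
  calc lam (suspensionFlow s t ⁻¹' A ∩ underRoof s)
      = ∫⁻ z, ∑' n : ℤ, D z * F (deck s n (lift t z)) ∂lam := by
        rw [← lintegral_indicator_one ((hmf hA).inter measurableSet_underRoof)]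
        exact lintegral_congr h1
    _ = ∑' n : ℤ, ∫⁻ z, D z * F (deck s n (lift t z)) ∂lam := by
        refine lintegral_tsum fun n => Measurable.aemeasurable ?_
        exact hDm.mul (hFm.comp ((measurable_deck n).comp (measurable_lift t)))
    _ = ∑' n : ℤ, ∫⁻ z, D (deck s (-n) (lift (-t) z)) * F z ∂lam := by
        congr 1; ext n
        have hmp := (measurePreserving_deck (s := s) h n).comp (measurePreserving_lift (μ := μ) t)
        rw [← hmp.lintegral_comp
          (f := fun z => D (deck s (-n) (lift (-t) z)) * F z)
          ((hDm.comp ((measurable_deck _).comp (measurable_lift _))).mul hFm)]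
        refine lintegral_congr fun z => ?_
        simp only [Function.comp_apply]
        rw [lift_deck, lift_lift, deck_deck]
        simp
    _ = ∫⁻ z, ∑' n : ℤ, D (deck s (-n) (lift (-t) z)) * F z ∂lam := by
        refine (lintegral_tsum fun n => Measurable.aemeasurable ?_).symm
        exact (hDm.comp ((measurable_deck _).comp (measurable_lift _))).mul hFm
    _ = ∫⁻ z, F z ∂lam := by
        refine lintegral_congr fun z => ?_
        have h3 := (Equiv.neg ℤ).tsum_eq fun n => D (deck s n (lift (-t) z))
        simp only [Equiv.neg_apply] at h3
        rw [ENNReal.tsum_mul_right, h3, hsum, one_mul]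
    _ = lam (A ∩ underRoof s) := lintegral_indicator_one (hA.inter measurableSet_underRoof)

instance isFiniteMeasure_suspensionMeasure (μ : Measure (ℤ → Fin m)) [IsProbabilityMeasure μ]
    (s : Fin m → ℝ) : IsFiniteMeasure (suspensionMeasure μ s) := by
  refine ⟨?_⟩
  rw [suspensionMeasure, Measure.restrict_apply_univ]
  have hsub : underRoof s ⊆ Set.univ ×ˢ Set.Icc (0 : ℝ) (∑ a, |s a|) := by
    rintro ⟨x, u⟩ ⟨h1, h2⟩
    refine ⟨trivial, h1, h2.le.trans ((le_abs_self _).trans ?_)⟩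
    exact Finset.single_le_sum (f := fun a => |s a|) (fun _ _ => abs_nonneg _) (Finset.mem_univ _)
  refine (measure_mono hsub).trans_lt ?_
  rw [Measure.prod_prod]
  simp

end Flow

/-! ### Twisted integrals along the flow -/

section TwistedIntegral

/-- `exp (-2πia)`. -/
noncomputable def expNeg (a : ℝ) : ℂ := Complex.exp (-(2 * Real.pi * a) * Complex.I)

lemma expNeg_add (a b : ℝ) : expNeg (a + b) = expNeg a * expNeg b := by
  rw [expNeg, expNeg, expNeg, ← Complex.exp_add]; congr 1; push_cast; ring

@[simp] lemma norm_expNeg (a : ℝ) : ‖expNeg a‖ = 1 := by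
  have := Complex.norm_exp_ofReal_mul_I (-(2 * Real.pi * a))
  rw [expNeg]; push_cast at this; exact this

@[simp] lemma expNeg_zero : expNeg 0 = 1 := by simp [expNeg]

lemma continuous_expNeg : Continuous expNeg := by unfold expNeg; fun_prop

lemma phase_eq_expNeg (s : Fin m → ℝ) (ω : ℝ) (w : List (Fin m)) :
    phase (fun a => ((ω * s a : ℝ) : UnitAddCircle)) w = expNeg (ω * (w.map s).sum) := by
  induction w with
  | nil => simp
  | cons a w ih =>
    rw [← List.singleton_append, phase_append, ih, List.map_append, List.sum_append, mul_add,
      expNeg_add]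
    congr 1
    rw [phase, List.map_singleton, List.sum_singleton, List.map_singleton, List.sum_singleton,
      fourier_coe_apply, expNeg]
    congr 1; push_cast; ring

lemma sum_map_prefixWord (s : Fin m → ℝ) (x : ℤ → Fin m) (j : ℕ) :
    ((prefixWord x j).map s).sum = hittingTime s x j := by
  induction j with
  | zero => simp [prefixWord]
  | succ j ih =>
    push_cast
    rw [hittingTime_succ, ← ih]
    simp [prefixWord, List.range_succ]

/-- The twisted integral of `g` over the part of a flow orbit above one point of the base. -/
noncomputable def floorIntegral (s : Fin m → ℝ) (g : (ℤ → Fin m) × ℝ → ℂ) (ω : ℝ)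
    (x : ℤ → Fin m) : ℂ :=
  ∫ t in (0 : ℝ)..s (x 0), expNeg (ω * t) * g (x, t)

lemma norm_floorIntegral_le {s : Fin m → ℝ} (hs : ∀ a, 0 < s a) {g : (ℤ → Fin m) × ℝ → ℂ} {D S : ℝ}
    (hD : ∀ z, ‖g z‖ ≤ D) (hS : ∀ a, s a ≤ S) (ω : ℝ) (x : ℤ → Fin m) :
    ‖floorIntegral s g ω x‖ ≤ D * S := by
  have hD0 : 0 ≤ D := (norm_nonneg _).trans (hD (x, 0))
  refine (intervalIntegral.norm_integral_le_of_norm_le_const (C := D) fun t _ => ?_).trans ?_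
  · rw [norm_mul, norm_expNeg, one_mul]; exact hD _
  · rw [sub_zero, abs_of_pos (hs _)]
    exact mul_le_mul_of_nonneg_left (hS _) hD0

/-- The twisted integral along a flow orbit is, up to a bounded error, a twisted sum along an orbit
of the shift. -/
lemma norm_integral_flow_le {s : Fin m → ℝ} (hs : ∀ a, 0 < s a) {g : (ℤ → Fin m) × ℝ → ℂ}
    (hg : Measurable g) {D S c : ℝ} (hD : ∀ z, ‖g z‖ ≤ D) (hS : ∀ a, s a ≤ S)
    (hc : ∀ a, c ≤ s a) (ω : ℝ) {y : (ℤ → Fin m) × ℝ} (hy : y ∈ underRoof s) {R : ℝ} (hR : 0 ≤ R) :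
    ∃ J : ℕ, J * c ≤ S + R ∧
      ‖∫ t in (0 : ℝ)..R, expNeg (ω * t) * g (suspensionFlow s t y)‖ ≤
        ‖∑ j ∈ Finset.range J, phase (fun a => ((ω * s a : ℝ) : UnitAddCircle))
          (prefixWord y.1 j) * (floorIntegral s g ω fun i => y.1 (i + j))‖ + 2 * D * S := by
  obtain ⟨x, u⟩ := y
  obtain ⟨hu0, hu1⟩ := hy
  dsimp only at hu0 hu1 ⊢
  have hD0 : 0 ≤ D := (norm_nonneg _).trans (hD (x, 0))
  let φ : ℝ → ℂ := fun t => expNeg (ω * t) * g (toRoof s (x, t))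
  have hφb : ∀ t, ‖φ t‖ ≤ D := fun t => by
    rw [norm_mul, norm_expNeg, one_mul]; exact hD _
  have hφm : Measurable φ :=
    (continuous_expNeg.comp (continuous_const.mul continuous_id)).measurable.mul
      (hg.comp ((measurable_toRoof hs).comp measurable_prodMk_left))
  have hφi : ∀ a b : ℝ, IntervalIntegrable φ volume a b := fun a b =>
    (intervalIntegrable_const (c := D)).mono_fun hφm.aestronglyMeasurable
      (ae_of_all _ fun t => (hφb t).trans (le_abs_self D))
  -- the index of the last return before time `R`
  set N := hitIndex s (x, u + R) with hN
  obtain ⟨hN1, hN2⟩ := (hitIndex_eq_iff hs (x, u + R) N).1 rfl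
  dsimp only at hN1 hN2
  have hN0 : 0 ≤ N := by
    by_contra hcon
    push Not at hcon
    have := (strictMono_hittingTime hs x).monotone (by omega : N + 1 ≤ 0)
    rw [hittingTime_zero] at this
    linarith
  obtain ⟨J, hJ⟩ := Int.eq_ofNat_of_zero_le hN0
  rw [hJ] at hN1 hN2
  refine ⟨J, ?_, ?_⟩
  · have := mul_le_hittingTime hc x J
    linarith [hS (x 0)]
  have hshift : ∫ t in (0 : ℝ)..R, expNeg (ω * t) * g (suspensionFlow s t (x, u))
      = expNeg (-(ω * u)) * ∫ t in u..(u + R), φ t := by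
    have h1 := intervalIntegral.integral_comp_add_left (a := 0) (b := R) φ u
    rw [add_zero] at h1
    rw [← h1, ← intervalIntegral.integral_const_mul]
    congr 1; ext t
    simp only [φ, suspensionFlow_eq, lift]
    rw [← mul_assoc, ← expNeg_add]
    congr 2; ring
  -- cut the integral at the return times to the base; the two incomplete floors are bounded
  have hsplit : ∫ t in u..(u + R), φ t = (∫ t in (0 : ℝ)..hittingTime s x J, φ t) -
      (∫ t in (0 : ℝ)..u, φ t) + ∫ t in (hittingTime s x J)..(u + R), φ t := by
    rw [← intervalIntegral.integral_add_adjacent_intervals (hφi u (hittingTime s x J)) (hφi _ _),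
      ← intervalIntegral.integral_add_adjacent_intervals (hφi 0 u) (hφi u (hittingTime s x J))]
    ring
  have hfloor : ∀ j : ℕ, ∫ t in (hittingTime s x j)..(hittingTime s x (j + 1 : ℕ)), φ t =
      phase (fun a => ((ω * s a : ℝ) : UnitAddCircle)) (prefixWord x j) *
        floorIntegral s g ω fun i => x (i + j) := by
    intro j
    have h1 := intervalIntegral.integral_comp_add_left (a := 0) (b := s (x j)) φ (hittingTime s x j)
    rw [add_zero] at h1
    rw [Nat.cast_succ, hittingTime_succ, ← h1, floorIntegral, phase_eq_expNeg, sum_map_prefixWord,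
      ← intervalIntegral.integral_const_mul, zero_add]
    refine intervalIntegral.integral_congr_Ioo_of_le (hs _).le fun t ht => ?_
    have h2 : toRoof s (x, hittingTime s x j + t) = (fun i => x (i + j), t) := by
      have h3 : deck s j (x, hittingTime s x j + t) = (fun i => x (i + j), t) := by
        simp only [deck, add_sub_cancel_left]; rfl
      rw [← toRoof_deck hs j, h3]
      refine toRoof_of_mem hs ⟨ht.1.le, ?_⟩
      simpa using ht.2
    simp only [φ, h2]
    rw [← mul_assoc, ← expNeg_add, mul_add]
  have hsum := intervalIntegral.sum_integral_adjacent_intervals (f := φ) (μ := volume)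
    (a := fun j : ℕ => hittingTime s x j) (n := J) fun k _ => hφi _ _
  simp only [hfloor, Nat.cast_zero, hittingTime_zero] at hsum
  rw [hshift, norm_mul, norm_expNeg, one_mul, hsplit, ← hsum]
  have h1 : ‖∫ t in (0 : ℝ)..u, φ t‖ ≤ D * S := by
    refine (intervalIntegral.norm_integral_le_of_norm_le_const fun t _ => hφb t).trans ?_
    rw [sub_zero, abs_of_nonneg hu0]
    exact mul_le_mul_of_nonneg_left (hu1.le.trans (hS _)) hD0
  have h2 : ‖∫ t in (hittingTime s x J)..(u + R), φ t‖ ≤ D * S := by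
    refine (intervalIntegral.norm_integral_le_of_norm_le_const fun t _ => hφb t).trans ?_
    rw [abs_of_nonneg (by linarith)]
    refine mul_le_mul_of_nonneg_left ?_ hD0
    rw [hittingTime_succ] at hN2
    linarith [hS (x J)]
  refine (norm_add_le _ _).trans ?_
  have h3 := norm_sub_le (∑ j ∈ Finset.range J, phase (fun a => ((ω * s a : ℝ) : UnitAddCircle))
    (prefixWord x j) * floorIntegral s g ω fun i => x (i + j)) (∫ t in (0 : ℝ)..u, φ t)
  linarith

end TwistedIntegral

end SpectralCocycle

/-! ### Plancherel-type estimates -/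

namespace SpectralCocycle

open scoped ENNReal ComplexConjugate

section SquareExpansion

lemma norm_sq_integral_eq {τ : Measure ℝ} [IsFiniteMeasure τ] (φ : ℝ → ℂ) :
    ((‖∫ t, φ t ∂τ‖ ^ 2 : ℝ) : ℂ) = ∫ q : ℝ × ℝ, φ q.1 * conj (φ q.2) ∂(τ.prod τ) := by
  rw [integral_prod_mul φ (fun t => conj (φ t)), integral_conj,
    Complex.mul_conj, Complex.normSq_eq_norm_sq]

variable {Z : Type*} [MeasurableSpace Z] {κ : Measure Z} {τ : Measure ℝ}
  [IsFiniteMeasure τ] {Φ : Z × ℝ → ℂ}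

lemma integrable_mul_conj (hΦ : Measurable Φ)
    (hL : ∫⁻ z, ∫⁻ t, ‖Φ (z, t)‖ₑ ^ 2 ∂τ ∂κ < ∞) :
    Integrable (fun p : Z × (ℝ × ℝ) => Φ (p.1, p.2.1) * conj (Φ (p.1, p.2.2)))
      (κ.prod (τ.prod τ)) := by
  have hm1 : Measurable fun p : Z × (ℝ × ℝ) => Φ (p.1, p.2.1) := hΦ.comp (by fun_prop)
  have hm2 : Measurable fun p : Z × (ℝ × ℝ) => Φ (p.1, p.2.2) := hΦ.comp (by fun_prop)
  have hsq : Measurable fun p : Z × ℝ => ‖Φ p‖ₑ ^ 2 := hΦ.enorm.pow_const 2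
  have hI : Measurable fun z => ∫⁻ t, ‖Φ (z, t)‖ₑ ^ 2 ∂τ := hsq.lintegral_prod_right'
  have h1 : ∫⁻ p : Z × (ℝ × ℝ), ‖Φ (p.1, p.2.1)‖ₑ ^ 2 ∂(κ.prod (τ.prod τ)) < ∞ := by
    rw [lintegral_prod _ (hm1.enorm.pow_const 2).aemeasurable]
    have e : ∀ z, ∫⁻ q : ℝ × ℝ, ‖Φ (z, q.1)‖ₑ ^ 2 ∂(τ.prod τ)
        = (∫⁻ t, ‖Φ (z, t)‖ₑ ^ 2 ∂τ) * τ Set.univ := by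
      intro z
      have hz : Measurable fun t => ‖Φ (z, t)‖ₑ ^ 2 := hsq.comp measurable_prodMk_left
      rw [lintegral_prod (fun q : ℝ × ℝ => ‖Φ (z, q.1)‖ₑ ^ 2) (hz.comp measurable_fst).aemeasurable]
      simp only [lintegral_const]
      rw [lintegral_mul_const _ hz]
    simp only [e]
    rw [lintegral_mul_const _ hI]
    exact ENNReal.mul_lt_top hL (measure_lt_top _ _)
  have h2 : ∫⁻ p : Z × (ℝ × ℝ), ‖Φ (p.1, p.2.2)‖ₑ ^ 2 ∂(κ.prod (τ.prod τ)) < ∞ := by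
    rw [lintegral_prod _ (hm2.enorm.pow_const 2).aemeasurable]
    have e : ∀ z, ∫⁻ q : ℝ × ℝ, ‖Φ (z, q.2)‖ₑ ^ 2 ∂(τ.prod τ)
        = (∫⁻ t, ‖Φ (z, t)‖ₑ ^ 2 ∂τ) * τ Set.univ := by
      intro z
      have hz : Measurable fun t => ‖Φ (z, t)‖ₑ ^ 2 := hsq.comp measurable_prodMk_left
      rw [lintegral_prod (fun q : ℝ × ℝ => ‖Φ (z, q.2)‖ₑ ^ 2) (hz.comp measurable_snd).aemeasurable]
      simp only [lintegral_const]
    simp only [e]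
    rw [lintegral_mul_const _ hI]
    exact ENNReal.mul_lt_top hL (measure_lt_top _ _)
  refine ⟨(hm1.mul (Complex.continuous_conj.measurable.comp hm2)).aestronglyMeasurable, ?_⟩
  rw [HasFiniteIntegral]
  refine lt_of_le_of_lt (lintegral_mono fun p => ?_) (lintegral_add_left
    (hm1.enorm.pow_const 2) (fun p => ‖Φ (p.1, p.2.2)‖ₑ ^ 2) ▸ ENNReal.add_lt_top.2 ⟨h1, h2⟩)
  rw [enorm_mul, RCLike.enorm_conj]
  rcases le_total ‖Φ (p.1, p.2.1)‖ₑ ‖Φ (p.1, p.2.2)‖ₑ with h | h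
  · refine le_trans ?_ le_add_self
    rw [sq]; gcongr
  · refine le_trans ?_ le_self_add
    rw [sq]; gcongr

lemma integrable_norm_sq_integral (hΦ : Measurable Φ)
    (hL : ∫⁻ z, ∫⁻ t, ‖Φ (z, t)‖ₑ ^ 2 ∂τ ∂κ < ∞) :
    Integrable (fun z => ‖∫ t, Φ (z, t) ∂τ‖ ^ 2) κ := by
  have h := (integrable_mul_conj hΦ hL).integral_prod_left.norm
  refine h.congr (ae_of_all _ fun z => ?_)
  dsimp only
  rw [← norm_sq_integral_eq fun t => Φ (z, t), Complex.norm_real, Real.norm_of_nonneg (by positivity)]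

/-- Expanding the square of an integral and exchanging the order of integration. -/
lemma integral_norm_sq_integral [SFinite κ] (hΦ : Measurable Φ)
    (hL : ∫⁻ z, ∫⁻ t, ‖Φ (z, t)‖ₑ ^ 2 ∂τ ∂κ < ∞) :
    ((∫ z, ‖∫ t, Φ (z, t) ∂τ‖ ^ 2 ∂κ : ℝ) : ℂ) =
      ∫ q : ℝ × ℝ, ∫ z, Φ (z, q.1) * conj (Φ (z, q.2)) ∂κ ∂(τ.prod τ) := by
  rw [← integral_complex_ofReal]
  have e : ∀ z, ((‖∫ t, Φ (z, t) ∂τ‖ ^ 2 : ℝ) : ℂ) =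
      ∫ q : ℝ × ℝ, Φ (z, q.1) * conj (Φ (z, q.2)) ∂(τ.prod τ) := fun z =>
    norm_sq_integral_eq fun t => Φ (z, t)
  simp only [e]
  exact integral_integral_swap (f := fun z (q : ℝ × ℝ) => Φ (z, q.1) * conj (Φ (z, q.2)))
    (integrable_mul_conj hΦ hL)

lemma lintegral_enorm_sq_integral (hΦ : Measurable Φ)
    (hL : ∫⁻ z, ∫⁻ t, ‖Φ (z, t)‖ₑ ^ 2 ∂τ ∂κ < ∞) :
    ∫⁻ z, ‖∫ t, Φ (z, t) ∂τ‖ₑ ^ 2 ∂κ = ENNReal.ofReal (∫ z, ‖∫ t, Φ (z, t) ∂τ‖ ^ 2 ∂κ) := by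
  rw [ofReal_integral_eq_lintegral_ofReal (integrable_norm_sq_integral hΦ hL)
    (ae_of_all _ fun z => by positivity)]
  refine lintegral_congr fun z => ?_
  rw [ENNReal.ofReal_pow (norm_nonneg _), ofReal_norm]

end SquareExpansion

section Plancherel

lemma conj_expNeg (a : ℝ) : conj (expNeg a) = expNeg (-a) := by
  rw [expNeg, expNeg, ← Complex.exp_conj]
  congr 1
  rw [map_mul, Complex.conj_I, ← Complex.ofReal_ofNat, ← Complex.ofReal_mul, ← Complex.ofReal_mul,
    ← Complex.ofReal_neg, Complex.conj_ofReal]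
  push_cast; ring

/-- The Fourier transform of a Gaussian, normalized to have total mass `1`. -/
noncomputable def gaussKernel (b u : ℝ) : ℝ :=
  √(Real.pi / b) * Real.exp (-(Real.pi ^ 2 / b) * u ^ 2)

lemma integral_gauss_expNeg {b : ℝ} (hb : 0 < b) (u : ℝ) :
    ∫ ω : ℝ, (Real.exp (-b * ω ^ 2) : ℂ) * expNeg (ω * u) = gaussKernel b u := by
  have h := fourierIntegral_gaussian (b := (b : ℂ)) (by simpa using hb) (-(2 * Real.pi * u) : ℂ)
  have e : ∀ ω : ℝ, (Real.exp (-b * ω ^ 2) : ℂ) * expNeg (ω * u) =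
      Complex.exp (Complex.I * (-(2 * Real.pi * u)) * ω) * Complex.exp (-b * ω ^ 2) := by
    intro ω
    rw [expNeg, mul_comm]; push_cast; congr 2; ring
  simp only [e, h]
  rw [gaussKernel, Real.sqrt_eq_rpow]
  push_cast
  rw [Complex.ofReal_cpow (by positivity)]
  push_cast
  congr 2
  have : (b : ℂ) ≠ 0 := by exact_mod_cast hb.ne'
  field_simp
  ring

lemma lintegral_gaussKernel {b : ℝ} (hb : 0 < b) (t : ℝ) :
    ∫⁻ t', ENNReal.ofReal (gaussKernel b (t - t')) = 1 := by
  have h0 : ∀ u, 0 ≤ gaussKernel b u := fun u => by unfold gaussKernel; positivity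
  have hb2 : 0 < Real.pi ^ 2 / b := by positivity
  have hint : Integrable (gaussKernel b) := (integrable_exp_neg_mul_sq hb2).const_mul _
  rw [lintegral_sub_left_eq_self (fun u => ENNReal.ofReal (gaussKernel b u)) t,
    ← ofReal_integral_eq_lintegral_ofReal hint (ae_of_all _ h0)]
  unfold gaussKernel
  rw [integral_const_mul, integral_gaussian, ← Real.sqrt_mul (by positivity)]
  have : Real.pi / b * (Real.pi / (Real.pi ^ 2 / b)) = 1 := by
    have := Real.pi_pos.ne'
    field_simp
  rw [this]; simp

/-- Bessel's inequality for the Fourier transform of a square integrable function on a bounded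
interval. It follows by inserting the weight `exp (-bω²)`, whose Fourier transform is a positive
kernel of mass `1`, and letting `b → 0`. -/
theorem lintegral_fourier_sq_le {τ : Measure ℝ} [IsFiniteMeasure τ] (hτ : τ ≤ volume) {φ : ℝ → ℂ}
    (hφ : Measurable φ) :
    ∫⁻ ω : ℝ, ‖∫ t, expNeg (ω * t) * φ t ∂τ‖ₑ ^ 2 ≤ ∫⁻ t, ‖φ t‖ₑ ^ 2 ∂τ := by
  rcases eq_top_or_lt_top (∫⁻ t, ‖φ t‖ₑ ^ 2 ∂τ) with htop | hfin
  · rw [htop]; exact le_top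
  have hφ2 : Measurable fun t => ‖φ t‖ₑ ^ 2 := hφ.enorm.pow_const 2
  have key : ∀ b : ℝ, 0 < b → ∫⁻ ω : ℝ, ENNReal.ofReal (Real.exp (-b * ω ^ 2)) *
      ‖∫ t, expNeg (ω * t) * φ t ∂τ‖ₑ ^ 2 ≤ ∫⁻ t, ‖φ t‖ₑ ^ 2 ∂τ := by
    intro b hb
    let w : ℝ → ℝ := fun ω => Real.exp (-(b / 2) * ω ^ 2)
    have hw2 : ∀ ω, w ω ^ 2 = Real.exp (-b * ω ^ 2) := fun ω => by
      rw [← Real.exp_nat_mul]; congr 1; push_cast; ring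
    let Φ : ℝ × ℝ → ℂ := fun p => (w p.1 : ℂ) * (expNeg (p.1 * p.2) * φ p.2)
    have hΦ : Measurable Φ := by
      refine Measurable.mul (by fun_prop) (Measurable.mul ?_ (hφ.comp measurable_snd))
      exact (continuous_expNeg.comp (continuous_fst.mul continuous_snd)).measurable
    have hΦn : ∀ ω t, ‖Φ (ω, t)‖ₑ ^ 2 = ENNReal.ofReal (Real.exp (-b * ω ^ 2)) * ‖φ t‖ₑ ^ 2 := by
      intro ω t
      have h1 : ‖expNeg (ω * t)‖ₑ = 1 := by rw [← ofReal_norm, norm_expNeg]; simp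
      simp only [Φ]
      rw [enorm_mul, enorm_mul, h1, one_mul, mul_pow, ← ofReal_norm, Complex.norm_real,
        Real.norm_of_nonneg (Real.exp_pos _).le, ← ENNReal.ofReal_pow (Real.exp_pos _).le, hw2]
    have hgauss : ∫⁻ ω : ℝ, ENNReal.ofReal (Real.exp (-b * ω ^ 2)) < ∞ := by
      rw [← ofReal_integral_eq_lintegral_ofReal (integrable_exp_neg_mul_sq hb)
        (ae_of_all _ fun _ => (Real.exp_pos _).le)]
      exact ENNReal.ofReal_lt_top
    have hL : ∫⁻ ω, ∫⁻ t, ‖Φ (ω, t)‖ₑ ^ 2 ∂τ < ∞ := by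
      simp only [hΦn]
      have : ∀ ω : ℝ, ∫⁻ t, ENNReal.ofReal (Real.exp (-b * ω ^ 2)) * ‖φ t‖ₑ ^ 2 ∂τ
          = ENNReal.ofReal (Real.exp (-b * ω ^ 2)) * ∫⁻ t, ‖φ t‖ₑ ^ 2 ∂τ := fun ω =>
        lintegral_const_mul _ hφ2
      simp only [this]
      rw [lintegral_mul_const _ (by fun_prop)]
      exact ENNReal.mul_lt_top hgauss hfin
    have e1 : ∀ ω, ENNReal.ofReal (Real.exp (-b * ω ^ 2)) * ‖∫ t, expNeg (ω * t) * φ t ∂τ‖ₑ ^ 2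
        = ‖∫ t, Φ (ω, t) ∂τ‖ₑ ^ 2 := by
      intro ω
      simp only [Φ]
      rw [integral_const_mul, enorm_mul, mul_pow, ← ofReal_norm (w ω : ℂ),
        Complex.norm_real, Real.norm_of_nonneg (Real.exp_pos _).le,
        ← ENNReal.ofReal_pow (Real.exp_pos _).le, hw2]
    simp only [e1]
    rw [lintegral_enorm_sq_integral hΦ hL]
    have e2 := integral_norm_sq_integral hΦ hL
    have e3 : ∀ q : ℝ × ℝ, ∫ ω, Φ (ω, q.1) * conj (Φ (ω, q.2))
        = φ q.1 * conj (φ q.2) * gaussKernel b (q.1 - q.2) := by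
      intro q
      rw [← integral_gauss_expNeg hb, ← integral_const_mul]
      congr 1; ext ω
      simp only [Φ, map_mul, conj_expNeg, Complex.conj_ofReal]
      rw [← hw2, mul_sub, sub_eq_add_neg, expNeg_add]
      push_cast; ring
    simp only [e3] at e2
    have h0 : ∀ u, 0 ≤ gaussKernel b u := fun u => by unfold gaussKernel; positivity
    have hGm : Measurable (gaussKernel b) := by unfold gaussKernel; fun_prop
    have e4 : ENNReal.ofReal (∫ z, ‖∫ t, Φ (z, t) ∂τ‖ ^ 2) =
        ‖∫ q : ℝ × ℝ, φ q.1 * conj (φ q.2) * gaussKernel b (q.1 - q.2) ∂(τ.prod τ)‖ₑ := by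
      rw [← e2, ← ofReal_norm, Complex.norm_real, Real.norm_of_nonneg]
      exact integral_nonneg fun z => by positivity
    rw [e4]
    refine (enorm_integral_le_lintegral_enorm _).trans ?_
    have hbound : ∀ q : ℝ × ℝ, ‖φ q.1 * conj (φ q.2) * gaussKernel b (q.1 - q.2)‖ₑ ≤
        (1 / 2) * (‖φ q.1‖ₑ ^ 2 * ENNReal.ofReal (gaussKernel b (q.1 - q.2))) +
        (1 / 2) * (‖φ q.2‖ₑ ^ 2 * ENNReal.ofReal (gaussKernel b (q.2 - q.1))) := by
      intro q
      have hsymm : gaussKernel b (q.2 - q.1) = gaussKernel b (q.1 - q.2) := by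
        unfold gaussKernel; congr 3; ring
      rw [hsymm, ← mul_add, ← add_mul, ← mul_assoc, enorm_mul, enorm_mul, RCLike.enorm_conj]
      have hg : ‖(gaussKernel b (q.1 - q.2) : ℂ)‖ₑ
          = ENNReal.ofReal (gaussKernel b (q.1 - q.2)) := by
        rw [← ofReal_norm, Complex.norm_real, Real.norm_of_nonneg (h0 _)]
      rw [hg]
      refine mul_le_mul' ?_ le_rfl
      rw [← ofReal_norm, ← ofReal_norm, ← ENNReal.ofReal_pow (norm_nonneg _),
        ← ENNReal.ofReal_pow (norm_nonneg _), ← ENNReal.ofReal_add (by positivity) (by positivity),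
        ← ENNReal.ofReal_mul (norm_nonneg _)]
      have : (1 / 2 : ℝ≥0∞) = ENNReal.ofReal (1 / 2) := by
        rw [ENNReal.ofReal_div_of_pos two_pos]; simp
      rw [this, ← ENNReal.ofReal_mul (by norm_num)]
      refine ENNReal.ofReal_le_ofReal ?_
      nlinarith [sq_nonneg (‖φ q.1‖ - ‖φ q.2‖)]
    refine (lintegral_mono hbound).trans ?_
    have hA : ∫⁻ q : ℝ × ℝ, ‖φ q.1‖ₑ ^ 2 * ENNReal.ofReal (gaussKernel b (q.1 - q.2)) ∂(τ.prod τ)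
        ≤ ∫⁻ t, ‖φ t‖ₑ ^ 2 ∂τ := by
      rw [lintegral_prod _ (by fun_prop)]
      refine lintegral_mono fun t => ?_
      dsimp only
      rw [lintegral_const_mul _ (by fun_prop)]
      have : ∫⁻ t', ENNReal.ofReal (gaussKernel b (t - t')) ∂τ ≤ 1 :=
        (lintegral_mono' hτ le_rfl).trans (lintegral_gaussKernel hb t).le
      calc _ ≤ ‖φ t‖ₑ ^ 2 * 1 := by gcongr
        _ = _ := mul_one _
    have hB : ∫⁻ q : ℝ × ℝ, ‖φ q.2‖ₑ ^ 2 * ENNReal.ofReal (gaussKernel b (q.2 - q.1)) ∂(τ.prod τ)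
        ≤ ∫⁻ t, ‖φ t‖ₑ ^ 2 ∂τ := by
      refine le_trans (le_of_eq ?_) hA
      rw [← lintegral_prod_swap]
      rfl
    rw [lintegral_add_left (by fun_prop), lintegral_const_mul _ (by fun_prop),
      lintegral_const_mul _ (by fun_prop)]
    calc _ ≤ (1 / 2) * (∫⁻ t, ‖φ t‖ₑ ^ 2 ∂τ) + (1 / 2) * ∫⁻ t, ‖φ t‖ₑ ^ 2 ∂τ := by gcongr
      _ = _ := by rw [← add_mul, one_div, ENNReal.inv_two_add_inv_two, one_mul]
  -- Fatou's lemma along `b = 1 / (n + 1)`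
  have hmeas : Measurable fun ω : ℝ => ‖∫ t, expNeg (ω * t) * φ t ∂τ‖ₑ ^ 2 := by
    have h1 : Measurable fun p : ℝ × ℝ => expNeg (p.1 * p.2) * φ p.2 :=
      (continuous_expNeg.comp (continuous_fst.mul continuous_snd)).measurable.mul
        (hφ.comp measurable_snd)
    exact (h1.stronglyMeasurable.integral_prod_right').measurable.enorm.pow_const 2
  have hlim : ∀ ω : ℝ, Tendsto (fun n : ℕ => ENNReal.ofReal (Real.exp (-(1 / ((n : ℝ) + 1)) * ω ^ 2)) *
      ‖∫ t, expNeg (ω * t) * φ t ∂τ‖ₑ ^ 2) atTop (𝓝 (‖∫ t, expNeg (ω * t) * φ t ∂τ‖ₑ ^ 2)) := by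
    intro ω
    have h1 : Tendsto (fun n : ℕ => Real.exp (-(1 / ((n : ℝ) + 1)) * ω ^ 2)) atTop (𝓝 1) := by
      have h2 := ((tendsto_one_div_add_atTop_nhds_zero_nat (𝕜 := ℝ)).neg.mul_const (ω ^ 2)).rexp
      simpa using h2
    have h3 := ENNReal.Tendsto.mul_const (b := ‖∫ t, expNeg (ω * t) * φ t ∂τ‖ₑ ^ 2)
      (ENNReal.tendsto_ofReal h1) (Or.inl (by simp))
    simpa using h3
  calc ∫⁻ ω : ℝ, ‖∫ t, expNeg (ω * t) * φ t ∂τ‖ₑ ^ 2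
      = ∫⁻ ω : ℝ, liminf (fun n : ℕ => ENNReal.ofReal (Real.exp (-(1 / ((n : ℝ) + 1)) * ω ^ 2)) *
          ‖∫ t, expNeg (ω * t) * φ t ∂τ‖ₑ ^ 2) atTop := by
        refine lintegral_congr fun ω => ((hlim ω).liminf_eq).symm
    _ ≤ liminf (fun n : ℕ => ∫⁻ ω : ℝ, ENNReal.ofReal (Real.exp (-(1 / ((n : ℝ) + 1)) * ω ^ 2)) *
          ‖∫ t, expNeg (ω * t) * φ t ∂τ‖ₑ ^ 2) atTop :=
        lintegral_liminf_le fun n => Measurable.mul (by fun_prop) hmeas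
    _ ≤ liminf (fun _ : ℕ => ∫⁻ t, ‖φ t‖ₑ ^ 2 ∂τ) atTop :=
        liminf_le_liminf (Eventually.of_forall fun n => key _ (by positivity))
    _ = _ := liminf_const _

end Plancherel

end SpectralCocycle

/-! ### Spectral measures and twisted integrals -/

namespace SpectralCocycle

open scoped ENNReal ComplexConjugate

section SpectralMeasure

variable {Y : Type*} [MeasurableSpace Y] {ν : Measure Y} {h : ℝ → Y → Y}

/-- The twisted integral `∫₀ᴿ exp (-2πiωt) f (h_t y) dt`. -/
noncomputable def twistedIntegral (h : ℝ → Y → Y) (f : Y → ℂ) (R ω : ℝ) (y : Y) : ℂ :=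
  ∫ t in Set.Ioc 0 R, expNeg (ω * t) * f (h t y)

lemma enorm_expNeg_mul (a : ℝ) (z : ℂ) : ‖expNeg a * z‖ₑ = ‖z‖ₑ := by
  rw [enorm_mul, ← ofReal_norm, norm_expNeg]; simp

lemma isSpectralMeasure_congr (hmp : ∀ t, MeasurePreserving (h t) ν ν) {f f' : Y → ℂ}
    (hff' : f =ᵐ[ν] f') {σ : Measure ℝ} (hσ : IsSpectralMeasure ν h f σ) :
    IsSpectralMeasure ν h f' σ := by
  refine ⟨hσ.1, fun t => (hσ.2 t).trans (integral_congr_ae ?_)⟩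
  filter_upwards [hff', (hmp t).quasiMeasurePreserving.ae_eq_comp hff'] with y h1 h2
  simp only [Function.comp_apply] at h2
  rw [h1, h2]

lemma lintegral_enorm_sq_lt_top {f : Y → ℂ} (hf : MemLp f 2 ν) : ∫⁻ y, ‖f y‖ₑ ^ 2 ∂ν < ∞ := by
  have h1 := lintegral_rpow_enorm_lt_top_of_eLpNorm_lt_top two_ne_zero ENNReal.ofNat_ne_top hf.2
  simpa using h1

variable [IsFiniteMeasure ν]

lemma lintegral_lintegral_flow (hmp : ∀ t, MeasurePreserving (h t) ν ν)
    (hm : Measurable fun p : Y × ℝ => h p.2 p.1) {k : Y → ℝ≥0∞} (hk : Measurable k) {R : ℝ} :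
    ∫⁻ y, (∫⁻ t in Set.Ioc 0 R, k (h t y)) ∂ν = ENNReal.ofReal R * ∫⁻ y, k y ∂ν := by
  rw [lintegral_lintegral_swap (f := fun y t => k (h t y)) (hk.comp hm).aemeasurable]
  have : ∀ t, ∫⁻ y, k (h t y) ∂ν = ∫⁻ y, k y ∂ν := fun t => (hmp t).lintegral_comp hk
  simp only [this, lintegral_const, Measure.restrict_apply_univ, Real.volume_Ioc, sub_zero]
  rw [mul_comm]

lemma enorm_add_sq_le (a b : ℂ) : ‖a + b‖ₑ ^ 2 ≤ 2 * ‖a‖ₑ ^ 2 + 2 * ‖b‖ₑ ^ 2 := by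
  simp only [← ofReal_norm, ← ENNReal.ofReal_pow (norm_nonneg _)]
  have h2 : (2 : ℝ≥0∞) = ENNReal.ofReal 2 := by simp
  rw [h2, ← ENNReal.ofReal_mul two_pos.le, ← ENNReal.ofReal_mul two_pos.le,
    ← ENNReal.ofReal_add (by positivity) (by positivity)]
  refine ENNReal.ofReal_le_ofReal ?_
  have h3 := pow_le_pow_left₀ (norm_nonneg _) (norm_add_le a b) 2
  nlinarith [sq_nonneg (‖a‖ - ‖b‖)]

/-- For `|a| ≤ 1 / (8R)` the exponential `exp (-2πiat)` stays in the half plane `Re ≥ 1/2` on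
`[0, R]`. -/
lemma half_le_norm_integral_expNeg {R a : ℝ} (hR : 0 < R) (ha : |a| ≤ 1 / (8 * R)) :
    R / 2 ≤ ‖∫ t in Set.Ioc 0 R, expNeg (a * t)‖ := by
  have hc : Continuous fun t : ℝ => expNeg (a * t) :=
    continuous_expNeg.comp (continuous_const.mul continuous_id)
  have hint : IntegrableOn (fun t : ℝ => expNeg (a * t)) (Set.Ioc 0 R) :=
    (hc.integrableOn_Icc).mono_set Set.Ioc_subset_Icc_self
  have hre : (∫ t in Set.Ioc 0 R, expNeg (a * t)).re = ∫ t in Set.Ioc 0 R, (expNeg (a * t)).re :=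
    (integral_re hint).symm
  refine le_trans ?_ (Complex.re_le_norm _)
  rw [hre]
  have h1 : ∫ _ in Set.Ioc 0 R, (1 / 2 : ℝ) = R / 2 := by
    simp [hR.le]; ring
  rw [← h1]
  refine setIntegral_mono_on (by simp) hint.re measurableSet_Ioc fun t ht => ?_
  have h2 : (expNeg (a * t)).re = Real.cos (2 * Real.pi * (a * t)) := by
    have e : expNeg (a * t) = Complex.exp ((-(2 * Real.pi * (a * t)) : ℝ) * Complex.I) := by
      rw [expNeg]; push_cast; rfl
    rw [e, Complex.exp_ofReal_mul_I_re, Real.cos_neg]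
  rw [h2]
  have h3 : |a * t| ≤ 1 / 8 := by
    rw [abs_mul, abs_of_pos ht.1]
    calc |a| * t ≤ 1 / (8 * R) * R := mul_le_mul ha ht.2 ht.1.le (by positivity)
      _ = 1 / 8 := by field_simp
  have h4 : |2 * Real.pi * (a * t)| ≤ 1 := by
    rw [abs_mul, abs_of_pos (by positivity)]
    nlinarith [Real.pi_lt_four, Real.pi_pos, abs_nonneg (a * t)]
  have h5 := Real.one_sub_sq_div_two_le_cos (x := 2 * Real.pi * (a * t))
  have h6 : (2 * Real.pi * (a * t)) ^ 2 ≤ 1 := by exact (sq_le_one_iff_abs_le_one _).2 h4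
  linarith

/-- The mass that the spectral measure of `f` gives to a ball of radius `1 / (8R)` is controlled by
the `L²` norm of the twisted integrals of length `R`. -/
theorem spectralMeasure_closedBall_le (hmp : ∀ t, MeasurePreserving (h t) ν ν)
    (hm : Measurable fun p : Y × ℝ => h p.2 p.1)
    (hgrp : ∀ t t' y, h t (h t' y) = h (t + t') y) {f : Y → ℂ} (hf : Measurable f)
    (hf2 : ∫⁻ y, ‖f y‖ₑ ^ 2 ∂ν < ∞) {σ : Measure ℝ} (hσ : IsSpectralMeasure ν h f σ) {R : ℝ}
    (hR : 0 < R) (ω : ℝ) :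
    ENNReal.ofReal ((R / 2) ^ 2) * σ (Metric.closedBall ω (1 / (8 * R))) ≤
      ∫⁻ y, ‖twistedIntegral h f R ω y‖ₑ ^ 2 ∂ν := by
  obtain ⟨hσf, hσ⟩ := hσ
  obtain ⟨τ, hτ⟩ : ∃ τ : Measure ℝ, τ = volume.restrict (Set.Ioc 0 R) := ⟨_, rfl⟩
  have : IsFiniteMeasure τ := by rw [hτ]; infer_instance
  obtain ⟨Φ, hΦd⟩ : ∃ Φ : Y × ℝ → ℂ, Φ = fun p => expNeg (ω * p.2) * f (h p.2 p.1) := ⟨_, rfl⟩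
  obtain ⟨Ψ, hΨd⟩ : ∃ Ψ : ℝ × ℝ → ℂ, Ψ = fun p => expNeg ((ω - p.1) * p.2) := ⟨_, rfl⟩
  have hΦ : Measurable Φ := hΦd ▸
    (continuous_expNeg.measurable.comp (by fun_prop)).mul (hf.comp hm)
  have hΨ : Measurable Ψ := hΨd ▸ continuous_expNeg.measurable.comp (by fun_prop)
  have hΦL : ∫⁻ y, ∫⁻ t, ‖Φ (y, t)‖ₑ ^ 2 ∂τ ∂ν < ∞ := by
    simp only [hΦd, enorm_expNeg_mul]
    have := lintegral_lintegral_flow hmp hm (k := fun y => ‖f y‖ₑ ^ 2) (hf.enorm.pow_const 2)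
      (R := R)
    rw [hτ, this]
    exact ENNReal.mul_lt_top ENNReal.ofReal_lt_top hf2
  have hΨL : ∫⁻ l, ∫⁻ t, ‖Ψ (l, t)‖ₑ ^ 2 ∂τ ∂σ < ∞ := by
    have e : ∀ l t, ‖Ψ (l, t)‖ₑ ^ 2 = 1 := by
      intro l t
      have := enorm_expNeg_mul ((ω - l) * t) 1
      rw [mul_one] at this
      simp only [hΨd]
      rw [this]; simp
    simp only [e, lintegral_const, one_mul]
    exact ENNReal.mul_lt_top (measure_lt_top _ _) (measure_lt_top _ _)
  -- both sides are the double integral over `(t, t')` of the correlation at time `t - t'`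
  have hkey : ∫ y, ‖∫ t, Φ (y, t) ∂τ‖ ^ 2 ∂ν = ∫ l, ‖∫ t, Ψ (l, t) ∂τ‖ ^ 2 ∂σ := by
    have h1 := integral_norm_sq_integral hΦ hΦL
    have h2 := integral_norm_sq_integral hΨ hΨL
    have h3 : ∀ q : ℝ × ℝ, ∫ y, Φ (y, q.1) * conj (Φ (y, q.2)) ∂ν =
        ∫ l, Ψ (l, q.1) * conj (Ψ (l, q.2)) ∂σ := by
      rintro ⟨t, t'⟩
      have h4 : ∫ y, f (h t y) * conj (f (h t' y)) ∂ν
          = ∫ y, f (h (t - t') y) * conj (f y) ∂ν := by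
        have hmk : Measurable fun y => f (h (t - t') y) * conj (f y) :=
          (hf.comp (hmp _).measurable).mul (Complex.continuous_conj.measurable.comp hf)
        conv_rhs => rw [← (hmp t').map_eq]
        rw [integral_map (hmp t').measurable.aemeasurable hmk.aestronglyMeasurable]
        simp only [hgrp, sub_add_cancel]
      have h5 : ∀ y, Φ (y, t) * conj (Φ (y, t')) =
          expNeg (ω * (t - t')) * (f (h t y) * conj (f (h t' y))) := by
        intro y
        simp only [hΦd, map_mul, conj_expNeg]
        rw [mul_sub, sub_eq_add_neg, expNeg_add]; ring
      have h6 : ∀ l, Ψ (l, t) * conj (Ψ (l, t')) = expNeg (ω * (t - t')) *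
          Complex.exp (2 * Real.pi * Complex.I * l * ((t - t' : ℝ) : ℂ)) := by
        intro l
        simp only [hΨd, conj_expNeg]
        rw [← expNeg_add, expNeg, expNeg, ← Complex.exp_add]
        congr 1; push_cast; ring
      simp only [h5, h6]
      rw [integral_const_mul, integral_const_mul, h4, hσ (t - t')]
    simp only [h3] at h1
    exact_mod_cast h1.trans h2.symm
  have hI : ∫⁻ y, ‖twistedIntegral h f R ω y‖ₑ ^ 2 ∂ν
      = ∫⁻ l, ‖∫ t, Ψ (l, t) ∂τ‖ₑ ^ 2 ∂σ := by
    rw [lintegral_enorm_sq_integral hΨ hΨL, ← hkey, ← lintegral_enorm_sq_integral hΦ hΦL]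
    simp only [twistedIntegral, hΦd, hτ]
  -- on the ball the inner integral stays away from `0`
  rw [hI, ← setLIntegral_const]
  refine (setLIntegral_mono' Metric.isClosed_closedBall.measurableSet fun l hl => ?_).trans
    (setLIntegral_le_lintegral _ _)
  rw [← ofReal_norm, ← ENNReal.ofReal_pow (norm_nonneg _)]
  refine ENNReal.ofReal_le_ofReal (pow_le_pow_left₀ (by positivity) ?_ 2)
  simp only [hΨd, hτ]
  refine half_le_norm_integral_expNeg hR ?_
  rwa [Metric.mem_closedBall, Real.dist_eq, abs_sub_comm] at hl

lemma measurable_twistedIntegral (hm : Measurable fun p : Y × ℝ => h p.2 p.1) {f : Y → ℂ}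
    (hf : Measurable f) (R : ℝ) : Measurable fun p : ℝ × Y => twistedIntegral h f R p.1 p.2 := by
  have h1 : Measurable fun p : (ℝ × Y) × ℝ => expNeg (p.1.1 * p.2) * f (h p.2 p.1.2) :=
    (continuous_expNeg.measurable.comp (by fun_prop)).mul
      (hf.comp (hm.comp ((measurable_snd.comp measurable_fst).prodMk measurable_snd)))
  exact (h1.stronglyMeasurable.integral_prod_right').measurable

/-- Bessel's inequality along each orbit, integrated over the phase space. -/
lemma lintegral_twistedIntegral_le (hmp : ∀ t, MeasurePreserving (h t) ν ν)
    (hm : Measurable fun p : Y × ℝ => h p.2 p.1) {f : Y → ℂ} (hf : Measurable f) (R : ℝ) :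
    ∫⁻ ω : ℝ, ∫⁻ y, ‖twistedIntegral h f R ω y‖ₑ ^ 2 ∂ν ≤
      ENNReal.ofReal R * ∫⁻ y, ‖f y‖ₑ ^ 2 ∂ν := by
  rw [lintegral_lintegral_swap ((measurable_twistedIntegral hm hf R).enorm.pow_const 2).aemeasurable,
    ← lintegral_lintegral_flow hmp hm (k := fun y => ‖f y‖ₑ ^ 2) (hf.enorm.pow_const 2)]
  refine lintegral_mono fun y => ?_
  exact lintegral_fourier_sq_le Measure.restrict_le_self
    (hf.comp (hm.comp measurable_prodMk_left))

lemma lintegral_twistedIntegral_add_le (hmp : ∀ t, MeasurePreserving (h t) ν ν)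
    (hm : Measurable fun p : Y × ℝ => h p.2 p.1) {f g : Y → ℂ} (hf : Measurable f)
    (hg : Measurable g) (hf2 : ∫⁻ y, ‖f y‖ₑ ^ 2 ∂ν < ∞) (hg2 : ∫⁻ y, ‖g y‖ₑ ^ 2 ∂ν < ∞) (R ω : ℝ) :
    ∫⁻ y, ‖twistedIntegral h (f + g) R ω y‖ₑ ^ 2 ∂ν ≤
      2 * ∫⁻ y, ‖twistedIntegral h f R ω y‖ₑ ^ 2 ∂ν +
      2 * ∫⁻ y, ‖twistedIntegral h g R ω y‖ₑ ^ 2 ∂ν := by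
  have hint : ∀ k : Y → ℂ, Measurable k → ∫⁻ y, ‖k y‖ₑ ^ 2 ∂ν < ∞ → ∀ᵐ y ∂ν,
      Integrable (fun t => expNeg (ω * t) * k (h t y)) (volume.restrict (Set.Ioc 0 R)) := by
    intro k hk hk2
    have h1 := lintegral_lintegral_flow hmp hm (k := fun y => ‖k y‖ₑ ^ 2) (hk.enorm.pow_const 2)
      (R := R)
    have hmeas : Measurable fun p : Y × ℝ => ‖k (h p.2 p.1)‖ₑ ^ 2 := (hk.comp hm).enorm.pow_const 2
    have h2 := ae_lt_top (hmeas.lintegral_prod_right' (ν := volume.restrict (Set.Ioc 0 R)))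
      (h1.trans_lt (ENNReal.mul_lt_top ENNReal.ofReal_lt_top hk2)).ne
    filter_upwards [h2] with y hy
    have hky : Measurable fun t => expNeg (ω * t) * k (h t y) :=
      (continuous_expNeg.measurable.comp (by fun_prop)).mul
        (hk.comp (hm.comp measurable_prodMk_left))
    refine ⟨hky.aestronglyMeasurable, ?_⟩
    rw [HasFiniteIntegral]
    simp only [enorm_expNeg_mul]
    refine lt_of_le_of_lt (lintegral_mono (g := fun t => ‖k (h t y)‖ₑ ^ 2 + 1) fun t => ?_) ?_
    · dsimp only
      rcases le_total ‖k (h t y)‖ₑ 1 with h3 | h3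
      · exact h3.trans le_add_self
      · exact (le_self_pow₀ h3 two_ne_zero).trans le_self_add
    · rw [lintegral_add_right _ measurable_const]
      refine ENNReal.add_lt_top.2 ⟨hy, ?_⟩
      simp
  have hmf : Measurable fun y => ‖twistedIntegral h f R ω y‖ₑ ^ 2 :=
    ((measurable_twistedIntegral hm hf R).comp measurable_prodMk_left).enorm.pow_const 2
  have hmg : Measurable fun y => ‖twistedIntegral h g R ω y‖ₑ ^ 2 :=
    ((measurable_twistedIntegral hm hg R).comp measurable_prodMk_left).enorm.pow_const 2
  rw [← lintegral_const_mul _ hmf, ← lintegral_const_mul _ hmg,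
    ← lintegral_add_left (hmf.const_mul 2)]
  refine lintegral_mono_ae ?_
  filter_upwards [hint f hf hf2, hint g hg hg2] with y h1 h2
  have e : twistedIntegral h (f + g) R ω y =
      twistedIntegral h f R ω y + twistedIntegral h g R ω y := by
    simp only [twistedIntegral, Pi.add_apply, mul_add]
    exact integral_add h1 h2
  rw [e]
  exact enorm_add_sq_le _ _

/-- If `f` is an `L²` limit of functions whose twisted integrals of length `R` are `o(√R)` for almost
every frequency, then its spectral measure is singular: the density of `σ_f` at almost every
frequency is bounded by that of the error term, and the latter has integral at most a constant times
the squared norm of the error. -/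
theorem mutuallySingular_of_approx (hmp : ∀ t, MeasurePreserving (h t) ν ν)
    (hm : Measurable fun p : Y × ℝ => h p.2 p.1)
    (hgrp : ∀ t t' y, h t (h t' y) = h (t + t') y) {f : Y → ℂ} (hf : Measurable f)
    (hf2 : ∫⁻ y, ‖f y‖ₑ ^ 2 ∂ν < ∞) {σ : Measure ℝ} (hσ : IsSpectralMeasure ν h f σ)
    {R : ℕ → ℝ} (hR0 : ∀ n, 0 < R n) (hR : Tendsto R atTop atTop)
    (happrox : ∀ ε : ℝ≥0∞, 0 < ε → ∃ g : Y → ℂ, Measurable g ∧ ∫⁻ y, ‖g y‖ₑ ^ 2 ∂ν < ∞ ∧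
      ∫⁻ y, ‖f y - g y‖ₑ ^ 2 ∂ν ≤ ε ∧ ∀ᵐ ω : ℝ, Tendsto (fun n =>
        ENNReal.ofReal (1 / R n) * ∫⁻ y, ‖twistedIntegral h g (R n) ω y‖ₑ ^ 2 ∂ν) atTop (𝓝 0)) :
    σ ⟂ₘ volume := by
  have hσf : IsFiniteMeasure σ := hσ.1
  rw [← Measure.rnDeriv_eq_zero, ← lintegral_eq_zero_iff (Measure.measurable_rnDeriv _ _)]
  -- the density is computed along the balls of radius `1 / (8 R n)`
  have hden : ∀ᵐ ω : ℝ, Tendsto (fun n => σ (Metric.closedBall ω (1 / (8 * R n))) /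
      volume (Metric.closedBall ω (1 / (8 * R n)))) atTop (𝓝 (σ.rnDeriv volume ω)) := by
    filter_upwards [Besicovitch.ae_tendsto_rnDeriv σ volume] with ω hω
    refine hω.comp (tendsto_nhdsWithin_iff.2 ⟨?_, Eventually.of_forall fun n => ?_⟩)
    · have := (hR.const_mul_atTop (show (0 : ℝ) < 8 by norm_num)).inv_tendsto_atTop
      refine this.congr fun n => ?_
      rw [Pi.inv_apply, one_div]
    · have := hR0 n
      rw [Set.mem_Ioi]; positivity
  have hratio : ∀ n ω, σ (Metric.closedBall ω (1 / (8 * R n))) /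
      volume (Metric.closedBall ω (1 / (8 * R n))) ≤
      ENNReal.ofReal (16 / R n) * ∫⁻ y, ‖twistedIntegral h f (R n) ω y‖ₑ ^ 2 ∂ν := by
    intro n ω
    have hn := hR0 n
    refine le_trans ?_ (mul_le_mul_right
      (spectralMeasure_closedBall_le hmp hm hgrp hf hf2 hσ hn ω) _)
    rw [Real.volume_closedBall, ← mul_assoc, ← ENNReal.ofReal_mul (by positivity), div_eq_mul_inv,
      ← ENNReal.ofReal_inv_of_pos (by positivity), mul_comm]
    refine le_of_eq ?_
    congr 2
    field_simp
    norm_num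
  have hle : ∀ ε : ℝ≥0∞, 0 < ε → ∫⁻ ω, σ.rnDeriv volume ω ≤ 32 * ε := by
    intro ε hε
    obtain ⟨g, hg, hg2, hfg, hlim⟩ := happrox ε hε
    -- for `ε = ∞` there is nothing to prove, and otherwise `f - g` is in `L²`
    rcases eq_top_or_lt_top ε with htop | hεtop
    · rw [htop]; simp
    let F : Y → ℂ := fun y => f y - g y
    have hF : Measurable F := hf.sub hg
    have hF2 : ∫⁻ y, ‖F y‖ₑ ^ 2 ∂ν < ∞ := hfg.trans_lt hεtop
    let A : ℕ → ℝ → ℝ≥0∞ := fun n ω =>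
      ENNReal.ofReal (32 / R n) * ∫⁻ y, ‖twistedIntegral h F (R n) ω y‖ₑ ^ 2 ∂ν
    let B : ℕ → ℝ → ℝ≥0∞ := fun n ω =>
      32 * (ENNReal.ofReal (1 / R n) * ∫⁻ y, ‖twistedIntegral h g (R n) ω y‖ₑ ^ 2 ∂ν)
    have hAm : ∀ n, Measurable (A n) := fun n =>
      (((measurable_twistedIntegral hm hF (R n)).enorm.pow_const 2).lintegral_prod_right').const_mul _
    have hAI : ∀ n, ∫⁻ ω, A n ω ≤ 32 * ε := by
      intro n
      have hn := hR0 n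
      rw [lintegral_const_mul' _ _ ENNReal.ofReal_ne_top]
      refine (mul_le_mul_right (lintegral_twistedIntegral_le hmp hm hF (R n)) _).trans ?_
      rw [← mul_assoc, ← ENNReal.ofReal_mul (by positivity), div_mul_cancel₀ _ hn.ne']
      have : ENNReal.ofReal 32 = 32 := by simp
      rw [this]
      exact mul_le_mul_right hfg _
    have hpt : ∀ᵐ ω : ℝ, σ.rnDeriv volume ω ≤ liminf (fun n => A n ω) atTop := by
      filter_upwards [hden, hlim] with ω h1 h2
      have h3 : Tendsto (fun n => B n ω) atTop (𝓝 0) := by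
        have := ENNReal.Tendsto.const_mul h2 (Or.inr (show (32 : ℝ≥0∞) ≠ ∞ by simp))
        rwa [mul_zero] at this
      rw [← ENNReal.liminf_add_of_right_tendsto_zero h3, ← h1.liminf_eq]
      refine liminf_le_liminf (Eventually.of_forall fun n => (hratio n ω).trans ?_)
      have hn := hR0 n
      have e : f = F + g := by ext y; simp [F]
      have h4 := lintegral_twistedIntegral_add_le hmp hm hF hg hF2 hg2 (R n) ω
      rw [← e] at h4
      refine (mul_le_mul_right h4 _).trans (le_of_eq ?_)
      have h5 : ENNReal.ofReal (16 / R n) = 16 * ENNReal.ofReal (1 / R n) := by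
        rw [show 16 / R n = 16 * (1 / R n) by ring, ENNReal.ofReal_mul (by norm_num)]; simp
      have h6 : ENNReal.ofReal (32 / R n) = 32 * ENNReal.ofReal (1 / R n) := by
        rw [show 32 / R n = 32 * (1 / R n) by ring, ENNReal.ofReal_mul (by norm_num)]; simp
      simp only [A, B, Pi.add_apply]
      rw [h5, h6]
      ring
    calc ∫⁻ ω, σ.rnDeriv volume ω ≤ ∫⁻ ω, liminf (fun n => A n ω) atTop := lintegral_mono_ae hpt
      _ ≤ liminf (fun n => ∫⁻ ω, A n ω) atTop := lintegral_liminf_le hAm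
      _ ≤ liminf (fun _ : ℕ => 32 * ε) atTop :=
        liminf_le_liminf (Eventually.of_forall hAI)
      _ = 32 * ε := liminf_const _
  by_contra hne
  have hpos : 0 < ∫⁻ ω, σ.rnDeriv volume ω := pos_iff_ne_zero.2 hne
  have hfin : ∫⁻ ω, σ.rnDeriv volume ω ≠ ∞ :=
    ((Measure.lintegral_rnDeriv_le (μ := σ) (ν := volume)).trans_lt (measure_lt_top _ _)).ne
  have h1 := hle ((∫⁻ ω, σ.rnDeriv volume ω) / 64) (ENNReal.div_pos hpos.ne' (by simp))
  have h2 : 32 * ((∫⁻ ω, σ.rnDeriv volume ω) / 64) = (∫⁻ ω, σ.rnDeriv volume ω) / 2 := by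
    rw [show (64 : ℝ≥0∞) = 32 * 2 by norm_num, ← mul_div_assoc,
      ENNReal.mul_div_mul_left _ _ (by simp) (by simp)]
  rw [h2] at h1
  exact absurd h1 (not_le.2 (ENNReal.half_lt_self hpos.ne' hfin))

end SpectralMeasure

end SpectralCocycle

/-! ### Generic directions in the torus -/

namespace SpectralCocycle

open scoped ENNReal ComplexConjugate

section Torus

/-- The projection `ℝ^ι → 𝕋^ι` pulls back null sets to null sets. -/
lemma ae_coe_torus {ι : Type*} [Fintype ι] {p : (ι → UnitAddCircle) → Prop}
    (h : ∀ᵐ ξ, p ξ) : ∀ᵐ v : ι → ℝ, p fun a => (v a : UnitAddCircle) := by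
  have hbox : ∀ k : ι → ℤ, ∀ᵐ v ∂(volume : Measure (ι → ℝ)).restrict
      (Set.univ.pi fun a => Set.Ioc (k a : ℝ) (k a + 1)), p fun a => (v a : UnitAddCircle) := by
    intro k
    have h1 := measurePreserving_pi (fun a => (volume : Measure ℝ).restrict (Set.Ioc (k a : ℝ) (k a + 1)))
      (fun _ : ι => (volume : Measure UnitAddCircle)) (f := fun _ v => (v : UnitAddCircle))
      fun a => UnitAddCircle.measurePreserving_mk (k a : ℝ)
    rw [← Measure.restrict_pi_pi] at h1
    exact h1.quasiMeasurePreserving.ae h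
  have hcov : (⋃ k : ι → ℤ, Set.univ.pi fun a => Set.Ioc (k a : ℝ) (k a + 1)) = Set.univ := by
    refine Set.eq_univ_of_forall fun v => Set.mem_iUnion.2 ⟨fun a => ⌈v a⌉ - 1, fun a _ => ?_⟩
    have h1 := Int.ceil_lt_add_one (v a)
    have h2 := Int.le_ceil (v a)
    constructor <;> push_cast <;> linarith
  have h2 := (ae_restrict_iUnion_iff (μ := (volume : Measure (ι → ℝ)))
    (fun k : ι → ℤ => Set.univ.pi fun a => Set.Ioc (k a : ℝ) (k a + 1))
    (fun v => p fun a => (v a : UnitAddCircle))).2 hbox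
  rwa [hcov, Measure.restrict_univ] at h2

/-- Almost every line through the origin meets the preimage of a null set of the torus in a null
set. -/
lemma ae_ae_smul_torus {ι : Type*} [Fintype ι] {p : (ι → UnitAddCircle) → Prop}
    (h : ∀ᵐ ξ, p ξ) :
    ∀ᵐ s : ι → ℝ, ∀ᵐ ω : ℝ, p fun a => ((ω * s a : ℝ) : UnitAddCircle) := by
  obtain ⟨A, hAp, hAm, hA0⟩ := exists_measurable_superset_of_null (ae_iff.1 h)
  have hA : ∀ᵐ ξ : ι → UnitAddCircle, ξ ∉ A := measure_eq_zero_iff_ae_notMem.1 hA0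
  let π : (ι → ℝ) → ι → UnitAddCircle := fun v a => (v a : UnitAddCircle)
  have hπ : Measurable π := measurable_pi_lambda _ fun a =>
    (AddCircle.continuous_mk' 1).measurable.comp (measurable_pi_apply a)
  have hmeas : MeasurableSet {q : (ι → ℝ) × ℝ | π (q.2 • q.1) ∉ A} :=
    ((hπ.comp (measurable_snd.smul measurable_fst)) hAm).compl
  have h1 : ∀ᵐ ω : ℝ, ∀ᵐ s : ι → ℝ, π (ω • s) ∉ A := by
    filter_upwards [Measure.ae_ne volume (0 : ℝ)] with ω hω
    have h2 : volume (π ⁻¹' A) = 0 := measure_eq_zero_iff_ae_notMem.2 (ae_coe_torus hA)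
    have h3 := Measure.addHaar_preimage_smul (volume : Measure (ι → ℝ)) hω (π ⁻¹' A)
    rw [h2, mul_zero] at h3
    exact measure_eq_zero_iff_ae_notMem.1 h3
  have h4 := (Measure.ae_ae_comm (p := fun s ω => π (ω • s) ∉ A) hmeas).2 h1
  filter_upwards [h4] with s hs
  filter_upwards [hs] with ω hω
  by_contra hcon
  exact hω (hAp hcon)

end Torus

variable {m : ℕ}

/-! ### Approximation by functions of finitely many coordinates -/

section Density

/-- The sequence which agrees with `x` on `[-K, K]` and is constant elsewhere. -/
def truncate [NeZero m] (K : ℕ) (x : ℤ → Fin m) : ℤ → Fin m := fun i => if |i| ≤ K then x i else 0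

lemma measurable_truncate [NeZero m] (K : ℕ) :
    Measurable (truncate K : (ℤ → Fin m) → ℤ → Fin m) := by
  refine measurable_pi_lambda _ fun i => ?_
  unfold truncate
  split_ifs
  · exact measurable_pi_apply i
  · exact measurable_const

lemma tendsto_truncate [NeZero m] (x : ℤ → Fin m) :
    Tendsto (fun K : ℕ => truncate K x) atTop (𝓝 x) := by
  refine tendsto_pi_nhds.2 fun i => tendsto_const_nhds.congr' ?_
  filter_upwards [eventually_ge_atTop i.natAbs] with K hK
  rw [truncate, if_pos]
  rw [Int.abs_eq_natAbs]
  exact_mod_cast hK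

/-- Bounded functions depending on finitely many coordinates and on the height are dense in `L²`. -/
lemma exists_isWindow_approx [NeZero m] {ν : Measure ((ℤ → Fin m) × ℝ)} [IsFiniteMeasure ν]
    {f : (ℤ → Fin m) × ℝ → ℂ} (hf : MemLp f 2 ν) {ε : ℝ≥0∞} (hε : 0 < ε) :
    ∃ (g : (ℤ → Fin m) × ℝ → ℂ) (K : ℕ) (D : ℝ), Measurable g ∧ (∀ z, ‖g z‖ ≤ D) ∧
      (∀ t, IsWindow K fun x => g (x, t)) ∧ ∫⁻ z, ‖f z - g z‖ₑ ^ 2 ∂ν ≤ ε := by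
  rcases eq_top_or_lt_top ε with htop | hεtop
  · exact ⟨0, 0, 0, measurable_const, by simp, fun t x y _ => rfl, htop ▸ le_top⟩
  have hε4 : 0 < ε / 4 := ENNReal.div_pos hε.ne' (by simp)
  have hδ : (ε / 4) ^ (1 / 2 : ℝ) ≠ 0 := by
    rw [Ne, ENNReal.rpow_eq_zero_iff_of_pos (by norm_num)]; exact hε4.ne'
  obtain ⟨g₀, hg₀, -⟩ := hf.exists_boundedContinuous_eLpNorm_sub_le (by simp) hδ
  have h1 : ∫⁻ z, ‖f z - g₀ z‖ₑ ^ 2 ∂ν ≤ ε / 4 := by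
    rw [eLpNorm_eq_lintegral_rpow_enorm_toReal (by simp) (by simp)] at hg₀
    have := (ENNReal.rpow_le_rpow_iff (by norm_num)).1 hg₀
    simpa using this
  let g : ℕ → (ℤ → Fin m) × ℝ → ℂ := fun K z => g₀ (truncate K z.1, z.2)
  have hgm : ∀ K, Measurable (g K) := fun K => g₀.continuous.measurable.comp
    (((measurable_truncate K).comp measurable_fst).prodMk measurable_snd)
  have h2 : Tendsto (fun K => ∫⁻ z, ‖g₀ z - g K z‖ₑ ^ 2 ∂ν) atTop (𝓝 (∫⁻ _, 0 ∂ν)) := by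
    refine tendsto_lintegral_of_dominated_convergence
      (fun _ => ENNReal.ofReal ((‖g₀‖ + ‖g₀‖) ^ 2))
      (fun K => (g₀.continuous.measurable.sub (hgm K)).enorm.pow_const 2)
      (fun K => ae_of_all _ fun z => ?_) ?_ (ae_of_all _ fun z => ?_)
    · dsimp only
      rw [← ofReal_norm, ← ENNReal.ofReal_pow (norm_nonneg _)]
      exact ENNReal.ofReal_le_ofReal (pow_le_pow_left₀ (norm_nonneg _) ((norm_sub_le _ _).trans
        (add_le_add (g₀.norm_coe_le_norm _) (g₀.norm_coe_le_norm _))) 2)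
    · rw [lintegral_const]
      exact (ENNReal.mul_lt_top ENNReal.ofReal_lt_top (measure_lt_top _ _)).ne
    · have h3 : Tendsto (fun K => g K z) atTop (𝓝 (g₀ z)) :=
        (g₀.continuous.tendsto z).comp ((tendsto_truncate z.1).prodMk_nhds tendsto_const_nhds)
      have h4 := ENNReal.Tendsto.pow (n := 2) ((tendsto_const_nhds (x := g₀ z)).sub h3).enorm
      simpa using h4
  rw [lintegral_zero] at h2
  obtain ⟨K, hK⟩ := ((tendsto_order.1 h2).2 _ hε4).exists
  refine ⟨g K, K, ‖g₀‖, hgm K, fun z => g₀.norm_coe_le_norm _, fun t x y hxy => ?_, ?_⟩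
  · have : truncate K x = truncate K y := by
      ext1 i
      unfold truncate
      split_ifs with hi
      · exact hxy i hi
      · rfl
    simp only [g, this]
  · calc ∫⁻ z, ‖f z - g K z‖ₑ ^ 2 ∂ν
        ≤ ∫⁻ z, (2 * ‖f z - g₀ z‖ₑ ^ 2 + 2 * ‖g₀ z - g K z‖ₑ ^ 2) ∂ν :=
          lintegral_mono fun z => by
            rw [← sub_add_sub_cancel (f z) (g₀ z)]
            exact enorm_add_sq_le _ _
      _ = 2 * ∫⁻ z, ‖f z - g₀ z‖ₑ ^ 2 ∂ν + 2 * ∫⁻ z, ‖g₀ z - g K z‖ₑ ^ 2 ∂ν := by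
          have hm : Measurable fun z => ‖g₀ z - g K z‖ₑ ^ 2 :=
            (g₀.continuous.measurable.sub (hgm K)).enorm.pow_const 2
          rw [lintegral_add_right _ (hm.const_mul 2),
            lintegral_const_mul' _ _ (by simp), lintegral_const_mul' _ _ (by simp)]
      _ ≤ 2 * (ε / 4) + 2 * (ε / 4) := by gcongr
      _ = ε := by
          rw [← add_mul, show (2 + 2 : ℝ≥0∞) = 4 by norm_num]
          exact ENNReal.mul_div_cancel (by simp) (by simp)

end Density

/-! ### Singularity of the spectrum -/

section Flow

variable {s : Fin m → ℝ}

lemma isWindow_floorIntegral {g : (ℤ → Fin m) × ℝ → ℂ} {K : ℕ}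
    (hg : ∀ t, IsWindow K fun x => g (x, t)) (ω : ℝ) : IsWindow K (floorIntegral s g ω) := by
  intro x y hxy
  have h0 : x 0 = y 0 := hxy 0 (by simp)
  have h1 : ∀ t, g (x, t) = g (y, t) := fun t => hg t x y hxy
  simp only [floorIntegral, h0, h1]

/-- If the cocycle grows at a rate `β < (1/2) log θ₁` along the orbit of `ω s`, the twisted integrals
over `[0, θ₁ⁿ]` are of smaller order than the square root of the length. -/
theorem tendsto_lintegral_twistedIntegral [NeZero m] (ζ : Substitution m) (hprim : ζ.IsPrimitive)
    (hs : ∀ a, 0 < s a) {μ : Measure (ℤ → Fin m)} (hμ : ζ.IsInvariantProbability μ)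
    {g : (ℤ → Fin m) × ℝ → ℂ} {K : ℕ} {D : ℝ} (hg : Measurable g) (hD : ∀ z, ‖g z‖ ≤ D)
    (hw : ∀ t, IsWindow K fun x => g (x, t)) {ω B β : ℝ} (hβ : 0 ≤ β)
    (hβθ : Real.exp (2 * β) < ζ.perronRoot) (hB0 : 0 ≤ B)
    (hB : open scoped Matrix.Norms.Operator in
      ∀ j k : ℕ, ‖ζ.cocycle (ζ.toralEndo^[j] fun a => ((ω * s a : ℝ) : UnitAddCircle)) k‖
        ≤ B * Real.exp (β * (j + k))) :
    Tendsto (fun n : ℕ => ENNReal.ofReal (1 / ζ.perronRoot ^ n) *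
      ∫⁻ y, ‖twistedIntegral (suspensionFlow s) g (ζ.perronRoot ^ n) ω y‖ₑ ^ 2
        ∂(suspensionMeasure μ s)) atTop (𝓝 0) := by
  obtain ⟨hprob, hsp, -⟩ := hμ
  have hD0 : 0 ≤ D := (norm_nonneg _).trans (hD (fun _ => 0, 0))
  obtain ⟨b, hb0, hb⟩ := exists_pos_le hs
  obtain ⟨aS, haS⟩ := Finite.exists_max s
  have hS0 := hs aS
  obtain ⟨c, hc0, hc⟩ := ζ.exists_perronRoot_pow_le_length hprim
  have hθ1 := ζ.one_le_perronRoot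
  set θ := ζ.perronRoot
  set S := s aS
  obtain ⟨K', hK', hsum⟩ := exists_norm_sum_le ζ (isWindow_floorIntegral hw ω)
    (norm_floorIntegral_le hs hD haS ω) hβ hB0 hB
  set k₀ : ℝ := (S + 1) * c / b
  have hk₀ : 0 ≤ k₀ := by positivity
  set C : ℝ := K' * (k₀ + 1) + 2 * D * S
  have hC : 0 ≤ C := by positivity
  have hpt : ∀ n : ℕ, ∀ᵐ y ∂(suspensionMeasure μ s),
      ‖twistedIntegral (suspensionFlow s) g (θ ^ n) ω y‖ ≤ C * (n + 1) ^ 2 * Real.exp (β * n) := by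
    intro n
    have hθn : 1 ≤ θ ^ n := one_le_pow₀ hθ1
    have hsp' : ∀ᵐ y ∂(suspensionMeasure μ s), y.1 ∈ ζ.space :=
      ae_restrict_of_ae (Measure.quasiMeasurePreserving_fst.ae hsp)
    filter_upwards [ae_restrict_mem (measurableSet_underRoof (s := s)), hsp'] with y hy hy1
    obtain ⟨J, hJ, hint⟩ := norm_integral_flow_le hs hg hD haS hb ω hy (R := θ ^ n) (by positivity)
    rw [intervalIntegral.integral_of_le (by positivity)] at hint
    obtain ⟨a₀, ha₀⟩ := Finite.exists_min fun a => (ζ.iterWord n a).length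
    obtain ⟨k, hkJ, hk⟩ := hsum n _ ha₀ y.1 hy1 J
    have hN : (0 : ℝ) < (ζ.iterWord n a₀).length := by
      exact_mod_cast List.length_pos_iff.2 (ζ.iterWord_ne_nil n a₀)
    -- `k` blocks of length at least `θⁿ / c` fit into a time interval of length `S + θⁿ`
    have hkk : (k : ℝ) ≤ k₀ := by
      rw [le_div_iff₀ hb0]
      have h1 : (k : ℝ) * (ζ.iterWord n a₀).length ≤ J := by exact_mod_cast hkJ
      have h2 := hc n a₀
      have h3 : (k : ℝ) * b * (ζ.iterWord n a₀).length ≤ (S + 1) * c * (ζ.iterWord n a₀).length := by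
        nlinarith
      exact le_of_mul_le_mul_right h3 hN
    have hE : 1 ≤ ((n : ℝ) + 1) ^ 2 * Real.exp (β * n) :=
      one_le_mul_of_one_le_of_one_le (one_le_pow₀ (by simp)) (Real.one_le_exp (by positivity))
    calc _ ≤ _ := hint
      _ ≤ K' * (n + 1) ^ 2 * Real.exp (β * n) * (k + 1) + 2 * D * S := by gcongr
      _ ≤ K' * (n + 1) ^ 2 * Real.exp (β * n) * (k₀ + 1) +
          2 * D * S * (((n : ℝ) + 1) ^ 2 * Real.exp (β * n)) := by
          refine add_le_add ?_ (le_mul_of_one_le_right (by positivity) hE)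
          gcongr
      _ = _ := by ring
  set V : ℝ := (suspensionMeasure μ s).real Set.univ
  have hbound : ∀ n : ℕ, ENNReal.ofReal (1 / θ ^ n) *
      ∫⁻ y, ‖twistedIntegral (suspensionFlow s) g (θ ^ n) ω y‖ₑ ^ 2 ∂(suspensionMeasure μ s) ≤
      ENNReal.ofReal (C ^ 2 * V * (((n : ℝ) + 1) ^ 4 * (Real.exp (2 * β) / θ) ^ n)) := by
    intro n
    have h1 : ∫⁻ y, ‖twistedIntegral (suspensionFlow s) g (θ ^ n) ω y‖ₑ ^ 2
        ∂(suspensionMeasure μ s) ≤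
        ENNReal.ofReal ((C * (n + 1) ^ 2 * Real.exp (β * n)) ^ 2) * ENNReal.ofReal V := by
      rw [ofReal_measureReal, ← lintegral_const]
      refine lintegral_mono_ae ?_
      filter_upwards [hpt n] with y hy
      rw [← ofReal_norm, ← ENNReal.ofReal_pow (norm_nonneg _)]
      exact ENNReal.ofReal_le_ofReal (pow_le_pow_left₀ (norm_nonneg _) hy 2)
    refine (mul_le_mul_right h1 _).trans (le_of_eq ?_)
    rw [← ENNReal.ofReal_mul (by positivity), ← ENNReal.ofReal_mul (by positivity)]
    congr 1
    have h2 : Real.exp (β * n) ^ 2 = Real.exp (2 * β) ^ n := by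
      rw [← Real.exp_nat_mul, ← Real.exp_nat_mul]; congr 1; push_cast; ring
    rw [mul_pow, h2, div_pow]
    ring
  have hr : |Real.exp (2 * β) / θ| < 1 := by
    rw [abs_of_pos (by positivity), div_lt_one (by positivity)]
    exact hβθ
  have hr0 : 0 < Real.exp (2 * β) / θ := by positivity
  have hlim : Tendsto (fun n : ℕ => C ^ 2 * V * (((n : ℝ) + 1) ^ 4 * (Real.exp (2 * β) / θ) ^ n))
      atTop (𝓝 0) := by
    have h1 := ((tendsto_pow_const_mul_const_pow_of_abs_lt_one 4 hr).comp
      (tendsto_add_atTop_nat 1)).const_mul (C ^ 2 * V / (Real.exp (2 * β) / θ))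
    rw [mul_zero] at h1
    refine h1.congr fun n => ?_
    simp only [Function.comp_apply]
    rw [pow_succ _ n]
    push_cast
    field_simp
  have hlim' := ENNReal.tendsto_ofReal hlim
  rw [ENNReal.ofReal_zero] at hlim'
  exact tendsto_of_tendsto_of_tendsto_of_le_of_le tendsto_const_nhds hlim' (fun _ => zero_le) hbound

/-- If the line `ω ↦ ω s` in the torus almost surely avoids the points where the cocycle grows
faster than at the rate `β < (1/2) log θ₁`, the suspension flow has purely singular spectrum. -/
theorem hasPurelySingularSpectrum_suspensionFlow [NeZero m] (ζ : Substitution m)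
    (hprim : ζ.IsPrimitive) (hs : ∀ a, 0 < s a) {μ : Measure (ℤ → Fin m)}
    (hμ : ζ.IsInvariantProbability μ) {β : ℝ} (hβ : 0 ≤ β)
    (hβθ : Real.exp (2 * β) < ζ.perronRoot)
    (hB : open scoped Matrix.Norms.Operator in ∀ᵐ ω : ℝ, ∃ B : ℝ, 0 ≤ B ∧
      ∀ j k : ℕ, ‖ζ.cocycle (ζ.toralEndo^[j] fun a => ((ω * s a : ℝ) : UnitAddCircle)) k‖
        ≤ B * Real.exp (β * (j + k))) :
    HasPurelySingularSpectrum (suspensionMeasure μ s) (suspensionFlow s) := by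
  intro f hf σ hσ
  have hprob := hμ.1
  have hmp := measurePreserving_suspensionFlow hs hμ.2.2
  have hθ1 : 1 < ζ.perronRoot := (Real.one_le_exp (by positivity)).trans_lt hβθ
  obtain ⟨f', hf'm, hff'⟩ := hf.1
  have hf' : MemLp f' 2 (suspensionMeasure μ s) := (memLp_congr_ae hff').1 hf
  refine mutuallySingular_of_approx hmp (measurable_suspensionFlow hs)
    (suspensionFlow_suspensionFlow hs) hf'm.measurable (lintegral_enorm_sq_lt_top hf')
    (isSpectralMeasure_congr hmp hff' hσ) (R := fun n => ζ.perronRoot ^ n)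
    (fun n => by positivity) (tendsto_pow_atTop_atTop_of_one_lt hθ1) fun ε hε => ?_
  obtain ⟨g, K, D, hg, hD, hw, hfg⟩ := exists_isWindow_approx hf' hε
  have hg2 : MemLp g 2 (suspensionMeasure μ s) :=
    MemLp.of_bound hg.aestronglyMeasurable D (ae_of_all _ hD)
  refine ⟨g, hg, lintegral_enorm_sq_lt_top hg2, hfg, ?_⟩
  filter_upwards [hB] with ω ⟨B, hB0, hBω⟩
  exact tendsto_lintegral_twistedIntegral ζ hprim hs hμ hg hD hw hβ hβθ hB0 hBω

lemma IsLipCylindrical.memLp (hs : ∀ a, 0 < s a) {f : (ℤ → Fin m) × ℝ → ℂ}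
    (hf : IsLipCylindrical s f) (μ : Measure (ℤ → Fin m)) [IsProbabilityMeasure μ] :
    MemLp f 2 (suspensionMeasure μ s) := by
  obtain ⟨ψ, hψ, hfψ⟩ := hf
  have hcont : ∀ a, ContinuousOn (ψ a) (Set.Icc 0 (s a)) := fun a => (hψ a).choose_spec.continuousOn
  choose C hC using fun a => isCompact_Icc.exists_bound_of_continuousOn (hcont a)
  have hmem := ae_restrict_mem (μ := μ.prod volume) (measurableSet_underRoof (s := s))
  -- extend the functions `ψ a` continuously from `[0, s a]` to `ℝ`, to have measurability
  have hext : ∀ a, Continuous (Set.IccExtend (hs a).le ((Set.Icc 0 (s a)).domRestrict (ψ a))) :=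
    fun a => (continuousOn_iff_continuous_domRestrict.1 (hcont a)).Icc_extend'
  have hmeas : Measurable fun y : (ℤ → Fin m) × ℝ =>
      Set.IccExtend (hs (y.1 0)).le ((Set.Icc 0 (s (y.1 0))).domRestrict (ψ (y.1 0))) y.2 := by
    have h1 : Measurable fun q : Fin m × ℝ =>
        Set.IccExtend (hs q.1).le ((Set.Icc 0 (s q.1)).domRestrict (ψ q.1)) q.2 :=
      measurable_from_prod_countable_right fun a => (hext a).measurable
    have h2 : Measurable fun y : (ℤ → Fin m) × ℝ => (y.1 0, y.2) :=
      ((measurable_pi_apply 0).comp measurable_fst).prodMk measurable_snd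
    exact h1.comp h2
  refine MemLp.of_bound (C := ∑ a, |C a|) ⟨_, hmeas.stronglyMeasurable, ?_⟩ ?_
  · filter_upwards [hmem] with y hy
    rw [hfψ y hy, Set.IccExtend_of_mem _ _ ⟨hy.1, hy.2.le⟩]
    rfl
  · filter_upwards [hmem] with y hy
    rw [hfψ y hy]
    exact ((hC _ _ ⟨hy.1, hy.2.le⟩).trans (le_abs_self _)).trans
      (Finset.single_le_sum (f := fun a => |C a|) (fun a _ => abs_nonneg _) (Finset.mem_univ _))

end Flow

end SpectralCocycle

open SpectralCocycle in
theorem corollary4p6 (m : ℕ) (hm : 2 ≤ m) (ζ : Substitution m)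
    (hprim : ζ.IsPrimitive) (haper : ζ.IsAperiodic)
    (herg : Ergodic ζ.toralEndo (volume : Measure (Fin m → UnitAddCircle))) :
    ∃ χ : ℝ, ζ.IsTopLyapunovExponent χ ∧
      χ ≤ (1 / 2) * Real.log ζ.perronRoot ∧
      (χ < (1 / 2) * Real.log ζ.perronRoot →
        ∀ μ : Measure (ℤ → Fin m), ζ.IsInvariantProbability μ →
          ∀ᵐ s ∂(volume : Measure (Fin m → ℝ)), (∀ a, 0 < s a) →
            ∀ f : (ℤ → Fin m) × ℝ → ℂ, IsLipCylindrical s f →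
              ∀ σ : Measure ℝ,
                IsSpectralMeasure (suspensionMeasure μ s) (suspensionFlow s) f σ →
                  σ ⟂ₘ volume) ∧
      (χ < (1 / 2) * Real.log ζ.perronRoot → (∃ ξ, (ζ.spectralMatrix ξ).det ≠ 0) →
        ∀ μ : Measure (ℤ → Fin m), ζ.IsInvariantProbability μ →
          ∀ᵐ s ∂(volume : Measure (Fin m → ℝ)), (∀ a, 0 < s a) →
            HasPurelySingularSpectrum (suspensionMeasure μ s) (suspensionFlow s)) := by
  have : NeZero m := ⟨by omega⟩
  obtain ⟨χ, hχ0, hχ, hgrowth⟩ := exists_lyapunov ζ herg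
  have key : χ < (1 / 2) * Real.log ζ.perronRoot →
      ∀ μ : Measure (ℤ → Fin m), ζ.IsInvariantProbability μ →
        ∀ᵐ s ∂(volume : Measure (Fin m → ℝ)), (∀ a, 0 < s a) →
          HasPurelySingularSpectrum (suspensionMeasure μ s) (suspensionFlow s) := by
    intro hlt μ hμ
    obtain ⟨β, hχβ, hβ⟩ := exists_between hlt
    have hβθ : Real.exp (2 * β) < ζ.perronRoot := by
      rw [← Real.lt_log_iff_exp_lt (one_pos.trans_le ζ.one_le_perronRoot)]
      linarith
    filter_upwards [ae_ae_smul_torus (hgrowth β hχβ)] with s hgen hs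
    exact hasPurelySingularSpectrum_suspensionFlow ζ hprim hs hμ (hχ0.trans hχβ.le) hβθ hgen
  refine ⟨χ, hχ, lyapunov_le ζ hχ, fun hlt μ hμ => ?_, fun hlt _ => key hlt⟩
  have hprob := hμ.1
  filter_upwards [key hlt μ hμ] with s h hs f hf σ hσ
  exact h hs f (hf.memLp hs μ) σ hσ
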